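/- Let $k$ be a field. **Deformation cohomology.** Let $\mathcal C$ be a $k$-linear monoidal category. For $n\ge 0$ let $E^n(\mathcal C)$ be the $k$-vector space of all families of endomorphisms $a_{X_1,\dots,X_n}\colon X_1\otimes\cdots\otimes X_n\to X_1\otimes\cdots\otimes X_n$ that are natural in each of $X_1,\dots,X_n\in\mathcal C$ (so $E^0(\mathcal C)=\mathrm{End}(\mathbf 1)$). Up to the associativity and unit isomorphisms of $\mathcal C$, put, for $a\in E^n(\mathcal C)$, $$(\partial_0a)_{X_1,\dots,X_{n+1}}=1_{X_1}\otimes a_{X_2,\dots,X_{n+1}},\qquad (\partial_{n+1}a)_{X_1,\dots,X_{n+1}}=a_{X_1,\dots,X_n}\otimes 1_{X_{n+1}},$$ $$(\partial_ia)_{X_1,\dots,X_{n+1}}=a_{X_1,\dots,X_i\otimes X_{i+1},\dots,X_{n+1}}\quad(1\le i\le n),$$ and $\partial=\sum_{i=0}^{n+1}(-1)^i\partial_i\colon E^n(\mathcal C)\to E^{n+1}(\mathcal C)$. The *deformation cohomology* $H^*(\mathcal C)$ is the cohomology of the complex $(E^*(\mathcal C),\partial)$. It is a graded algebra under the cup product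 induced by $$(a\cup b)_{X_1,\dots,X_{m+n}}=a_{X_1,\dots,X_m}\otimes b_{X_{m+1},\dots,X_{m+n}},$$ with unit the class of $1_{\mathbf 1}\in E^0(\mathcal C)$. **The degenerate affine Hecke category.** For $n\ge 0$ the degenerate affine Hecke algebra $\Lambda_n$ is the unital associative $k$-algebra with generators $t_1,\dots,t_{n-1},y_1,\dots,y_n$ and relations $$t_i^2=1,\quad t_it_{i+1}t_i=t_{i+1}t_it_{i+1},\quad t_it_j=t_jt_i\ (|i-j|>1),$$ $$y_it_i-t_iy_{i+1}=1,\quad y_iy_j=y_jy_i,\quad t_iy_j=y_jt_i\ (j\ne i,i+1).$$ There are algebra homomorphisms $\Lambda_m\otimes\Lambda_n\to\Lambda_{m+n}$, $t_i\otimes1\mapsto t_i$, $1\otimes t_j\mapsto t_{j+m}$, $y_i\otimes 1\mapsto y_i$, $1\otimes y_j\mapsto y_{j+m}$. The degenerate affine Hecke category $\mathcal L$ is the Schur–Weyl category of this sequence of algebras: its objects are $[n]$, $n\in\mathbb N$; $\mathrm{End}([n])=\Lambda_n$ and $\mathrm{Hom}([m],[n])=0$ for $m\ne n$; composition is multiplication;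 $[m]\otimes[n]=[m+n]$, and the tensor product of morphisms is given by $\Lambda_m\otimes\Lambda_n\to\Lambda_{m+n}$. **Theorem.** 1. The deformation cohomology of $\mathcal L$ is the exterior algebra of the vector space $k[x]$: there is an isomorphism of graded algebras $$H^*(\mathcal L)\;\simeq\;\Lambda^*(k[x]).$$ 2. For natural numbers $m_1,\dots,m_r$ ($r\ge 0$), let $C(m_1,\dots,m_r)$ be the centralizer in $\Lambda_{m_1+\cdots+m_r}$ of the image of $\Lambda_{m_1}\otimes\cdots\otimes\Lambda_{m_r}$, and let $S^m(k[x])=(k[x]^{\otimes m})^{S_m}$ be the algebra of tensors invariant under permutation of the factors. Then there is an isomorphism of algebras $$S^{m_1}(k[x])\otimes\cdots\otimes S^{m_r}(k[x])\;\simeq\;C(m_1,\dots,m_r),$$ namely the restriction of the homomorphism $k[x]^{\otimes(m_1+\cdots+m_r)}\to\Lambda_{m_1+\cdots+m_r}$, $p_1\otimes p_2\otimes\cdots\mapsto p_1(y_1)\,p_2(y_2)\cdots$. -/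

import Mathlib

open CategoryTheory MonoidalCategory
open scoped TensorProduct

universe u v w

set_option linter.unusedSectionVars false

namespace TensorDeformation

noncomputable section

/-! ### The deformation complex of a linear monoidal category -/

section Complex

variable {C : Type u} [Category.{v} C] [MonoidalCategory C]

/-- The tensor product `X₁ ⊗ (X₂ ⊗ (⋯ ⊗ (Xₙ ⊗ 𝟙_)))` of a list of objects. -/
def tens : List C → C
  | [] => 𝟙_ C
  | X :: l => X ⊗ tens l

/-- Families of morphisms `fᵢ : Xᵢ ⟶ Yᵢ` between the entries of two lists of the same length. -/
inductive HomList : List C → List C → Type (max u v)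
  | nil : HomList [] []
  | cons {X Y : C} {l l' : List C} (f : X ⟶ Y) (fs : HomList l l') : HomList (X :: l) (Y :: l')

/-- The tensor product `f₁ ⊗ ⋯ ⊗ fₙ` of a family of morphisms. -/
def tensHom : {l l' : List C} → HomList l l' → (tens l ⟶ tens l')
  | _, _, .nil => 𝟙 _
  | _, _, .cons f fs => f ⊗ₘ tensHom fs

/-- `merge i [X₀, X₁, …]` replaces the two consecutive entries `Xᵢ, Xᵢ₊₁` by the single entry
`Xᵢ ⊗ Xᵢ₊₁`; the value when there are no such entries is irrelevant. -/
def merge : ℕ → List C → List C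
  | 0, X :: Y :: l => (X ⊗ Y) :: l
  | 0, [X] => [X]
  | i + 1, X :: l => X :: merge i l
  | _, [] => []

/-- The canonical associativity isomorphism `⋯ ⊗ (Xᵢ ⊗ Xᵢ₊₁) ⊗ ⋯ ≅ ⋯ ⊗ Xᵢ ⊗ Xᵢ₊₁ ⊗ ⋯`. -/
def mergeIso : (i : ℕ) → (l : List C) → (tens (merge i l) ≅ tens l)
  | 0, X :: Y :: l => α_ X Y (tens l)
  | 0, [X] => Iso.refl (tens [X])
  | i + 1, X :: l => whiskerLeftIso X (mergeIso i l)
  | 0, [] => Iso.refl _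
  | _ + 1, [] => Iso.refl _

/-- The canonical isomorphism `X₁ ⊗ ⋯ ⊗ Xₙ ≅ (X₁ ⊗ ⋯ ⊗ Xₘ) ⊗ (Xₘ₊₁ ⊗ ⋯ ⊗ Xₙ)`. -/
def splitIso : (m : ℕ) → (l : List C) → (tens l ≅ tens (l.take m) ⊗ tens (l.drop m))
  | 0, l => (λ_ (tens l)).symm
  | _ + 1, [] => (λ_ (𝟙_ C)).symm
  | m + 1, X :: l => whiskerLeftIso X (splitIso m l) ≪≫ (α_ X _ _).symm

theorem length_merge : ∀ (i : ℕ) (l : List C), i + 1 < l.length →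
    (merge i l).length = l.length - 1
  | 0, X :: Y :: l, _ => by simp [merge]
  | 0, [X], h => by simp at h
  | i + 1, X :: l, h => by
      have h' : i + 1 < l.length := by simpa using h
      simp only [merge, List.length_cons, length_merge i l h']
      omega
  | 0, [], h => by simp at h
  | _ + 1, [], h => by simp at h

def mergeHom : (i : ℕ) → {l l' : List C} → HomList l l' → HomList (merge i l) (merge i l')
  | 0, _, _, .cons f (.cons g fs) => .cons (f ⊗ₘ g) fs
  | 0, _, _, .cons f .nil => .cons f .nil
  | i + 1, _, _, .cons f fs => .cons f (mergeHom i fs)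
  | 0, _, _, .nil => .nil
  | _ + 1, _, _, .nil => .nil

def takeHom : (m : ℕ) → {l l' : List C} → HomList l l' → HomList (l.take m) (l'.take m)
  | 0, _, _, _ => .nil
  | _ + 1, _, _, .nil => .nil
  | m + 1, _, _, .cons f fs => .cons f (takeHom m fs)

def dropHom : (m : ℕ) → {l l' : List C} → HomList l l' → HomList (l.drop m) (l'.drop m)
  | 0, _, _, fs => fs
  | _ + 1, _, _, .nil => .nil
  | m + 1, _, _, .cons _ fs => dropHom m fs

theorem mergeIso_naturality : ∀ (i : ℕ) {l l' : List C} (f : HomList l l'),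
    tensHom (mergeHom i f) ≫ (mergeIso i l').hom = (mergeIso i l).hom ≫ tensHom f
  | 0, _, _, .cons f (.cons g fs) => associator_naturality f g (tensHom fs)
  | 0, _, _, .cons f .nil => (Category.comp_id _).trans (Category.id_comp _).symm
  | i + 1, X :: l, Y :: l', .cons f fs => by
      change (f ⊗ₘ tensHom (mergeHom i fs)) ≫ (Y ◁ (mergeIso i l').hom) =
        (X ◁ (mergeIso i l).hom) ≫ (f ⊗ₘ tensHom fs)
      rw [← id_tensorHom, ← id_tensorHom, tensorHom_comp_tensorHom, tensorHom_comp_tensorHom,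
        mergeIso_naturality i fs, Category.comp_id, Category.id_comp]
  | 0, _, _, .nil => (Category.comp_id _).trans (Category.id_comp _).symm
  | _ + 1, _, _, .nil => (Category.comp_id _).trans (Category.id_comp _).symm

theorem splitIso_naturality : ∀ (m : ℕ) {l l' : List C} (f : HomList l l'),
    tensHom f ≫ (splitIso m l').hom =
      (splitIso m l).hom ≫ (tensHom (takeHom m f) ⊗ₘ tensHom (dropHom m f))
  | 0, l, l', fs => by
      change tensHom fs ≫ (λ_ (tens l')).inv = (λ_ (tens l)).inv ≫ (𝟙 (𝟙_ C) ⊗ₘ tensHom fs)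
      rw [id_tensorHom, leftUnitor_inv_naturality]
  | _ + 1, _, _, .nil => by
      change 𝟙 (𝟙_ C) ≫ (λ_ (𝟙_ C)).inv = (λ_ (𝟙_ C)).inv ≫ (𝟙 (𝟙_ C) ⊗ₘ 𝟙 (𝟙_ C))
      simp
  | m + 1, X :: l, Y :: l', .cons f fs => by
      change (f ⊗ₘ tensHom fs) ≫ (Y ◁ (splitIso m l').hom) ≫ (α_ Y _ _).inv =
        ((X ◁ (splitIso m l).hom) ≫ (α_ X _ _).inv) ≫
          ((f ⊗ₘ tensHom (takeHom m fs)) ⊗ₘ tensHom (dropHom m fs))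
      rw [← id_tensorHom, ← id_tensorHom, tensorHom_comp_tensorHom_assoc, Category.comp_id,
        splitIso_naturality m fs, Category.assoc, ← associator_inv_naturality,
        tensorHom_comp_tensorHom_assoc, Category.id_comp]

variable (k : Type w) [Field k] [Preadditive C] [Linear k C]

variable (C) in
/-- The families of endomorphisms `a_{X₁, …, Xₙ}` of `X₁ ⊗ ⋯ ⊗ Xₙ` that are natural in each
`Xᵢ`, as a subspace of the space of all families. -/
def naturalFamilies (n : ℕ) : Submodule k (∀ X : List.Vector C n, tens X.1 ⟶ tens X.1) where
  carrier := {a | ∀ (X Y : List.Vector C n) (f : HomList X.1 Y.1),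
    tensHom f ≫ a Y = a X ≫ tensHom f}
  zero_mem' := by intro X Y f; simp
  add_mem' := by intro a b ha hb X Y f; simp [ha X Y f, hb X Y f]
  smul_mem' := by intro c a ha X Y f; simp [ha X Y f]

variable (C) in
/-- The `n`-th term `Eⁿ(C)` of the deformation complex: the natural families of endomorphisms. -/
def E (n : ℕ) : Type (max u v) := naturalFamilies C k n

instance (n : ℕ) : AddCommGroup (E C k n) :=
  inferInstanceAs (AddCommGroup (naturalFamilies C k n))

instance (n : ℕ) : Module k (E C k n) :=
  inferInstanceAs (Module k (naturalFamilies C k n))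

variable {k} {n : ℕ}

/-- The component `a_{X₁, …, Xₙ}` of a family `a`. -/
def E.app (a : E C k n) (l : List C) (h : l.length = n) : tens l ⟶ tens l := a.1 ⟨l, h⟩

theorem E.ext {a b : E C k n} (h : ∀ l hl, a.app l hl = b.app l hl) : a = b :=
  Subtype.ext (funext fun X => h X.1 X.2)

theorem E.app_add (a b : E C k n) (l : List C) (h : l.length = n) :
    (a + b).app l h = a.app l h + b.app l h := rfl

theorem E.app_smul (c : k) (a : E C k n) (l : List C) (h : l.length = n) :
    (c • a).app l h = c • a.app l h := rfl

theorem E.naturality (a : E C k n) {l l' : List C} (f : HomList l l') (h : l.length = n)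
    (h' : l'.length = n) : tensHom f ≫ a.app l' h' = a.app l h ≫ tensHom f :=
  a.2 ⟨l, h⟩ ⟨l', h'⟩ f

variable [MonoidalPreadditive C] [MonoidalLinear k C]

/-- `∂₀(a)_{X₁, …, Xₙ₊₁} = 1_{X₁} ⊗ a_{X₂, …, Xₙ₊₁}`. -/
def cofaceFirst : E C k n →ₗ[k] E C k (n + 1) where
  toFun a := ⟨fun
    | ⟨X :: l, h⟩ => X ◁ a.app l (Nat.succ.inj h), by
      rintro ⟨_ | ⟨X, l⟩, hX⟩ ⟨_ | ⟨Y, l'⟩, hY⟩ f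
      · simp at hX
      · simp at hX
      · simp at hY
      · cases f with
        | cons f fs =>
          change (f ⊗ₘ tensHom fs) ≫ Y ◁ a.app l' _ = X ◁ a.app l _ ≫ (f ⊗ₘ tensHom fs)
          rw [← id_tensorHom, ← id_tensorHom, tensorHom_comp_tensorHom, tensorHom_comp_tensorHom,
            Category.comp_id, Category.id_comp,
            a.naturality fs (Nat.succ.inj hX) (Nat.succ.inj hY)]⟩
  map_add' a b := by
    refine Subtype.ext (funext ?_)
    rintro ⟨_ | ⟨X, l⟩, h⟩
    · simp at h
    · exact MonoidalPreadditive.whiskerLeft_add _ _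
  map_smul' c a := by
    refine Subtype.ext (funext ?_)
    rintro ⟨_ | ⟨X, l⟩, h⟩
    · simp at h
    · exact MonoidalLinear.whiskerLeft_smul _ _ _

/-- `∂ᵢ₊₁(a)_{X₁, …, Xₙ₊₁} = a_{X₁, …, Xᵢ₊₁ ⊗ Xᵢ₊₂, …, Xₙ₊₁}` for `0 ≤ i < n`, transported along
the associativity isomorphism. -/
def cofaceInner (i : Fin n) : E C k n →ₗ[k] E C k (n + 1) where
  toFun a := ⟨fun X =>
    (mergeIso i X.1).inv ≫
      a.app (merge i X.1) (by rw [length_merge _ _ (by simp [X.2]), X.2]; rfl) ≫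
      (mergeIso i X.1).hom, by
    intro X Y f
    rw [← cancel_epi (mergeIso i X.1).hom, ← cancel_mono (mergeIso i Y.1).inv]
    have hf := mergeIso_naturality i f
    have hf' : tensHom f ≫ (mergeIso i Y.1).inv =
        (mergeIso i X.1).inv ≫ tensHom (mergeHom i f) := by
      rw [Iso.comp_inv_eq, Category.assoc, hf, Iso.inv_hom_id_assoc]
    simp only [Category.assoc, Iso.hom_inv_id, Category.comp_id, Iso.hom_inv_id_assoc]
    rw [hf', ← reassoc_of% hf, Iso.hom_inv_id_assoc, Iso.hom_inv_id_assoc]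
    exact a.naturality (mergeHom i f) _ _⟩
  map_add' a b := by
    refine Subtype.ext (funext fun X => ?_)
    simp only [E.app_add, Preadditive.comp_add, Preadditive.add_comp]
    rfl
  map_smul' c a := by
    refine Subtype.ext (funext fun X => ?_)
    simp only [E.app_smul, Linear.comp_smul, Linear.smul_comp, RingHom.id_apply]
    rfl

/-- The cup product
`(a ∪ b)_{X₁, …, Xₘ₊ₙ} = a_{X₁, …, Xₘ} ⊗ b_{Xₘ₊₁, …, Xₘ₊ₙ}`. -/
def cup {m n : ℕ} (a : E C k m) (b : E C k n) : E C k (m + n) :=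
  ⟨fun X =>
    (splitIso m X.1).hom ≫
      (a.app (X.1.take m) (by simp [X.2]) ⊗ₘ b.app (X.1.drop m) (by simp [X.2])) ≫
      (splitIso m X.1).inv, by
    intro X Y f
    have hf := splitIso_naturality m f
    have hf' : (tensHom (takeHom m f) ⊗ₘ tensHom (dropHom m f)) ≫ (splitIso m Y.1).inv =
        (splitIso m X.1).inv ≫ tensHom f := by
      rw [Iso.comp_inv_eq, Category.assoc, hf, Iso.inv_hom_id_assoc]
    rw [reassoc_of% hf, Category.assoc, Category.assoc, ← hf', tensorHom_comp_tensorHom_assoc,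
      tensorHom_comp_tensorHom_assoc,
      a.naturality (takeHom m f) (by simp [X.2]) (by simp [Y.2]),
      b.naturality (dropHom m f) (by simp [X.2]) (by simp [Y.2])]⟩

variable (C k) in
/-- The unit `1_{X₁ ⊗ ⋯ ⊗ Xₙ}` of the algebra of natural endomorphisms. -/
def one (n : ℕ) : E C k n :=
  ⟨fun _ => 𝟙 _, by intro X Y f; simp⟩

/-- `∂ₙ₊₁(a)_{X₁, …, Xₙ₊₁} = a_{X₁, …, Xₙ} ⊗ 1_{Xₙ₊₁}`. -/
def cofaceLast : E C k n →ₗ[k] E C k (n + 1) where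
  toFun a := cup a (one C k 1)
  map_add' a b := by
    refine Subtype.ext (funext fun X => ?_)
    simp only [cup, E.app_add, MonoidalPreadditive.add_tensor,
      Preadditive.comp_add, Preadditive.add_comp]
    rfl
  map_smul' c a := by
    refine Subtype.ext (funext fun X => ?_)
    simp only [cup, E.app_smul, MonoidalCategory.tensorHom_def, MonoidalLinear.smul_whiskerRight,
      Linear.comp_smul, Linear.smul_comp, RingHom.id_apply]
    rfl

variable (C k) in
/-- The differential `∂ = ∑ᵢ (-1)ⁱ ∂ᵢ` of the deformation complex. -/
def d (n : ℕ) : E C k n →ₗ[k] E C k (n + 1) :=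
  cofaceFirst + ∑ i : Fin n, (-1 : k) ^ ((i : ℕ) + 1) • cofaceInner i +
    (-1 : k) ^ (n + 1) • cofaceLast

end Complex

/-! ### The Leibniz rule -/

section Leibniz

variable {C : Type u} [Category.{v} C] [MonoidalCategory C]

def HomList.refl : (l : List C) → HomList l l
  | [] => .nil
  | X :: l => .cons (𝟙 X) (HomList.refl l)

@[simp] theorem tensHom_refl : (l : List C) → tensHom (HomList.refl l) = 𝟙 (tens l)
  | [] => rfl
  | X :: l => by
      change (𝟙 X ⊗ₘ tensHom (HomList.refl l)) = _
      rw [tensHom_refl l, id_tensorHom_id]; rfl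

theorem split_merge_left : ∀ (i m : ℕ) (l : List C), i < m → i + 1 < l.length →
    ∃ (φ : HomList ((merge i l).take m) (merge i (l.take (m + 1))))
      (ψ : HomList ((merge i l).drop m) (l.drop (m + 1))),
      (splitIso m (merge i l)).hom ≫ (tensHom φ ⊗ₘ tensHom ψ) ≫
        (mergeIso i (l.take (m + 1))).hom ▷ tens (l.drop (m + 1)) =
      (mergeIso i l).hom ≫ (splitIso (m + 1) l).hom
  | _, 0, _, h, _ => absurd h (Nat.not_lt_zero _)
  | _, _ + 1, [], _, h => by simp at h
  | 0, m + 1, [X], _, h => by simp at h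
  | 0, m + 1, X :: Y :: l, _, _ => by
      refine ⟨HomList.refl ((X ⊗ Y) :: l.take m), HomList.refl (l.drop m), ?_⟩
      change ((X ⊗ Y) ◁ (splitIso m l).hom ≫ (α_ (X ⊗ Y) _ _).inv) ≫
          ((𝟙 (X ⊗ Y) ⊗ₘ tensHom (HomList.refl (l.take m))) ⊗ₘ
            tensHom (HomList.refl (l.drop m))) ≫
          (α_ X Y (tens (l.take m))).hom ▷ _ =
        (α_ X Y (tens l)).hom ≫ X ◁ (Y ◁ (splitIso m l).hom ≫ (α_ Y _ _).inv) ≫ (α_ X _ _).inv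
      rw [tensHom_refl, tensHom_refl, id_tensorHom_id, id_tensorHom_id]
      generalize (splitIso m l).hom = s
      generalize tens (l.take m) = T at s ⊢
      generalize tens (l.drop m) = D at s ⊢
      generalize tens l = L at s ⊢
      monoidal
  | i + 1, m + 1, X :: l, h, h' => by
      obtain ⟨φ, ψ, e⟩ := split_merge_left i m l (by omega) (by simpa using h')
      refine ⟨.cons (𝟙 X) φ, ψ, ?_⟩
      change (X ◁ (splitIso m (merge i l)).hom ≫ (α_ X _ _).inv) ≫
        ((𝟙 X ⊗ₘ tensHom φ) ⊗ₘ tensHom ψ) ≫ (X ◁ (mergeIso i (l.take (m + 1))).hom) ▷ _ =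
        X ◁ (mergeIso i l).hom ≫ X ◁ (splitIso (m + 1) l).hom ≫ (α_ X _ _).inv
      rw [← whiskerLeft_comp_assoc, ← e]
      simp [MonoidalCategory.tensorHom_def]

theorem split_merge_right : ∀ (i m : ℕ) (l : List C), m + i + 1 < l.length →
    ∃ (φ : HomList ((merge (m + i) l).take m) (l.take m))
      (ψ : HomList ((merge (m + i) l).drop m) (merge i (l.drop m))),
      (splitIso m (merge (m + i) l)).hom ≫ (tensHom φ ⊗ₘ tensHom ψ) ≫
        tens (l.take m) ◁ (mergeIso i (l.drop m)).hom =
      (mergeIso (m + i) l).hom ≫ (splitIso m l).hom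
  | i, 0, l, _ => by
      rw [Nat.zero_add]
      refine ⟨HomList.refl [], HomList.refl _, ?_⟩
      change (λ_ (tens (merge i l))).inv ≫ (𝟙 (𝟙_ C) ⊗ₘ tensHom (HomList.refl (merge i l))) ≫
        𝟙_ C ◁ (mergeIso i l).hom = (mergeIso i l).hom ≫ (λ_ (tens l)).inv
      rw [tensHom_refl, id_tensorHom_id, Category.id_comp, leftUnitor_inv_naturality]
  | _, _ + 1, [], h => by simp at h
  | i, m + 1, X :: l, h => by
      obtain ⟨φ, ψ, e⟩ := split_merge_right i m l (by simp at h; omega)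
      have hm : m + 1 + i = m + i + 1 := by omega
      rw [hm]
      refine ⟨.cons (𝟙 X) φ, ψ, ?_⟩
      change (X ◁ (splitIso m (merge (m + i) l)).hom ≫ (α_ X _ _).inv) ≫
        ((𝟙 X ⊗ₘ tensHom φ) ⊗ₘ tensHom ψ) ≫ _ ◁ (mergeIso i (l.drop m)).hom =
        X ◁ (mergeIso (m + i) l).hom ≫ X ◁ (splitIso m l).hom ≫ (α_ X _ _).inv
      rw [← whiskerLeft_comp_assoc, ← e]
      simp [MonoidalCategory.tensorHom_def]

theorem split_split : ∀ (m n N : ℕ) (l : List C), N = m + n → N ≤ l.length →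
    ∃ (φ : HomList ((l.take N).take m) (l.take m))
      (ψ : HomList ((l.take N).drop m) ((l.drop m).take n))
      (χ : HomList (l.drop N) ((l.drop m).drop n)),
      (splitIso N l).hom ≫ (splitIso m (l.take N)).hom ▷ tens (l.drop N) ≫
        ((tensHom φ ⊗ₘ tensHom ψ) ⊗ₘ tensHom χ) ≫ (α_ _ _ _).hom =
      (splitIso m l).hom ≫ tens (l.take m) ◁ (splitIso n (l.drop m)).hom
  | 0, n, N, l, h, _ => by
      obtain rfl : N = n := by omega
      refine ⟨HomList.refl [], HomList.refl _, HomList.refl _, ?_⟩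
      change (splitIso N l).hom ≫ (λ_ _).inv ▷ _ ≫
        ((𝟙 (𝟙_ C) ⊗ₘ tensHom (HomList.refl (l.take N))) ⊗ₘ tensHom (HomList.refl (l.drop N))) ≫
          (α_ (𝟙_ C) _ _).hom =
        (λ_ (tens l)).inv ≫ 𝟙_ C ◁ (splitIso N l).hom
      rw [tensHom_refl, tensHom_refl, ← leftUnitor_inv_naturality, id_tensorHom_id, id_tensorHom_id, Category.id_comp,
        leftUnitor_inv_whiskerRight]
      simp
  | m + 1, n, N + 1, [], _, h => by simp at h
  | m + 1, n, N + 1, X :: l, h, h' => by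
      obtain ⟨φ, ψ, χ, e⟩ := split_split m n N l (by omega) (by simpa using h')
      refine ⟨.cons (𝟙 X) φ, ψ, χ, ?_⟩
      change (X ◁ (splitIso N l).hom ≫ (α_ X _ _).inv) ≫
        (X ◁ (splitIso m (l.take N)).hom ≫ (α_ X _ _).inv) ▷ _ ≫
        (((𝟙 X ⊗ₘ tensHom φ) ⊗ₘ tensHom ψ) ⊗ₘ tensHom χ) ≫ (α_ (X ⊗ _) _ _).hom =
        (X ◁ (splitIso m l).hom ≫ (α_ X _ _).inv) ≫ (X ⊗ _) ◁ (splitIso n (l.drop m)).hom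
      have e' : X ◁ (splitIso m l).hom ≫ X ◁ (tens (l.take m) ◁ (splitIso n (l.drop m)).hom) =
        _ := (whiskerLeft_comp _ _ _).symm.trans (congrArg (X ◁ ·) e.symm)
      rw [Category.assoc (X ◁ (splitIso m l).hom), ← associator_inv_naturality_right,
        reassoc_of% e']
      simp [MonoidalCategory.tensorHom_def]
  | m + 1, n, 0, _, h, _ => by omega

theorem merge_merge : ∀ (i j : ℕ) (l : List C), i ≤ j → j + 2 < l.length →
    ∃ φ : HomList (merge i (merge (j + 1) l)) (merge j (merge i l)),
      tensHom φ ≫ (mergeIso j (merge i l)).hom ≫ (mergeIso i l).hom =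
        (mergeIso i (merge (j + 1) l)).hom ≫ (mergeIso (j + 1) l).hom
  | 0, 0, X :: Y :: Z :: l, _, _ => by
      refine ⟨.cons (α_ X Y Z).inv (HomList.refl l), ?_⟩
      change ((α_ X Y Z).inv ⊗ₘ tensHom (HomList.refl l)) ≫ (α_ (X ⊗ Y) Z (tens l)).hom ≫
        (α_ X Y (Z ⊗ tens l)).hom = (α_ X (Y ⊗ Z) (tens l)).hom ≫ X ◁ (α_ Y Z (tens l)).hom
      rw [tensHom_refl, tensorHom_id]
      monoidal
  | 0, j + 1, X :: Y :: l, _, _ => by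
      refine ⟨HomList.refl ((X ⊗ Y) :: merge j l), ?_⟩
      change (𝟙 (X ⊗ Y) ⊗ₘ tensHom (HomList.refl (merge j l))) ≫ (X ⊗ Y) ◁ (mergeIso j l).hom ≫ (α_ X Y (tens l)).hom =
        (α_ X Y _).hom ≫ X ◁ Y ◁ (mergeIso j l).hom
      rw [tensHom_refl, id_tensorHom_id, Category.id_comp, associator_naturality_right]
  | i + 1, j + 1, X :: l, h, h' => by
      obtain ⟨φ, e⟩ := merge_merge i j l (by omega) (by simp at h'; omega)
      refine ⟨.cons (𝟙 X) φ, ?_⟩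
      change (𝟙 X ⊗ₘ tensHom φ) ≫ X ◁ (mergeIso j (merge i l)).hom ≫ X ◁ (mergeIso i l).hom =
        X ◁ (mergeIso i (merge (j + 1) l)).hom ≫ X ◁ (mergeIso (j + 1) l).hom
      rw [id_tensorHom, ← whiskerLeft_comp, ← whiskerLeft_comp, ← whiskerLeft_comp, e]
  | i + 1, 0, _, h, _ => by omega
  | 0, _, [], _, h => by simp at h
  | 0, _, [_], _, h => by simp at h
  | 0, 0, [_, _], _, h => by simp at h
  | i + 1, j + 1, [], _, h => by simp at h

variable {k : Type w} [Field k] [Preadditive C] [Linear k C] {m n p : ℕ}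

theorem inner_app (i : Fin n) (a : E C k n) (l : List C) (h : l.length = n + 1)
    (h' : (merge i l).length = n) :
    (mergeIso i l).hom ≫ (cofaceInner i a).app l h = a.app (merge i l) h' ≫ (mergeIso i l).hom :=
  Iso.hom_inv_id_assoc _ _

theorem cup_app (a : E C k m) (b : E C k n) (l : List C) (h : l.length = m + n)
    (h₁ : (l.take m).length = m) (h₂ : (l.drop m).length = n) :
    (cup a b).app l h ≫ (splitIso m l).hom =
      (splitIso m l).hom ≫ (a.app (l.take m) h₁ ⊗ₘ b.app (l.drop m) h₂) := by
  change ((splitIso m l).hom ≫ (a.app (l.take m) h₁ ⊗ₘ b.app (l.drop m) h₂) ≫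
    (splitIso m l).inv) ≫ (splitIso m l).hom = _
  simp

theorem app_sum {ι : Type*} (s : Finset ι) (a : ι → E C k n) (l : List C) (h : l.length = n) :
    (∑ i ∈ s, a i).app l h = ∑ i ∈ s, (a i).app l h := by
  let f : E C k n →+ (tens l ⟶ tens l) := ⟨⟨fun a => a.app l h, rfl⟩, fun a b => rfl⟩
  exact map_sum f a s

/-- Cochains are determined by, and can be transported along, their degree. -/
theorem cup_congr {m' n' : ℕ} (hm : m = m') (hn : n = n') {a : E C k m} {a' : E C k m'}
    {b : E C k n} {b' : E C k n'} (ha : ∀ l h h', a.app l h = a'.app l h')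
    (hb : ∀ l h h', b.app l h = b'.app l h') (l : List C) (h : l.length = m + n)
    (h' : l.length = m' + n') : (cup a b).app l h = (cup a' b').app l h' := by
  subst hm hn
  obtain rfl : a = a' := E.ext fun l h => ha l h h
  obtain rfl : b = b' := E.ext fun l h => hb l h h
  rfl

/-- `a`, regarded as a cochain of degree `n` for `m = n`. -/
def E.cast (h : m = n) (a : E C k m) : E C k n := h ▸ a

theorem E.cast_app (h : m = n) (a : E C k m) (l : List C) (hl : l.length = n)
    (hl' : l.length = m) : (E.cast h a).app l hl = a.app l hl' := by
  subst h; rfl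

variable [MonoidalPreadditive C] [MonoidalLinear k C]

theorem first_eq_cup (a : E C k n) (l : List C) (h : l.length = n + 1) (h' : l.length = 1 + n) :
    (cofaceFirst a).app l h = (cup (one C k 1) a).app l h' := by
  rcases l with _ | ⟨X, l⟩
  · simp at h
  · have e := cup_app (one C k 1) a (X :: l) h' (by simp) (by simpa using h)
    rw [← cancel_mono (splitIso 1 (X :: l)).hom, e]
    change X ◁ a.app l _ ≫ X ◁ (λ_ _).inv ≫ (α_ X _ _).inv =
      (X ◁ (λ_ _).inv ≫ (α_ X _ _).inv) ≫ (𝟙 (X ⊗ 𝟙_ C) ⊗ₘ a.app l _)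
    simp

theorem cup_cup_app (a : E C k m) (b : E C k n) (c : E C k p) (l : List C)
    (h : l.length = m + n + p) (h' : l.length = m + (n + p)) :
    (cup (cup a b) c).app l h = (cup a (cup b c)).app l h' := by
  obtain ⟨φ, ψ, χ, e⟩ := split_split m n (m + n) l rfl (by omega)
  have e₁ := cup_app (cup a b) c l h (by simp; omega) (by simp; omega)
  have e₂ := cup_app a b (l.take (m + n)) (by simp; omega) (by simp; omega) (by simp; omega)
  have e₃ := cup_app a (cup b c) l h' (by simp; omega) (by simp; omega)
  have e₄ := cup_app b c (l.drop m) (by simp; omega) (by simp; omega) (by simp; omega)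
  have na := a.naturality φ (by simp; omega) (by simp; omega)
  have nb := b.naturality ψ (by simp; omega) (by simp; omega)
  have nc := c.naturality χ (by simp; omega) (by simp; omega)
  rw [← cancel_mono (splitIso m l).hom,
    ← cancel_mono (tens (l.take m) ◁ (splitIso n (l.drop m)).hom), Category.assoc,
    Category.assoc, ← e, reassoc_of% e₁, e, reassoc_of% e₃]
  rw [← tensorHom_id, tensorHom_comp_tensorHom_assoc, e₂, Category.comp_id]
  rw [← id_tensorHom, tensorHom_comp_tensorHom, e₄, Category.comp_id]
  rw [← Category.id_comp (a.app (l.take m) _), ← tensorHom_comp_tensorHom, id_tensorHom,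
    ← reassoc_of% e, ← associator_naturality, tensorHom_comp_tensorHom_assoc,
    Category.assoc (splitIso m _).hom, tensorHom_comp_tensorHom, ← na, ← nb, ← nc,
    ← tensorHom_id, tensorHom_comp_tensorHom_assoc, tensorHom_comp_tensorHom_assoc,
    Category.assoc, tensorHom_comp_tensorHom, Category.id_comp]

theorem cup_inner_left (i : Fin m) (j : Fin (m + n)) (hij : (j : ℕ) = i) (a : E C k m)
    (b : E C k n) (l : List C) (h : l.length = m + 1 + n) (h' : l.length = m + n + 1) :
    (cup (cofaceInner i a) b).app l h = (cofaceInner j (cup a b)).app l h' := by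
  obtain ⟨j, hj⟩ := j
  obtain rfl : j = (i : ℕ) := hij
  have hi := i.2
  obtain ⟨φ, ψ, e⟩ := split_merge_left i m l i.2 (by omega)
  have hl : (merge i l).length = m + n := by rw [length_merge _ _ (by omega)]; omega
  have ht : (l.take (m + 1)).length = m + 1 := by simp; omega
  have hm : (merge i (l.take (m + 1))).length = m := by
    rw [length_merge _ _ (by omega)]; omega
  have e₁ := cup_app (cofaceInner i a) b l h ht (by simp; omega)
  have e₂ := inner_app ⟨(i : ℕ), hj⟩ (cup a b) l h' hl
  have e₃ := inner_app i a (l.take (m + 1)) ht hm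
  have e₄ := cup_app a b (merge i l) hl (by simp; omega) (by simp; omega)
  have na := a.naturality φ (by simp; omega) hm
  have nb := b.naturality ψ (by simp; omega) (by simp; omega)
  rw [← cancel_mono (splitIso (m + 1) l).hom, ← cancel_epi (mergeIso i l).hom, e₁,
    reassoc_of% e₂, ← reassoc_of% e, ← e, reassoc_of% e₄, ← tensorHom_id,
    tensorHom_comp_tensorHom_assoc, tensorHom_comp_tensorHom, tensorHom_comp_tensorHom,
    tensorHom_comp_tensorHom, Category.comp_id, Category.assoc, e₃,
    reassoc_of% na, nb]

theorem cup_inner_right (i : Fin n) (j : Fin (m + n)) (hij : (j : ℕ) = m + i) (a : E C k m)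
    (b : E C k n) (l : List C) (h : l.length = m + (n + 1)) (h' : l.length = m + n + 1) :
    (cup a (cofaceInner i b)).app l h = (cofaceInner j (cup a b)).app l h' := by
  obtain ⟨j, hj⟩ := j
  obtain rfl : j = m + (i : ℕ) := hij
  have hi := i.2
  obtain ⟨φ, ψ, e⟩ := split_merge_right i m l (by omega)
  have hl : (merge (m + i) l).length = m + n := by rw [length_merge _ _ (by omega)]; omega
  have ht : (l.drop m).length = n + 1 := by simp; omega
  have hm : (merge i (l.drop m)).length = n := by
    rw [length_merge _ _ (by omega)]; omega
  have e₁ := cup_app a (cofaceInner i b) l h (by simp; omega) ht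
  have e₂ := inner_app ⟨m + (i : ℕ), hj⟩ (cup a b) l h' hl
  have e₃ := inner_app i b (l.drop m) ht hm
  have e₄ := cup_app a b (merge (m + i) l) hl (by simp; omega) (by simp; omega)
  have na := a.naturality φ (by simp; omega) (by simp; omega)
  have nb := b.naturality ψ (by simp; omega) hm
  rw [← cancel_mono (splitIso m l).hom, ← cancel_epi (mergeIso (m + i) l).hom, e₁,
    reassoc_of% e₂, ← reassoc_of% e, ← e, reassoc_of% e₄, ← id_tensorHom,
    tensorHom_comp_tensorHom_assoc, tensorHom_comp_tensorHom, tensorHom_comp_tensorHom,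
    tensorHom_comp_tensorHom, Category.comp_id, Category.assoc, e₃,
    reassoc_of% nb, na]

theorem inner_inner (i : Fin n) (j : Fin n) (hij : i ≤ j) (a : E C k n) :
    cofaceInner j.succ (cofaceInner i a) = cofaceInner i.castSucc (cofaceInner j a) := by
  refine E.ext fun l h => ?_
  have hi := i.2
  have hj := j.2
  obtain ⟨φ, e⟩ := merge_merge i j l hij (by omega)
  have h₁ : (merge i l).length = n + 1 := by rw [length_merge _ _ (by omega)]; omega
  have h₂ : (merge (j + 1) l).length = n + 1 := by rw [length_merge _ _ (by omega)]; omega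
  have h₃ : (merge j (merge i l)).length = n := by rw [length_merge _ _ (by omega)]; omega
  have h₄ : (merge i (merge (j + 1) l)).length = n := by rw [length_merge _ _ (by omega)]; omega
  have e₁ := inner_app j.succ (cofaceInner i a) l h h₂
  have e₂ := inner_app i.castSucc (cofaceInner j a) l h h₁
  have e₃ := inner_app i a (merge (j + 1) l) h₂ h₄
  have e₄ := inner_app j a (merge i l) h₁ h₃
  have na := a.naturality φ h₄ h₃
  simp only [Fin.val_succ, Fin.val_castSucc] at e₁ e₂
  rw [← cancel_epi (mergeIso (j + 1) l).hom, ← cancel_epi (mergeIso i (merge (j + 1) l)).hom, e₁,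
    reassoc_of% e₃, ← e, ← reassoc_of% e, e₂, reassoc_of% e₄, reassoc_of% na]

theorem cup_add_left (a a' : E C k m) (b : E C k n) : cup (a + a') b = cup a b + cup a' b := by
  refine Subtype.ext (funext fun X => ?_)
  simp only [cup, E.app_add, MonoidalPreadditive.add_tensor, Preadditive.comp_add,
    Preadditive.add_comp]
  rfl

theorem cup_add_right (a : E C k m) (b b' : E C k n) : cup a (b + b') = cup a b + cup a b' := by
  refine Subtype.ext (funext fun X => ?_)
  simp only [cup, E.app_add, MonoidalPreadditive.tensor_add, Preadditive.comp_add,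
    Preadditive.add_comp]
  rfl

theorem cup_smul_left (c : k) (a : E C k m) (b : E C k n) : cup (c • a) b = c • cup a b := by
  refine Subtype.ext (funext fun X => ?_)
  simp only [cup, E.app_smul, MonoidalCategory.tensorHom_def, MonoidalLinear.smul_whiskerRight,
    Linear.comp_smul, Linear.smul_comp]
  rfl

theorem cup_smul_right (c : k) (a : E C k m) (b : E C k n) : cup a (c • b) = c • cup a b := by
  refine Subtype.ext (funext fun X => ?_)
  simp only [cup, E.app_smul, MonoidalCategory.tensorHom_def, MonoidalLinear.whiskerLeft_smul,
    Linear.comp_smul, Linear.smul_comp]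
  rfl

theorem d_app (a : E C k n) (l : List C) (h : l.length = n + 1) (h' : l.length = 1 + n) :
    (d C k n a).app l h = (cup (one C k 1) a).app l h' +
      ∑ i : Fin n, (-1 : k) ^ ((i : ℕ) + 1) • (cofaceInner i a).app l h +
      (-1 : k) ^ (n + 1) • (cup a (one C k 1)).app l h := by
  simp only [d, LinearMap.add_apply, LinearMap.sum_apply, LinearMap.smul_apply, E.app_add,
    E.app_smul, app_sum, first_eq_cup a l h h']
  rfl

theorem cup_sum_left {ι : Type*} (s : Finset ι) (a : ι → E C k m) (b : E C k n) :
    cup (∑ i ∈ s, a i) b = ∑ i ∈ s, cup (a i) b := by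
  let f : E C k m →+ E C k (m + n) :=
    AddMonoidHom.mk' (fun a => cup a b) (fun a a' => cup_add_left a a' b)
  exact map_sum f a s

theorem cup_sum_right {ι : Type*} (s : Finset ι) (a : E C k m) (b : ι → E C k n) :
    cup a (∑ i ∈ s, b i) = ∑ i ∈ s, cup a (b i) := by
  let f : E C k n →+ E C k (m + n) :=
    AddMonoidHom.mk' (fun b => cup a b) (fun b b' => cup_add_right a b b')
  exact map_sum f b s

/-- `∂(a ∪ b) = ∂a ∪ b + (-1)ᵐ a ∪ ∂b`. -/
theorem leibniz (a : E C k m) (b : E C k n) (l : List C) (h : l.length = m + n + 1)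
    (h₁ : l.length = m + 1 + n) (h₂ : l.length = m + (n + 1)) :
    (d C k (m + n) (cup a b)).app l h =
      (cup (d C k m a) b).app l h₁ + (-1 : k) ^ m • (cup a (d C k n b)).app l h₂ := by
  have ha : d C k m a = E.cast (Nat.add_comm 1 m) (cup (one C k 1) a) +
      ∑ i : Fin m, (-1 : k) ^ ((i : ℕ) + 1) • cofaceInner i a +
      (-1 : k) ^ (m + 1) • cup a (one C k 1) := by
    refine E.ext fun l hl => ?_
    rw [d_app a l hl (by omega)]
    simp only [E.app_add, E.app_smul, app_sum]
    rw [E.cast_app _ _ l hl (by omega)]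
  have hb : d C k n b = E.cast (Nat.add_comm 1 n) (cup (one C k 1) b) +
      ∑ i : Fin n, (-1 : k) ^ ((i : ℕ) + 1) • cofaceInner i b +
      (-1 : k) ^ (n + 1) • cup b (one C k 1) := by
    refine E.ext fun l hl => ?_
    rw [d_app b l hl (by omega)]
    simp only [E.app_add, E.app_smul, app_sum]
    rw [E.cast_app _ _ l hl (by omega)]
  rw [d_app (cup a b) l h (by omega), ha, hb]
  simp only [cup_add_left, cup_add_right, cup_sum_left, cup_sum_right, cup_smul_left,
    cup_smul_right, E.app_add, E.app_smul, app_sum, Fin.sum_univ_add]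
  have e₁ : (cup (E.cast (Nat.add_comm 1 m) (cup (one C k 1) a)) b).app l h₁ =
      (cup (one C k 1) (cup a b)).app l (by omega) := by
    rw [← cup_cup_app _ _ _ l (by omega) (by omega)]
    exact cup_congr (Nat.add_comm m 1) rfl (fun l h h' => E.cast_app _ _ l h h')
      (fun _ _ _ => rfl) l _ _
  have e₂ : (cup a (E.cast (Nat.add_comm 1 n) (cup (one C k 1) b))).app l h₂ =
      (cup (cup a (one C k 1)) b).app l h₁ := by
    rw [cup_cup_app _ _ _ l (by omega) (by omega)]
    exact cup_congr rfl (Nat.add_comm n 1) (fun _ _ _ => rfl)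
      (fun l h h' => E.cast_app _ _ l h h') l _ _
  have e₃ : (cup a (cup b (one C k 1))).app l h₂ = (cup (cup a b) (one C k 1)).app l h :=
    (cup_cup_app _ _ _ l _ _).symm
  have e₄ : ∀ i : Fin m, (cup (cofaceInner i a) b).app l h₁ =
      (cofaceInner (Fin.castAdd n i) (cup a b)).app l h :=
    fun i => cup_inner_left i _ rfl a b l _ _
  have e₅ : ∀ i : Fin n, (cup a (cofaceInner i b)).app l h₂ =
      (cofaceInner (Fin.natAdd m i) (cup a b)).app l h :=
    fun i => cup_inner_right i _ rfl a b l _ _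
  simp only [e₁, e₂, e₃, e₄, e₅, Fin.val_castAdd, Fin.val_natAdd, smul_add, Finset.smul_sum,
    smul_smul, ← pow_add]
  have s₁ : (-1 : k) ^ (m + 1) = - (-1) ^ m := by ring
  have s₂ : m + (n + 1) = m + n + 1 := by omega
  have s₃ : ∀ i : Fin n, m + ((i : ℕ) + 1) = m + i + 1 := fun i => by omega
  simp only [s₁, s₂, s₃, neg_smul]
  abel

variable (C k) in
/-- The alternating sum of the inner coface maps. -/
def innerSum (n : ℕ) : E C k n →ₗ[k] E C k (n + 1) :=
  ∑ i : Fin n, (-1 : k) ^ ((i : ℕ) + 1) • cofaceInner i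

theorem innerSum_apply (a : E C k n) :
    innerSum C k n a = ∑ i : Fin n, (-1 : k) ^ ((i : ℕ) + 1) • cofaceInner i a := by
  simp only [innerSum, LinearMap.sum_apply, LinearMap.smul_apply]

theorem innerSum_innerSum (a : E C k n) : innerSum C k (n + 1) (innerSum C k n a) = 0 := by
  rw [innerSum_apply, innerSum_apply]
  simp only [map_sum, map_smul, Finset.smul_sum, smul_smul]
  rw [Finset.sum_comm, ← Finset.sum_product', Finset.univ_product_univ]
  let P := Fin n × Fin (n + 1)
  let S : Finset P := {ij : P | (ij.2 : ℕ) ≤ (ij.1 : ℕ)}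
  rw [← Finset.sum_add_sum_compl S, ← eq_neg_iff_add_eq_zero, ← Finset.sum_neg_distrib]
  let φ : ∀ ij : P, ij ∈ S → P := fun ij hij =>
    (Fin.castLT ij.2 (lt_of_le_of_lt (Finset.mem_filter.mp hij).right (Fin.is_lt ij.1)),
      ij.1.succ)
  apply Finset.sum_bij φ
  · intro ij hij
    simp_rw [S, φ, Finset.compl_filter, Finset.mem_filter_univ, Fin.val_succ,
      Fin.val_castLT] at hij ⊢
    omega
  · rintro ⟨i, j⟩ hij ⟨i', j'⟩ hij' h
    have h₁ : (j : ℕ) = j' := congrArg (fun p : P => (p.1 : ℕ)) h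
    have h₂ : (i : ℕ) + 1 = i' + 1 := congrArg (fun p : P => (p.2 : ℕ)) h
    exact Prod.ext (Fin.ext (by simpa using h₂)) (Fin.ext h₁)
  · rintro ⟨i', j'⟩ hij'
    simp_rw [S, Finset.compl_filter, Finset.mem_filter_univ, not_le] at hij'
    refine ⟨(⟨(j' : ℕ) - 1, by omega⟩, Fin.castSucc i'), ?_, ?_⟩
    · simp only [S, Finset.mem_filter_univ, Fin.val_castSucc]
      omega
    · refine Prod.ext (Fin.ext rfl) (Fin.ext ?_)
      change (j' : ℕ) - 1 + 1 = j'
      omega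
  · rintro ⟨i, j⟩ hij
    have hij' : (j : ℕ) ≤ i := (Finset.mem_filter.mp hij).2
    have e := inner_inner (j.castLT (by omega)) i hij' a
    simp only [φ]
    rw [e, ← neg_smul]
    congr 1
    simp only [Fin.val_succ, Fin.val_castLT]
    ring

theorem d_one : d C k 1 (one C k 1) = cup (one C k 1) (one C k 1) := by
  have h₁ : ∀ l h, (cofaceInner 0 (one C k 1)).app l h = 𝟙 (tens l) := by
    intro l h
    change (mergeIso _ l).inv ≫ 𝟙 _ ≫ (mergeIso _ l).hom = _
    simp
  have h₂ : ∀ l h, (cup (one C k 1) (one C k 1)).app l h = 𝟙 (tens l) := by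
    intro l h
    change (splitIso _ l).hom ≫ (𝟙 _ ⊗ₘ 𝟙 _) ≫ (splitIso _ l).inv = _
    simp
  refine E.ext fun l h => ?_
  rw [d_app _ l h h]
  simp only [Finset.univ_unique, Finset.sum_singleton, Fin.default_eq_zero, h₁, h₂]
  simp

theorem d_eq (a : E C k n) : d C k n a = E.cast (Nat.add_comm 1 n) (cup (one C k 1) a) +
    innerSum C k n a + (-1 : k) ^ (n + 1) • cup a (one C k 1) := by
  refine E.ext fun l hl => ?_
  rw [d_app a l hl (by omega), innerSum_apply]
  simp only [E.app_add, E.app_smul, app_sum]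
  rw [E.cast_app _ _ l hl (by omega)]

theorem d_cast (h : m = n) (a : E C k m) (l : List C) (hl : l.length = n + 1)
    (hl' : l.length = m + 1) : (d C k n (E.cast h a)).app l hl = (d C k m a).app l hl' := by
  subst h; rfl

/-- `∂ ∘ ∂ = 0`. -/
theorem d_d (a : E C k n) : d C k (n + 1) (d C k n a) = 0 := by
  refine E.ext fun l h => ?_
  have hd := d_eq a
  have hdd := d_eq (innerSum C k n a)
  rw [innerSum_innerSum, add_zero] at hdd
  have e₁ := leibniz (one C k 1) a l (by omega) (by omega) (by omega)
  have e₂ := leibniz a (one C k 1) l h (by omega) (by omega)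
  rw [d_one] at e₁ e₂
  have e₃ := congrArg (fun x => (cup (one C k 1) x).app l (by omega)) hd
  have e₄ := congrArg (fun x => (cup x (one C k 1)).app l (by omega)) hd
  have e₅ := congrArg (fun x => E.app x l h) hdd
  simp only [cup_add_left, cup_add_right, cup_smul_left, cup_smul_right, E.app_add,
    E.app_smul] at e₃ e₄ e₅
  rw [E.cast_app _ _ l h (by omega)] at e₅
  have a₁ := cup_cup_app (one C k 1) (one C k 1) a l (by omega) (by omega)
  have a₂ := cup_cup_app a (one C k 1) (one C k 1) l (by omega) (by omega)
  have a₃ := cup_cup_app (one C k 1) a (one C k 1) l (by omega) (by omega)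
  have a₄ := cup_congr rfl (Nat.add_comm n 1) (a := one C k 1) (a' := one C k 1)
    (b := E.cast (Nat.add_comm 1 n) (cup (one C k 1) a)) (b' := cup (one C k 1) a)
    (fun _ _ _ => rfl) (fun l h h' => E.cast_app _ _ l h h') l (by omega) (by omega)
  have a₅ := cup_congr (Nat.add_comm n 1) rfl (b := one C k 1) (b' := one C k 1)
    (a := E.cast (Nat.add_comm 1 n) (cup (one C k 1) a)) (a' := cup (one C k 1) a)
    (fun l h h' => E.cast_app _ _ l h h') (fun _ _ _ => rfl) l (by omega) (by omega)
  rw [hd]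
  simp only [map_add, map_smul, E.app_add, E.app_smul]
  rw [d_cast _ _ l h (by omega), e₁, e₂, e₃, e₄, e₅, a₁, a₂, a₄, a₅, a₃]
  have s : (-1 : k) ^ n * (-1) ^ n = 1 := by
    rw [← mul_pow]; simp
  change _ = (0 : tens l ⟶ tens l)
  simp only [pow_succ, pow_zero]
  generalize (-1 : k) ^ n = x at s ⊢
  simp only [smul_add, smul_neg, smul_smul, one_mul, mul_neg, neg_mul, mul_one, s,
    neg_smul, one_smul, neg_neg]
  abel

end Leibniz

/-! ### Deformation cohomology -/

section Cohomology

variable (C : Type u) [Category.{v} C] [MonoidalCategory C] (k : Type w) [Field k]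
  [Preadditive C] [Linear k C] [MonoidalPreadditive C] [MonoidalLinear k C]

/-- The cocycles. -/
def Z (n : ℕ) : Submodule k (E C k n) := LinearMap.ker (d C k n)

/-- The coboundaries. -/
def B : (n : ℕ) → Submodule k (E C k n)
  | 0 => ⊥
  | n + 1 => LinearMap.range (d C k n)

theorem B_le_Z : (n : ℕ) → B C k n ≤ Z C k n
  | 0 => bot_le
  | n + 1 => by
      rintro _ ⟨a, rfl⟩
      exact d_d a

/-- The deformation cohomology `Hⁿ(C) = Zⁿ / Bⁿ`. -/
abbrev H (n : ℕ) : Type _ := Z C k n ⧸ (B C k n).submoduleOf (Z C k n)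

variable {C k} {m n : ℕ}

theorem mem_B {n j : ℕ} (h : n = j + 1) {a : E C k n} (b : E C k j)
    (hab : ∀ l hl hl', a.app l hl = (d C k j b).app l hl') : a ∈ B C k n := by
  subst h
  exact ⟨b, E.ext fun l hl => (hab l hl hl).symm⟩

theorem cup_zero_left (b : E C k n) : cup (0 : E C k m) b = 0 := by
  simpa using cup_smul_left (0 : k) (0 : E C k m) b

theorem cup_zero_right (a : E C k m) : cup a (0 : E C k n) = 0 := by
  simpa using cup_smul_right (0 : k) a (0 : E C k n)

theorem cup_mem_Z {a : E C k m} {b : E C k n} (ha : a ∈ Z C k m) (hb : b ∈ Z C k n) :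
    cup a b ∈ Z C k (m + n) := by
  have ha' : d C k m a = 0 := ha
  have hb' : d C k n b = 0 := hb
  refine E.ext (a := d C k (m + n) (cup a b)) fun l h => ?_
  rw [leibniz a b l h (by omega) (by omega), ha', hb', cup_zero_left, cup_zero_right]
  change (0 : tens l ⟶ tens l) + (-1 : k) ^ m • (0 : tens l ⟶ tens l) = 0
  simp

theorem cup_mem_B_left {a : E C k m} {b : E C k n} (ha : a ∈ B C k m) (hb : b ∈ Z C k n) :
    cup a b ∈ B C k (m + n) := by
  cases m with
  | zero =>
    obtain rfl : a = 0 := ha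
    rw [cup_zero_left]
    exact zero_mem _
  | succ m =>
    obtain ⟨a, rfl⟩ := ha
    have hb' : d C k n b = 0 := hb
    refine mem_B (j := m + n) (by omega) (cup a b) fun l hl hl' => ?_
    rw [leibniz a b l hl' hl (by omega), hb', cup_zero_right]
    change _ = _ + (-1 : k) ^ m • (0 : tens l ⟶ tens l)
    simp

theorem cup_mem_B_right {a : E C k m} {b : E C k n} (ha : a ∈ Z C k m) (hb : b ∈ B C k n) :
    cup a b ∈ B C k (m + n) := by
  cases n with
  | zero =>
    obtain rfl : b = 0 := hb
    rw [cup_zero_right]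
    exact zero_mem _
  | succ n =>
    obtain ⟨b, rfl⟩ := hb
    have ha' : d C k m a = 0 := ha
    refine mem_B (j := m + n) (by omega) ((-1 : k) ^ m • cup a b) fun l hl hl' => ?_
    rw [map_smul, E.app_smul, leibniz a b l hl' (by omega) hl, ha', cup_zero_left]
    change _ = (-1 : k) ^ m • ((0 : tens l ⟶ tens l) + _)
    rw [zero_add, smul_smul, ← mul_pow]
    simp

/-- The cup product on the deformation cohomology. -/
def H.cup (x : H C k m) (y : H C k n) : H C k (m + n) :=
  Quotient.map₂ (fun a b => ⟨TensorDeformation.cup a.1 b.1, cup_mem_Z a.2 b.2⟩) (by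
    intro a a' ha b b' hb
    rw [← Quotient.eq_iff_equiv] at ha hb
    have ha' : a.1 - a'.1 ∈ B C k m :=
      (Submodule.Quotient.eq ((B C k m).submoduleOf (Z C k m))).1 ha
    have hb' : b.1 - b'.1 ∈ B C k n :=
      (Submodule.Quotient.eq ((B C k n).submoduleOf (Z C k n))).1 hb
    rw [← Quotient.eq_iff_equiv]
    refine (Submodule.Quotient.eq _).2 ?_
    change TensorDeformation.cup a.1 b.1 - TensorDeformation.cup a'.1 b'.1 ∈ B C k (m + n)
    have e : TensorDeformation.cup a.1 b.1 - TensorDeformation.cup a'.1 b'.1 =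
        TensorDeformation.cup (a.1 - a'.1) b.1 + TensorDeformation.cup a'.1 (b.1 - b'.1) := by
      rw [sub_eq_add_neg a.1, sub_eq_add_neg b.1, ← neg_one_smul k a'.1, ← neg_one_smul k b'.1,
        cup_add_left, cup_add_right, cup_smul_left, cup_smul_right, neg_one_smul, neg_one_smul]
      abel
    rw [e]
    exact add_mem (cup_mem_B_left ha' b.2) (cup_mem_B_right a'.2 hb')) x y

variable (C k) in
theorem one_mem_Z : one C k 0 ∈ Z C k 0 := by
  refine E.ext (a := d C k 0 (one C k 0)) fun l h => ?_
  have h₁ : ∀ h, (cup (one C k 1) (one C k 0)).app l h = 𝟙 (tens l) := by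
    intro h
    change (splitIso _ l).hom ≫ (𝟙 _ ⊗ₘ 𝟙 _) ≫ (splitIso _ l).inv = _
    simp
  have h₂ : ∀ h, (cup (one C k 0) (one C k 1)).app l h = 𝟙 (tens l) := by
    intro h
    change (splitIso 0 l).hom ≫ (𝟙 _ ⊗ₘ 𝟙 _) ≫ (splitIso 0 l).inv = _
    simp only [id_tensorHom_id, Category.id_comp]
    exact Iso.hom_inv_id _
  rw [d_app _ l h h, h₁, h₂]
  change _ = (0 : tens l ⟶ tens l)
  simp

variable (C k) in
/-- The unit of the cup product on the deformation cohomology. -/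
def H.one : H C k 0 := Submodule.Quotient.mk ⟨TensorDeformation.one C k 0, one_mem_Z C k⟩

end Cohomology

/-! ### Schur–Weyl categories -/

section SchurWeyl

/-- The identification of the members of a family of algebras along an equality of indices. -/
def castAlg (k : Type w) [Field k] (A : ℕ → Type u) [∀ n, Ring (A n)] [∀ n, Algebra k (A n)]
    {m n : ℕ} (h : m = n) : A m ≃ₐ[k] A n :=
  h ▸ AlgEquiv.refl

/-- A multiplicative sequence of algebras over `k`: algebras `Aₙ` with `A₀ = k` and algebra
homomorphisms `μₘₙ : Aₘ ⊗ Aₙ → Aₘ₊ₙ` that are associative and unital. -/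
structure MultSeq (k : Type w) [Field k] where
  A : ℕ → Type u
  [ring : ∀ n, Ring (A n)]
  [algebra : ∀ n, Algebra k (A n)]
  bijective_algebraMap : Function.Bijective (algebraMap k (A 0))
  μ : ∀ m n, A m ⊗[k] A n →ₐ[k] A (m + n)
  assoc : ∀ (l m n : ℕ) (a : A l) (b : A m) (c : A n),
    castAlg k A (Nat.add_assoc l m n) (μ (l + m) n (μ l m (a ⊗ₜ b) ⊗ₜ c)) =
      μ l (m + n) (a ⊗ₜ μ m n (b ⊗ₜ c))
  one_left : ∀ (n : ℕ) (a : A n), castAlg k A (Nat.zero_add n) (μ 0 n (1 ⊗ₜ a)) = a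
  one_right : ∀ (n : ℕ) (a : A n), μ n 0 (a ⊗ₜ 1) = a

attribute [instance] MultSeq.ring MultSeq.algebra

variable {k : Type w} [Field k]

/-- The objects `[n]`, `n ∈ ℕ`, of the Schur–Weyl category of a multiplicative sequence. -/
structure SW (S : MultSeq.{u} k) where
  deg : ℕ

namespace SW

variable {S : MultSeq.{u} k}

/-- The space of morphisms `[m] ⟶ [n]`, as a subspace of `Aₘ`: it is all of `Aₘ` when `m = n`,
and zero otherwise. -/
def homSpace (X Y : SW S) : Submodule k (S.A X.deg) where
  carrier := {a | X.deg ≠ Y.deg → a = 0}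
  zero_mem' _ := rfl
  add_mem' ha hb h := by rw [ha h, hb h, add_zero]
  smul_mem' c a ha h := by rw [ha h, smul_zero]

/-- A morphism `[m] ⟶ [n]`. -/
def Hom (X Y : SW S) : Type u := homSpace X Y

instance (X Y : SW S) : AddCommGroup (Hom X Y) := inferInstanceAs (AddCommGroup (homSpace X Y))

instance (X Y : SW S) : Module k (Hom X Y) := inferInstanceAs (Module k (homSpace X Y))

/-- The composition of `f` followed by `g`: it is the product `g * f` in `Aₙ` when the source and
target of `f` agree. -/
def Hom.comp {X Y Z : SW S} (f : Hom X Y) (g : Hom Y Z) : Hom X Z :=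
  ⟨if h : Y.deg = X.deg then castAlg k S.A h g.1 * f.1 else 0, by
    intro hXZ
    split_ifs with h
    · rw [g.2 (h ▸ hXZ), map_zero, zero_mul]
    · rfl⟩

/-- The isomorphism `[m] ≅ [n]` for `m = n`, given by the unit of `Aₘ`. -/
def Hom.ofEq {X Y : SW S} (h : X.deg = Y.deg) : Hom X Y :=
  ⟨1, fun h' => absurd h h'⟩

/-- The tensor product of morphisms, given by `μₘₙ`. -/
def Hom.tensor {X Y X' Y' : SW S} (f : Hom X Y) (g : Hom X' Y') :
    Hom (⟨X.deg + X'.deg⟩ : SW S) ⟨Y.deg + Y'.deg⟩ :=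
  ⟨S.μ X.deg X'.deg (f.1 ⊗ₜ g.1), by
    intro h
    by_cases h₁ : X.deg = Y.deg
    · rw [g.2 (fun h₂ => h (by simp [h₁, h₂])), TensorProduct.tmul_zero, map_zero]
    · rw [f.2 h₁, TensorProduct.zero_tmul, map_zero]⟩

theorem comp_val {X Y Z : SW S} (f : Hom X Y) (g : Hom Y Z) (h : Y.deg = X.deg) :
    (Hom.comp f g).1 = castAlg k S.A h g.1 * f.1 := dif_pos h

theorem castAlg_rfl {n : ℕ} (h : n = n) (a : S.A n) : castAlg k S.A h a = a := rfl

theorem comp_mk {n : ℕ} (f g : Hom (⟨n⟩ : SW S) ⟨n⟩) : (Hom.comp f g).1 = g.1 * f.1 :=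
  comp_val f g rfl

theorem eq_zero {X Y : SW S} (f : Hom X Y) (h : X.deg ≠ Y.deg) : f = 0 := Subtype.ext (f.2 h)

theorem Hom.zero_comp {X Y Z : SW S} (g : Hom Y Z) : Hom.comp (0 : Hom X Y) g = 0 := by
  refine Subtype.ext ?_
  change (if h : Y.deg = X.deg then castAlg k S.A h g.1 * 0 else 0) = (0 : S.A X.deg)
  simp

theorem Hom.comp_zero {X Y Z : SW S} (f : Hom X Y) : Hom.comp f (0 : Hom Y Z) = 0 := by
  refine Subtype.ext ?_
  change (if h : Y.deg = X.deg then castAlg k S.A h 0 * f.1 else 0) = (0 : S.A X.deg)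
  simp

instance : Category (SW S) where
  Hom := Hom
  id X := Hom.ofEq rfl
  comp := Hom.comp
  id_comp {X Y} f := by
    refine Subtype.ext ?_
    rw [comp_val _ _ rfl, castAlg_rfl]; exact mul_one _
  comp_id {X Y} f := by
    by_cases h : X.deg = Y.deg
    · refine Subtype.ext ?_
      rw [comp_val _ _ h.symm]
      change castAlg k S.A _ 1 * f.1 = f.1
      rw [map_one, one_mul]
    · rw [eq_zero f h, Hom.zero_comp]
  assoc {W X Y Z} f g h := by
    by_cases h₁ : W.deg = X.deg
    · by_cases h₂ : X.deg = Y.deg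
      · obtain ⟨w⟩ := W; obtain ⟨x⟩ := X; obtain ⟨y⟩ := Y
        obtain rfl : w = x := h₁
        obtain rfl : w = y := h₂
        refine Subtype.ext ?_
        rw [comp_val _ _ rfl, comp_val _ _ rfl, comp_val _ _ rfl, comp_val _ _ rfl]
        simp only [castAlg_rfl, mul_assoc]
      · rw [eq_zero g h₂, Hom.zero_comp, Hom.comp_zero, Hom.zero_comp, Hom.comp_zero]
    · rw [eq_zero f h₁, Hom.zero_comp, Hom.zero_comp, Hom.zero_comp]

/-- The element of `Aₘ` underlying a morphism `[m] ⟶ [n]`. -/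
def val {X Y : SW S} (f : X ⟶ Y) : S.A X.deg := f.1

theorem hom_ext {X Y : SW S} {f g : X ⟶ Y} (h : val f = val g) : f = g := Subtype.ext h

instance : Preadditive (SW S) where
  homGroup X Y := inferInstanceAs (AddCommGroup (Hom X Y))
  add_comp X Y Z f f' g := by
    refine hom_ext ?_
    change (if h : Y.deg = X.deg then castAlg k S.A h g.1 * (f.1 + f'.1) else 0) =
      (if h : Y.deg = X.deg then castAlg k S.A h g.1 * f.1 else 0) +
        (if h : Y.deg = X.deg then castAlg k S.A h g.1 * f'.1 else 0)
    split_ifs <;> simp [mul_add]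
  comp_add X Y Z f g g' := by
    refine hom_ext ?_
    change (if h : Y.deg = X.deg then castAlg k S.A h (g.1 + g'.1) * f.1 else 0) =
      (if h : Y.deg = X.deg then castAlg k S.A h g.1 * f.1 else 0) +
        (if h : Y.deg = X.deg then castAlg k S.A h g'.1 * f.1 else 0)
    split_ifs <;> simp [add_mul]

instance : Linear k (SW S) where
  homModule X Y := inferInstanceAs (Module k (Hom X Y))
  smul_comp X Y Z c f g := by
    refine hom_ext ?_
    change (if h : Y.deg = X.deg then castAlg k S.A h g.1 * (c • f.1) else 0) =
      c • (if h : Y.deg = X.deg then castAlg k S.A h g.1 * f.1 else 0)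
    split_ifs <;> simp
  comp_smul X Y Z f c g := by
    refine hom_ext ?_
    change (if h : Y.deg = X.deg then castAlg k S.A h (c • g.1) * f.1 else 0) =
      c • (if h : Y.deg = X.deg then castAlg k S.A h g.1 * f.1 else 0)
    split_ifs <;> simp

/-- The isomorphism `[m] ≅ [n]` for `m = n`, given by the unit of `Aₘ`. -/
def isoOfEq {X Y : SW S} (h : X.deg = Y.deg) : X ≅ Y where
  hom := Hom.ofEq h
  inv := Hom.ofEq h.symm
  hom_inv_id := Subtype.ext <| by
    change (Hom.comp (Hom.ofEq h) (Hom.ofEq h.symm)).1 = 1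
    rw [comp_val _ _ h.symm]
    change castAlg k S.A _ 1 * 1 = 1
    rw [map_one, one_mul]
  inv_hom_id := Subtype.ext <| by
    change (Hom.comp (Hom.ofEq h.symm) (Hom.ofEq h)).1 = 1
    rw [comp_val _ _ h]
    change castAlg k S.A _ 1 * 1 = 1
    rw [map_one, one_mul]

instance : MonoidalCategoryStruct (SW S) where
  tensorObj X Y := ⟨X.deg + Y.deg⟩
  tensorUnit := ⟨0⟩
  tensorHom f g := Hom.tensor f g
  whiskerLeft X _ _ f := Hom.tensor (Hom.ofEq (X := X) rfl) f
  whiskerRight f Y := Hom.tensor f (Hom.ofEq (X := Y) rfl)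
  associator X Y Z := isoOfEq (Nat.add_assoc X.deg Y.deg Z.deg)
  leftUnitor X := isoOfEq (Nat.zero_add X.deg)
  rightUnitor X := isoOfEq (Nat.add_zero X.deg)

theorem val_comp {X Y Z : SW S} (f : X ⟶ Y) (g : Y ⟶ Z) (h : Y.deg = X.deg) :
    val (f ≫ g) = castAlg k S.A h (val g) * val f := comp_val f g h

theorem val_id (X : SW S) : val (𝟙 X) = 1 := rfl

theorem val_ofEq {X Y : SW S} (h : X.deg = Y.deg) : val (isoOfEq h).hom = 1 := rfl

theorem val_tensor {X Y X' Y' : SW S} (f : X ⟶ Y) (g : X' ⟶ Y') :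
    val (f ⊗ₘ g) = S.μ X.deg X'.deg (val f ⊗ₜ val g) := rfl

theorem hom_eq_zero {X Y : SW S} (f : X ⟶ Y) (h : X.deg ≠ Y.deg) : f = 0 := eq_zero f h

theorem zero_tensorHom {X Y X' Y' : SW S} (g : X' ⟶ Y') : ((0 : X ⟶ Y) ⊗ₘ g) = 0 := by
  refine hom_ext ?_
  rw [val_tensor]
  change S.μ _ _ (0 ⊗ₜ _) = 0
  rw [TensorProduct.zero_tmul, map_zero]

theorem tensorHom_zero {X Y X' Y' : SW S} (f : X ⟶ Y) : (f ⊗ₘ (0 : X' ⟶ Y')) = 0 := by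
  refine hom_ext ?_
  rw [val_tensor]
  change S.μ _ _ (_ ⊗ₜ 0) = 0
  rw [TensorProduct.tmul_zero, map_zero]

theorem tensorHom_ofEq {X Y X' Y' : SW S} (h : X.deg = Y.deg) (h' : X'.deg = Y'.deg) :
    ((isoOfEq h).hom ⊗ₘ (isoOfEq h').hom) =
      (isoOfEq (X := X ⊗ X') (Y := Y ⊗ Y') (congrArg₂ (· + ·) h h')).hom := by
  refine hom_ext ?_
  rw [val_tensor, val_ofEq, val_ofEq, val_ofEq, ← Algebra.TensorProduct.one_def, map_one]

theorem ofEq_comp_ofEq {X Y Z : SW S} (h : X.deg = Y.deg) (h' : Y.deg = Z.deg) :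
    (isoOfEq h).hom ≫ (isoOfEq h').hom = (isoOfEq (h.trans h')).hom := by
  refine hom_ext ?_
  rw [val_comp _ _ h.symm, val_ofEq, val_ofEq, val_ofEq, map_one, one_mul]

theorem val_comp_ofEq {X Y Z : SW S} (f : X ⟶ Y) (h : Y.deg = Z.deg) :
    val (f ≫ (isoOfEq h).hom) = val f := by
  by_cases h' : X.deg = Y.deg
  · rw [val_comp _ _ h'.symm, val_ofEq, map_one, one_mul]
  · rw [hom_eq_zero f h', Limits.zero_comp]
    rfl

theorem val_ofEq_comp {X Y Z : SW S} (h : X.deg = Y.deg) (f : Y ⟶ Z) :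
    val ((isoOfEq h).hom ≫ f) = castAlg k S.A h.symm (val f) := by
  rw [val_comp _ _ h.symm, val_ofEq, mul_one]

theorem castAlg_symm {m n : ℕ} (h : m = n) (a : S.A m) (b : S.A n) (H : castAlg k S.A h a = b) :
    a = castAlg k S.A h.symm b := by
  subst h; exact H

instance : MonoidalCategory (SW S) :=
  MonoidalCategory.ofTensorHom
    (id_tensorHom_id := fun X Y => tensorHom_ofEq rfl rfl)
    (id_tensorHom := fun _ _ _ _ => rfl)
    (tensorHom_id := fun _ _ => rfl)
    (tensorHom_comp_tensorHom := by
      intro X₁ Y₁ Z₁ X₂ Y₂ Z₂ f₁ f₂ g₁ g₂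
      by_cases h₁ : X₁.deg = Y₁.deg
      · by_cases h₂ : X₂.deg = Y₂.deg
        · obtain ⟨x₁⟩ := X₁; obtain ⟨x₂⟩ := X₂; obtain ⟨y₁⟩ := Y₁; obtain ⟨y₂⟩ := Y₂
          obtain rfl : x₁ = y₁ := h₁
          obtain rfl : x₂ = y₂ := h₂
          refine hom_ext ?_
          rw [val_comp _ _ rfl, val_tensor, val_tensor, val_tensor, val_comp _ _ rfl,
            val_comp _ _ rfl]
          simp only [castAlg_rfl]
          rw [← map_mul, Algebra.TensorProduct.tmul_mul_tmul]
        · rw [hom_eq_zero f₂ h₂, tensorHom_zero, Limits.zero_comp, Limits.zero_comp,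
            tensorHom_zero]
      · rw [hom_eq_zero f₁ h₁, zero_tensorHom, Limits.zero_comp, Limits.zero_comp,
          zero_tensorHom])
    (associator_naturality := by
      intro X₁ X₂ X₃ Y₁ Y₂ Y₃ f₁ f₂ f₃
      refine hom_ext ((val_comp_ofEq _ (Nat.add_assoc Y₁.deg Y₂.deg Y₃.deg)).trans
        ((castAlg_symm (Nat.add_assoc X₁.deg X₂.deg X₃.deg) _ _ ?_).trans
        (val_ofEq_comp (Nat.add_assoc X₁.deg X₂.deg X₃.deg) _).symm))
      exact S.assoc _ _ _ _ _ _)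
    (leftUnitor_naturality := by
      intro X Y f
      refine hom_ext ((val_comp_ofEq _ (Nat.zero_add Y.deg)).trans
        ((castAlg_symm (Nat.zero_add X.deg) _ _ ?_).trans (val_ofEq_comp (Nat.zero_add X.deg) _).symm))
      exact S.one_left _ _)
    (rightUnitor_naturality := by
      intro X Y f
      refine hom_ext ((val_comp_ofEq _ (Nat.add_zero Y.deg)).trans (Eq.trans ?_
        (val_ofEq_comp (Nat.add_zero X.deg) _).symm))
      exact S.one_right _ _)
    (pentagon := by
      intro W X Y Z
      have h₁ := tensorHom_ofEq (Nat.add_assoc W.deg X.deg Y.deg) (rfl : Z.deg = Z.deg)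
      have h₂ := tensorHom_ofEq (rfl : W.deg = W.deg) (Nat.add_assoc X.deg Y.deg Z.deg)
      change ((isoOfEq _).hom ⊗ₘ (isoOfEq (rfl : Z.deg = Z.deg)).hom) ≫ (isoOfEq _).hom ≫
        ((isoOfEq (rfl : W.deg = W.deg)).hom ⊗ₘ (isoOfEq _).hom) = (isoOfEq _).hom ≫ (isoOfEq _).hom
      rw [h₁, h₂]
      simp only [ofEq_comp_ofEq])
    (triangle := by
      intro X Y
      have h₁ := tensorHom_ofEq (rfl : X.deg = X.deg) (Nat.zero_add Y.deg)
      have h₂ := tensorHom_ofEq (Nat.add_zero X.deg) (rfl : Y.deg = Y.deg)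
      change (isoOfEq _).hom ≫ ((isoOfEq (rfl : X.deg = X.deg)).hom ⊗ₘ (isoOfEq _).hom) =
        ((isoOfEq _).hom ⊗ₘ (isoOfEq (rfl : Y.deg = Y.deg)).hom)
      rw [h₁, h₂]
      simp only [ofEq_comp_ofEq])

instance : MonoidalPreadditive (SW S) where
  whiskerLeft_zero := tensorHom_zero _
  zero_whiskerRight := zero_tensorHom _
  whiskerLeft_add f g := by
    refine hom_ext ?_
    change S.μ _ _ (_ ⊗ₜ (f.1 + g.1)) = S.μ _ _ (_ ⊗ₜ f.1) + S.μ _ _ (_ ⊗ₜ g.1)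
    rw [TensorProduct.tmul_add, map_add]
  add_whiskerRight f g := by
    refine hom_ext ?_
    change S.μ _ _ ((f.1 + g.1) ⊗ₜ _) = S.μ _ _ (f.1 ⊗ₜ _) + S.μ _ _ (g.1 ⊗ₜ _)
    rw [TensorProduct.add_tmul, map_add]

instance : MonoidalLinear k (SW S) where
  whiskerLeft_smul X Y Z c f := by
    refine hom_ext ?_
    change S.μ _ _ (_ ⊗ₜ (c • f.1)) = c • S.μ _ _ (_ ⊗ₜ f.1)
    rw [TensorProduct.tmul_smul, map_smul]
  smul_whiskerRight c Y Z f X := by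
    refine hom_ext ?_
    change S.μ _ _ ((c • f.1) ⊗ₜ _) = c • S.μ _ _ (f.1 ⊗ₜ _)
    rw [← TensorProduct.smul_tmul', map_smul]

end SW

end SchurWeyl

/-! ### The degenerate affine Hecke category -/

section Hecke

/-- The generators `t₁, …, tₙ₋₁` and `y₁, …, yₙ` of the degenerate affine Hecke algebra, indexed
from `0`. -/
inductive Gen (n : ℕ) : Type
  | t (i : ℕ) (h : i + 1 < n) : Gen n
  | y (i : ℕ) (h : i < n) : Gen n

variable (k : Type w) [Field k]

/-- The defining relations of the degenerate affine Hecke algebra. -/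
inductive Rel (n : ℕ) : FreeAlgebra k (Gen n) → FreeAlgebra k (Gen n) → Prop
  | t_sq (i : ℕ) (h : i + 1 < n) :
      Rel n (FreeAlgebra.ι k (Gen.t i h) * FreeAlgebra.ι k (Gen.t i h)) 1
  | braid (i : ℕ) (h : i + 1 < n) (h' : i + 1 + 1 < n) :
      Rel n
        (FreeAlgebra.ι k (Gen.t i h) * FreeAlgebra.ι k (Gen.t (i + 1) h') *
          FreeAlgebra.ι k (Gen.t i h))
        (FreeAlgebra.ι k (Gen.t (i + 1) h') * FreeAlgebra.ι k (Gen.t i h) *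
          FreeAlgebra.ι k (Gen.t (i + 1) h'))
  | t_comm (i j : ℕ) (hi : i + 1 < n) (hj : j + 1 < n) (hij : i + 1 < j) :
      Rel n (FreeAlgebra.ι k (Gen.t i hi) * FreeAlgebra.ι k (Gen.t j hj))
        (FreeAlgebra.ι k (Gen.t j hj) * FreeAlgebra.ι k (Gen.t i hi))
  | y_t (i : ℕ) (h : i + 1 < n) (h' : i < n) :
      Rel n
        (FreeAlgebra.ι k (Gen.y i h') * FreeAlgebra.ι k (Gen.t i h) -
          FreeAlgebra.ι k (Gen.t i h) * FreeAlgebra.ι k (Gen.y (i + 1) h)) 1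
  | y_comm (i j : ℕ) (hi : i < n) (hj : j < n) :
      Rel n (FreeAlgebra.ι k (Gen.y i hi) * FreeAlgebra.ι k (Gen.y j hj))
        (FreeAlgebra.ι k (Gen.y j hj) * FreeAlgebra.ι k (Gen.y i hi))
  | t_y (i j : ℕ) (hi : i + 1 < n) (hj : j < n) (h : j ≠ i) (h' : j ≠ i + 1) :
      Rel n (FreeAlgebra.ι k (Gen.t i hi) * FreeAlgebra.ι k (Gen.y j hj))
        (FreeAlgebra.ι k (Gen.y j hj) * FreeAlgebra.ι k (Gen.t i hi))

/-- The degenerate affine Hecke algebra `Λₙ`. -/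
def DAHA (n : ℕ) : Type w := RingQuot (Rel k n)

instance (n : ℕ) : Ring (DAHA k n) := inferInstanceAs (Ring (RingQuot (Rel k n)))

instance (n : ℕ) : Algebra k (DAHA k n) := inferInstanceAs (Algebra k (RingQuot (Rel k n)))

namespace DAHA

variable {n : ℕ}

variable (n) in
/-- The quotient map onto `Λₙ`. -/
def mk : FreeAlgebra k (Gen n) →ₐ[k] DAHA k n := RingQuot.mkAlgHom k (Rel k n)

/-- The element `tᵢ` of `Λₙ`. -/
def t (i : ℕ) (h : i + 1 < n) : DAHA k n := mk k n (FreeAlgebra.ι k (Gen.t i h))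

/-- The element `yᵢ` of `Λₙ`. -/
def y (i : ℕ) (h : i < n) : DAHA k n := mk k n (FreeAlgebra.ι k (Gen.y i h))

variable {k}

theorem rel {a b : FreeAlgebra k (Gen n)} (h : Rel k n a b) :
    mk k n a = mk k n b :=
  RingQuot.mkAlgHom_rel k h

theorem t_sq (i : ℕ) (h : i + 1 < n) : t k i h * t k i h = 1 := by
  have := rel (Rel.t_sq (k := k) i h)
  simp only [map_mul, map_one] at this
  exact this

theorem braid (i : ℕ) (h : i + 1 < n) (h' : i + 1 + 1 < n) :
    t k i h * t k (i + 1) h' * t k i h = t k (i + 1) h' * t k i h * t k (i + 1) h' := by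
  have := rel (Rel.braid (k := k) i h h')
  simp only [map_mul] at this
  exact this

theorem t_comm (i j : ℕ) (hi : i + 1 < n) (hj : j + 1 < n) (hij : i + 1 < j) :
    t k i hi * t k j hj = t k j hj * t k i hi := by
  have := rel (Rel.t_comm (k := k) i j hi hj hij)
  simp only [map_mul] at this
  exact this

theorem y_t (i : ℕ) (h : i + 1 < n) (h' : i < n) :
    y k i h' * t k i h - t k i h * y k (i + 1) h = 1 := by
  have := rel (Rel.y_t (k := k) i h h')
  simp only [map_mul, map_sub, map_one] at this
  exact this

theorem y_comm (i j : ℕ) (hi : i < n) (hj : j < n) :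
    y k i hi * y k j hj = y k j hj * y k i hi := by
  have := rel (Rel.y_comm (k := k) i j hi hj)
  simp only [map_mul] at this
  exact this

theorem t_y (i j : ℕ) (hi : i + 1 < n) (hj : j < n) (h : j ≠ i) (h' : j ≠ i + 1) :
    t k i hi * y k j hj = y k j hj * t k i hi := by
  have := rel (Rel.t_y (k := k) i j hi hj h h')
  simp only [map_mul] at this
  exact this

/-- The images of the generators of `Λₘ` in `Λₙ` under the shift of indices by `s`. -/
def shiftGen {m n : ℕ} (s : ℕ) (h : m + s ≤ n) : Gen m → DAHA k n
  | .t i hi => t k (i + s) (by omega)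
  | .y i hi => y k (i + s) (by omega)

theorem shiftGen_rel {m n : ℕ} (s : ℕ) (h : m + s ≤ n) ⦃a b : FreeAlgebra k (Gen m)⦄
    (hab : Rel k m a b) :
    FreeAlgebra.lift k (shiftGen (k := k) s h) a = FreeAlgebra.lift k (shiftGen s h) b := by
  have e : ∀ i, i + 1 + s = i + s + 1 := fun i => by omega
  cases hab with
  | t_sq i hi => simpa [shiftGen] using t_sq _ _
  | braid i hi hi' => simpa [shiftGen, e] using braid _ _ _
  | t_comm i j hi hj hij => simpa [shiftGen] using t_comm _ _ _ _ (by omega)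
  | y_t i hi hi' => simpa [shiftGen, e] using y_t _ _ _
  | y_comm i j hi hj => simpa [shiftGen] using y_comm _ _ _ _
  | t_y i j hi hj h h' => simpa [shiftGen] using t_y _ _ _ _ (by omega) (by omega)

/-- The homomorphism `Λₘ → Λₙ`, `tᵢ ↦ tᵢ₊ₛ`, `yᵢ ↦ yᵢ₊ₛ`, for `m + s ≤ n`. -/
def shift {m n : ℕ} (s : ℕ) (h : m + s ≤ n) : DAHA k m →ₐ[k] DAHA k n :=
  RingQuot.liftAlgHom k ⟨FreeAlgebra.lift k (shiftGen s h), shiftGen_rel s h⟩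

theorem shift_t {m n : ℕ} (s : ℕ) (h : m + s ≤ n) (i : ℕ) (hi : i + 1 < m) :
    shift s h (t k i hi) = t k (i + s) (by omega) := by
  refine (RingQuot.liftAlgHom_mkAlgHom_apply k _ _ _).trans ?_
  rw [FreeAlgebra.lift_ι_apply]; rfl

theorem shift_y {m n : ℕ} (s : ℕ) (h : m + s ≤ n) (i : ℕ) (hi : i < m) :
    shift s h (y k i hi) = y k (i + s) (by omega) := by
  refine (RingQuot.liftAlgHom_mkAlgHom_apply k _ _ _).trans ?_
  rw [FreeAlgebra.lift_ι_apply]; rfl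

/-- The generators generate. -/
theorem induction {P : DAHA k n → Prop} (halg : ∀ c : k, P (algebraMap k _ c))
    (ht : ∀ i h, P (t k i h)) (hy : ∀ i h, P (y k i h))
    (hadd : ∀ a b, P a → P b → P (a + b)) (hmul : ∀ a b, P a → P b → P (a * b))
    (a : DAHA k n) : P a := by
  obtain ⟨a, rfl⟩ := RingQuot.mkAlgHom_surjective k (Rel k n) a
  induction a using FreeAlgebra.induction with
  | grade0 c => rw [AlgHom.commutes]; exact halg c
  | grade1 g =>
    cases g with
    | t i h => exact ht i h
    | y i h => exact hy i h
  | mul a b ha hb => rw [map_mul]; exact hmul _ _ ha hb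
  | add a b ha hb => rw [map_add]; exact hadd _ _ ha hb

theorem algHom_ext {A : Type*} [Ring A] [Algebra k A] {f g : DAHA k n →ₐ[k] A}
    (ht : ∀ i h, f (t k i h) = g (t k i h)) (hy : ∀ i h, f (y k i h) = g (y k i h)) :
    f = g := by
  refine AlgHom.ext fun a => ?_
  induction a using DAHA.induction with
  | halg c => rw [AlgHom.commutes, AlgHom.commutes]
  | ht i h => exact ht i h
  | hy i h => exact hy i h
  | hadd a b ha hb => rw [map_add, map_add, ha, hb]
  | hmul a b ha hb => rw [map_mul, map_mul, ha, hb]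

theorem shift_shift {l m n : ℕ} (s s' : ℕ) (h : l + s ≤ m) (h' : m + s' ≤ n) (a : DAHA k l) :
    shift s' h' (shift s h a) = shift (s + s') (by omega) a := by
  refine DFunLike.congr_fun (f := (shift s' h').comp (shift s h)) (algHom_ext ?_ ?_) a
  · intro i hi
    simp only [AlgHom.comp_apply, shift_t, Nat.add_assoc]
  · intro i hi
    simp only [AlgHom.comp_apply, shift_y, Nat.add_assoc]

theorem shift_zero {n : ℕ} (h : n + 0 ≤ n) (a : DAHA k n) : shift 0 h a = a := by
  refine DFunLike.congr_fun (g := AlgHom.id k (DAHA k n)) (algHom_ext ?_ ?_) a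
  · intro i hi
    exact shift_t _ _ _ _
  · intro i hi
    exact shift_y _ _ _ _

/-- The elements of the two blocks commute. -/
theorem shift_commute {m n : ℕ} (h : m + 0 ≤ m + n) (h' : n + m ≤ m + n) (a : DAHA k m)
    (b : DAHA k n) : Commute (shift 0 h a) (shift m h' b) := by
  induction a using DAHA.induction with
  | halg c => rw [AlgHom.commutes]; exact Algebra.commutes _ _
  | hadd a a' ha ha' => rw [map_add]; exact ha.add_left ha'
  | hmul a a' ha ha' => rw [map_mul]; exact ha.mul_left ha'
  | ht i hi =>
    rw [shift_t]
    induction b using DAHA.induction with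
    | halg c => rw [AlgHom.commutes]; exact (Algebra.commutes _ _).symm
    | hadd a a' ha ha' => rw [map_add]; exact ha.add_right ha'
    | hmul a a' ha ha' => rw [map_mul]; exact ha.mul_right ha'
    | ht j hj => rw [shift_t]; exact t_comm _ _ _ _ (by omega)
    | hy j hj => rw [shift_y]; exact t_y _ _ _ _ (by omega) (by omega)
  | hy i hi =>
    rw [shift_y]
    induction b using DAHA.induction with
    | halg c => rw [AlgHom.commutes]; exact (Algebra.commutes _ _).symm
    | hadd a a' ha ha' => rw [map_add]; exact ha.add_right ha'
    | hmul a a' ha ha' => rw [map_mul]; exact ha.mul_right ha'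
    | ht j hj => rw [shift_t]; exact (t_y _ _ _ _ (by omega) (by omega)).symm
    | hy j hj => rw [shift_y]; exact y_comm _ _ _ _

/-- The homomorphism `Λₘ ⊗ Λₙ → Λₘ₊ₙ`, `tᵢ ⊗ 1 ↦ tᵢ`, `1 ⊗ tⱼ ↦ tⱼ₊ₘ`, `yᵢ ⊗ 1 ↦ yᵢ`,
`1 ⊗ yⱼ ↦ yⱼ₊ₘ`. -/
def μ (m n : ℕ) : DAHA k m ⊗[k] DAHA k n →ₐ[k] DAHA k (m + n) :=
  Algebra.TensorProduct.lift (shift 0 (by omega)) (shift m (by omega))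
    fun a b => shift_commute _ _ a b

theorem μ_tmul (m n : ℕ) (a : DAHA k m) (b : DAHA k n) :
    μ m n (a ⊗ₜ b) = shift 0 (by omega) a * shift m (by omega) b := rfl

theorem castAlg_shift {l m n : ℕ} (h : m = n) (s : ℕ) (h' : l + s ≤ m) (a : DAHA k l) :
    castAlg k (DAHA k) h (shift s h' a) = shift s (h ▸ h') a := by
  subst h; rfl

theorem bijective_algebraMap : Function.Bijective (algebraMap k (DAHA k 0)) := by
  constructor
  · let f : DAHA k 0 →ₐ[k] k := RingQuot.liftAlgHom k ⟨FreeAlgebra.lift k fun _ => 0, by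
      intro a b hab
      cases hab <;> omega⟩
    intro a b hab
    simpa using congrArg f hab
  · intro a
    induction a using DAHA.induction with
    | halg c => exact ⟨c, rfl⟩
    | ht i h => omega
    | hy i h => omega
    | hadd a b ha hb =>
      obtain ⟨a, rfl⟩ := ha
      obtain ⟨b, rfl⟩ := hb
      exact ⟨a + b, map_add _ _ _⟩
    | hmul a b ha hb =>
      obtain ⟨a, rfl⟩ := ha
      obtain ⟨b, rfl⟩ := hb
      exact ⟨a * b, map_mul _ _ _⟩

end DAHA

/-- The multiplicative sequence of degenerate affine Hecke algebras. -/
def heckeSeq : MultSeq.{w} k where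
  A := DAHA k
  bijective_algebraMap := DAHA.bijective_algebraMap
  μ := DAHA.μ
  assoc l m n a b c := by
    simp only [DAHA.μ_tmul, map_mul, DAHA.castAlg_shift, DAHA.shift_shift, mul_assoc, zero_add,
      add_zero, Nat.add_comm m l]
  one_left n a := by
    simp only [DAHA.μ_tmul, map_one, one_mul, DAHA.castAlg_shift]
    exact DAHA.shift_zero _ a
  one_right n a := by
    simp only [DAHA.μ_tmul, map_one, mul_one]
    exact DAHA.shift_zero _ a

/-- The degenerate affine Hecke category `𝓛`. -/
abbrev heckeCat : Type := SW (heckeSeq k)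

end Hecke

/-! ### Block subalgebras and symmetric powers -/

section Centralizer

/-- The image of `A_{m₁} ⊗ ⋯ ⊗ A_{mᵣ}` in `A_{m₁ + ⋯ + mᵣ}`. -/
def MultSeq.block {k : Type w} [Field k] (S : MultSeq.{u} k) :
    (l : List ℕ) → Subalgebra k (S.A l.sum)
  | [] => ⊥
  | m :: l => ((S.μ m l.sum).comp
      (Algebra.TensorProduct.map (AlgHom.id k (S.A m)) (S.block l).val)).range

/-- The centralizer `C(m₁, …, mᵣ)` of the image of `A_{m₁} ⊗ ⋯ ⊗ A_{mᵣ}` in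
`A_{m₁ + ⋯ + mᵣ}`. -/
def MultSeq.centralizer {k : Type w} [Field k] (S : MultSeq.{u} k) (l : List ℕ) :
    Subalgebra k (S.A l.sum) :=
  Subalgebra.centralizer k (S.block l : Set (S.A l.sum))

variable (k : Type w) [Field k]

theorem reindex_mul {n : ℕ} (σ : Equiv.Perm (Fin n)) (a b : ⨂[k] _ : Fin n, Polynomial k) :
    PiTensorProduct.reindex k (fun _ => Polynomial k) σ (a * b) =
      PiTensorProduct.reindex k (fun _ => Polynomial k) σ a *
        PiTensorProduct.reindex k (fun _ => Polynomial k) σ b := by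
  induction a using PiTensorProduct.induction_on with
  | add a a' ha ha' => rw [add_mul, map_add, map_add, add_mul, ha, ha']
  | smul_tprod c f =>
    induction b using PiTensorProduct.induction_on with
    | add b b' hb hb' => rw [mul_add, map_add, map_add, mul_add, hb, hb']
    | smul_tprod c' g =>
      rw [PiTensorProduct.smul_tprod_mul_smul_tprod, map_smul, map_smul, map_smul,
        PiTensorProduct.reindex_tprod, PiTensorProduct.reindex_tprod,
        PiTensorProduct.reindex_tprod, PiTensorProduct.smul_tprod_mul_smul_tprod]
      rfl

/-- The symmetric power `Sᵐ(k[x])`: the subalgebra of the elements of `k[x]^{⊗ m}` that are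
invariant under the permutations of the factors. -/
def symPow (m : ℕ) : Subalgebra k (⨂[k] _ : Fin m, Polynomial k) where
  carrier := {z | ∀ σ : Equiv.Perm (Fin m),
    PiTensorProduct.reindex k (fun _ => Polynomial k) σ z = z}
  add_mem' ha hb σ := by rw [map_add, ha σ, hb σ]
  mul_mem' ha hb σ := by rw [reindex_mul, ha σ, hb σ]
  algebraMap_mem' c σ := by
    rw [Algebra.algebraMap_eq_smul_one, PiTensorProduct.one_def, map_smul,
      PiTensorProduct.reindex_tprod]
    rfl

/-- The linear map `k[x]^{⊗ m} → Λₘ`, `p₁ ⊗ ⋯ ⊗ pₘ ↦ p₁(y₁) ⋯ pₘ(yₘ)`. -/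
def polyMap (m : ℕ) : (⨂[k] _ : Fin m, Polynomial k) →ₗ[k] DAHA k m :=
  PiTensorProduct.lift ((MultilinearMap.mkPiAlgebraFin k m (DAHA k m)).compLinearMap
    fun i => (Polynomial.aeval (DAHA.y k (i : ℕ) i.2)).toLinearMap)

/-- For `fᵢ ∈ S^{mᵢ}(k[x])`, the image of `f₁ ⊗ ⋯ ⊗ fᵣ` in `Λ_{m₁ + ⋯ + mᵣ}`, where `fᵢ` is
evaluated at the generators `y` of the `i`-th block. -/
def blockProd : (l : List ℕ) → (∀ i : Fin l.length, symPow k (l.get i)) → DAHA k l.sum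
  | [], _ => 1
  | m :: l, f => DAHA.μ m l.sum
      (polyMap k m (f ⟨0, Nat.succ_pos _⟩).1 ⊗ₜ blockProd l (fun i => f i.succ))

end Centralizer

end

end TensorDeformation

/-! Everything rests on the faithfulness of the polynomial representation of `Λₙ`, in which `yᵢ`
multiplies by `Xᵢ` and `tᵢ` acts as a transposition of variables plus a divided difference. Every
element is a sum of terms `f_w(y) w` (`normalSum_surjective`), where the words `w` in the `tᵢ` are
determined by their permutations (`words_ext`). As `w` acts as its permutation up to terms of lower
degree, Dedekind's independence of characters yields `rep_injective`. Hence whatever commutes with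
all `yᵢ` is a polynomial in them (`eq_poly_of_commute`), and a polynomial commutes with `tᵢ` exactly
when the corresponding transposition fixes it (`poly_commute_t_iff`). So the centralizers consist of
the block-symmetric polynomials `Inv`, and the second assertion follows by matching bases of orbit
sums (`symPowTensorInv`).

For the first assertion, a natural endomorphism of `[m₁] ⊗ ⋯ ⊗ [mₙ]` is thus a block-symmetric
polynomial, and its coefficients form a function of lists `(M₁, …, Mₙ)` of multisets of exponents
with `|Mᵢ| = mᵢ`. Tensoring two neighbouring objects joins their blocks, so it adds two multisets;
the polynomial `1` has coefficient `1` where all exponents are `0`. Therefore (`coch_d`) the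
deformation complex consists of functions on the bar complex of the polynomial ring `R = k[z₀, z₁,
…]`, the monoid algebra of the multisets, with the augmentation `z₀ ↦ 1`, `zⱼ ↦ 0` for `j > 0`. The
functions are restricted by a finiteness condition for each `(m₁, …, mₙ)`. By the Koszul resolution
the bar complex has the exterior algebra on the `zⱼ` as homology; the finiteness condition selects
`Λ(k[x])` inside its full dual.

To keep track of that condition, the comparison with the Koszul resolution is explicit: the
antisymmetrization `ant`, the contraction `con`, the homotopy `hpy`. As `z₀ ↦ 1`, these maps do not
preserve multidegrees, but all they do is delete copies of the generator `0` (`Loc`). So the sum of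
the exponents is constant and their number does not grow, and the primitives in `eq_prim` satisfy
the finiteness condition (`finOn_prim`). Consequently a cocycle that vanishes on the
antisymmetrizations of lists of generators is a coboundary (`mem_B_of_alt`).

The isomorphism is induced by `ev`: evaluate a cochain at `[1], …, [1]` and send `∏ Xᵢ ^ eᵢ` to the
wedge of the `x ^ eᵢ`. This is multiplicative (`ev_cup`) and kills coboundaries (`ev_d`). It is
surjective on cocycles because each polynomial in `x` gives a cocycle of power sums
(`powerCocycle_mem`), and its kernel consists of coboundaries because the values of a cocycle on
antisymmetrizations are contractions of its image (`lin_alt`). -/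

namespace TensorDeformation

noncomputable section

/-! ### The augmented bar resolution of the polynomial ring on the generators `0, 1, 2, …`. -/

namespace Bar

variable {k : Type w} [Field k]

/-- The augmentation of the free commutative monoid on `ℕ` that sends the generator `0` to `1`
and the other generators to `0`. -/
def eps (k : Type w) [Field k] (M : Multiset ℕ) : k :=
  open Classical in if ∀ x ∈ M, x = 0 then 1 else 0

theorem eps_zero : eps k 0 = 1 := by simp [eps]

theorem eps_add (M N : Multiset ℕ) : eps k (M + N) = eps k M * eps k N := by
  unfold eps
  by_cases h : ∀ x ∈ M, x = 0
  · by_cases h' : ∀ x ∈ N, x = 0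
    · rw [if_pos h, if_pos h', if_pos, one_mul]
      intro x hx
      exact (Multiset.mem_add.1 hx).elim (h x) (h' x)
    · rw [if_neg h', if_neg, mul_zero]
      exact fun H => h' fun x hx => H x (Multiset.mem_add.2 (Or.inr hx))
  · rw [if_neg h, if_neg, zero_mul]
    exact fun H => h fun x hx => H x (Multiset.mem_add.2 (Or.inl hx))

theorem eps_eq_zero {M : Multiset ℕ} {x : ℕ} (h : x ∈ M) (hx : x ≠ 0) : eps k M = 0 :=
  if_neg fun H => hx (H x h)

theorem eps_of_forall {M : Multiset ℕ} (h : ∀ x ∈ M, x = 0) : eps k M = 1 := if_pos h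

variable (k) in
/-- The chains: formal linear combinations of lists of monomials. -/
abbrev Ch : Type w := List (Multiset ℕ) →₀ k

variable (k) in
/-- Linear extension. -/
abbrev lin {α V : Type*} [AddCommGroup V] [Module k V] (f : α → V) : (α →₀ k) →ₗ[k] V :=
  Finsupp.linearCombination k f

variable (k) in
/-- The basis element of an index. -/
abbrev bs {α : Type*} (a : α) : α →₀ k := Finsupp.single a 1

/-- Restrictions on length, multidegree and order of the generators are expressed as supports; this
lemma and the next reduce claims under such restrictions to basis elements. -/
theorem eq_of_supported {α V : Type*} [AddCommGroup V] [Module k V] {f g : (α →₀ k) →ₗ[k] V}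
    {s : Set α} (h : ∀ a ∈ s, f (bs k a) = g (bs k a)) {ω : α →₀ k}
    (hω : ω ∈ Finsupp.supported k k s) : f ω = g ω := by
  rw [Finsupp.supported_eq_span_single] at hω
  refine LinearMap.eqOn_span (f := f) (g := g) ?_ hω
  rintro _ ⟨a, ha, rfl⟩
  exact h a ha

theorem map_mem_of_supported {α V : Type*} [AddCommGroup V] [Module k V]
    (f : (α →₀ k) →ₗ[k] V) {s : Set α} {W : Submodule k V}
    (h : ∀ a ∈ s, f (bs k a) ∈ W) {ω : α →₀ k}
    (hω : ω ∈ Finsupp.supported k k s) : f ω ∈ W := by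
  rw [Finsupp.supported_eq_span_single] at hω
  have : Submodule.span k ((fun i => Finsupp.single i (1 : k)) '' s) ≤ W.comap f := by
    rw [Submodule.span_le]
    rintro _ ⟨a, ha, rfl⟩
    exact h a ha
  exact this hω

/-- Adding an entry in front. -/
def cons (M : Multiset ℕ) : Ch k →ₗ[k] Ch k := lin k fun L => Finsupp.single (M :: L) 1

/-- Multiplication of the first entry, which is regarded as a coefficient, by a monomial. -/
def act0 (M : Multiset ℕ) : List (Multiset ℕ) → Ch k
  | [] => eps k M • Finsupp.single [] 1
  | N :: L => Finsupp.single ((M + N) :: L) 1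

/-- The action of a monomial on the augmented bar resolution. -/
def act (M : Multiset ℕ) : Ch k →ₗ[k] Ch k := lin k (act0 M)

/-- The reduction of the coefficient along the augmentation. -/
def red0 : List (Multiset ℕ) → Ch k
  | [] => 0
  | N :: L => eps k N • Finsupp.single L 1

/-- The reduction of the coefficient along the augmentation. -/
def red : Ch k →ₗ[k] Ch k := lin k red0

/-- The differential of the augmented bar resolution. -/
def bar0 : List (Multiset ℕ) → Ch k
  | [] => 0
  -- The first entry of a list is its coefficient, and `[]` spans the augmentation module. The
  -- coefficient is multiplied into the next entry, or augmented if there is none; the other faces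
  -- are those of the tail with the opposite sign.
  | M :: L => act M (Finsupp.single L 1) - cons M (bar0 L)

/-- The differential of the augmented bar resolution. -/
def bar : Ch k →ₗ[k] Ch k := lin k bar0

theorem lin_bs {α V : Type*} [AddCommGroup V] [Module k V] (f : α → V) (a : α) :
    lin k f (bs k a) = f a := by
  simp [lin]

@[simp] theorem cons_bs (M : Multiset ℕ) (L : List (Multiset ℕ)) :
    cons M (bs k L) = bs k (M :: L) := lin_bs _ _

@[simp] theorem act_nil (M : Multiset ℕ) : act M (bs k []) = eps k M • bs k [] := lin_bs _ _

@[simp] theorem act_cons (M N : Multiset ℕ) (L : List (Multiset ℕ)) :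
    act M (bs k (N :: L)) = bs k ((M + N) :: L) := lin_bs _ _

@[simp] theorem red_nil : red (bs k ([] : List (Multiset ℕ))) = 0 := lin_bs _ _

@[simp] theorem red_cons (N : Multiset ℕ) (L : List (Multiset ℕ)) :
    red (bs k (N :: L)) = eps k N • bs k L := lin_bs _ _

@[simp] theorem bar_nil : bar (bs k ([] : List (Multiset ℕ))) = 0 := lin_bs _ _

theorem bar_cons_bs (M : Multiset ℕ) (L : List (Multiset ℕ)) :
    bar (bs k (M :: L)) = act M (bs k L) - cons M (bar (bs k L)) := by
  rw [bar, lin_bs, lin_bs]; rfl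

theorem ext_bs {α V : Type*} [AddCommGroup V] [Module k V] {f g : (α →₀ k) →ₗ[k] V}
    (h : ∀ a, f (bs k a) = g (bs k a)) (ω : α →₀ k) : f ω = g ω :=
  DFunLike.congr_fun (Finsupp.lhom_ext' fun a => LinearMap.ext_ring (h a)) ω

/-- For `M = 0`, the monomial `1`, this says that prepending `1` contracts the augmented bar
resolution. -/
theorem bar_cons (M : Multiset ℕ) (ω : Ch k) :
    bar (cons M ω) = act M ω - cons M (bar ω) :=
  ext_bs (f := bar ∘ₗ cons M) (g := act M - cons M ∘ₗ bar)
    (fun L => by simp [bar_cons_bs]) ω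

theorem act_act (M N : Multiset ℕ) (ω : Ch k) : act M (act N ω) = act (M + N) ω :=
  ext_bs (f := act M ∘ₗ act N) (g := act (M + N)) (fun L => by
    cases L with
    | nil => simp [eps_add, smul_smul, mul_comm, -Finsupp.smul_single]
    | cons M' L => simp [add_assoc]) ω

theorem act_zero (ω : Ch k) : act 0 ω = ω :=
  ext_bs (f := act 0) (g := LinearMap.id) (fun L => by
    cases L with
    | nil => simp [eps_zero]
    | cons M' L => simp) ω

theorem act_cons_apply (M N : Multiset ℕ) (ω : Ch k) : act M (cons N ω) = cons (M + N) ω :=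
  ext_bs (f := act M ∘ₗ cons N) (g := cons (M + N)) (fun L => by simp) ω

theorem red_cons_apply (N : Multiset ℕ) (ω : Ch k) : red (cons N ω) = eps k N • ω :=
  ext_bs (f := red ∘ₗ cons N) (g := eps k N • LinearMap.id) (fun L => by simp) ω

theorem red_act (M : Multiset ℕ) (ω : Ch k) : red (act M ω) = eps k M • red ω :=
  ext_bs (f := red ∘ₗ act M) (g := eps k M • red) (fun L => by
    cases L with
    | nil => simp [-Finsupp.smul_single]
    | cons M' L => simp [eps_add, smul_smul, -Finsupp.smul_single]) ω

theorem bar_act (M : Multiset ℕ) (ω : Ch k) : bar (act M ω) = act M (bar ω) :=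
  ext_bs (f := bar ∘ₗ act M) (g := act M ∘ₗ bar) (fun L => by
    cases L with
    | nil => simp [-Finsupp.smul_single]
    | cons M' L => simp [bar_cons_bs, act_act, act_cons_apply]) ω

/-- On `M :: L` the differential of the first term is `act M (bar L)` by linearity over the monoid,
and `bar_cons` produces the same element from the second term, so only `cons M (bar (bar L))` is
left. -/
theorem bar_bar (ω : Ch k) : bar (bar ω) = 0 :=
  ext_bs (f := bar ∘ₗ bar) (g := 0) (fun L => by
    induction L with
    | nil => simp
    | cons M' L ih =>
      have ih' : bar (bar (bs k L)) = 0 := ih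
      simp [bar_cons_bs, bar_act, bar_cons, ih']) ω

variable (k) in
/-- The differential of the bar complex. -/
def bd : Ch k →ₗ[k] Ch k := red - bar

/-- On `M :: L` both sides are `eps M` times `red L - bar L`: augmenting the coefficients turns the
resolution into the bar complex, whose first face is `red`. -/
theorem red_bar (ω : Ch k) : red (bar ω) = bd k (red ω) :=
  ext_bs (f := red ∘ₗ bar) (g := bd k ∘ₗ red) (fun L => by
    cases L with
    | nil => simp
    | cons M L => simp [bar_cons_bs, red_act, red_cons_apply, bd, smul_sub, -Finsupp.smul_single]) ω

/-! ### Shuffles -/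

/-- The signed shuffles of a generator into a list. -/
def sh0 (x : ℕ) : List (Multiset ℕ) → Ch k
  | [] => bs k [{x}]
  | M :: L => bs k ({x} :: M :: L) - cons M (sh0 x L)

/-- The signed shuffles of a generator into a list. -/
def sh (x : ℕ) : Ch k →ₗ[k] Ch k := lin k (sh0 x)

/-- The signed shuffles of a generator into a list with a coefficient. -/
def shc (x : ℕ) : Ch k →ₗ[k] Ch k := cons {x} - sh x

@[simp] theorem sh_nil (x : ℕ) : sh x (bs k []) = bs k [{x}] := lin_bs _ _

theorem sh_cons_bs (x : ℕ) (M : Multiset ℕ) (L : List (Multiset ℕ)) :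
    sh x (bs k (M :: L)) = bs k ({x} :: M :: L) - cons M (sh x (bs k L)) := by
  rw [sh, lin_bs, lin_bs]; rfl

/-- The insertion in front of `M` cancels against `cons {x}`; what remains are the insertions behind
the coefficient. -/
theorem shc_cons (x : ℕ) (M : Multiset ℕ) (ω : Ch k) : shc x (cons M ω) = cons M (sh x ω) :=
  ext_bs (f := shc x ∘ₗ cons M) (g := cons M ∘ₗ sh x)
    (fun L => by simp [shc, sh_cons_bs]) ω

theorem shc_nil (x : ℕ) : shc x (bs k []) = 0 := by simp [shc]

theorem act_shc (x : ℕ) (M : Multiset ℕ) (ω : Ch k) : act M (shc x ω) = shc x (act M ω) :=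
  ext_bs (f := act M ∘ₗ shc x) (g := shc x ∘ₗ act M) (fun L => by
    cases L with
    | nil => simp [shc_nil, -Finsupp.smul_single]
    | cons N L =>
      have := shc_cons x N (bs k L)
      have h' := shc_cons x (M + N) (bs k L)
      simp only [cons_bs] at this h'
      simp [this, act_cons_apply, h']) ω

/-- Shuffling with `x` is a homotopy between the two actions of the generator `x`, by multiplication
and through the augmentation. In the induction, the term that multiplies the coefficient `M` by `x`
arises as `M + {x}`; commutativity of the monoid is what makes it the action of `x`. -/
theorem bar_shc_bs (x : ℕ) (L : List (Multiset ℕ)) :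
    bar (shc x (bs k L)) =
      act {x} (bs k L) - eps k {x} • bs k L - shc x (bar (bs k L)) := by
  induction L with
  | nil => simp [shc_nil, -Finsupp.smul_single]
  | cons M L ih =>
    have hs : sh x (bs k L) = cons {x} (bs k L) - shc x (bs k L) := by
      simp only [shc, LinearMap.sub_apply, sub_sub_cancel]
    have hs' : shc x (bar (bs k L)) = cons {x} (bar (bs k L)) - sh x (bar (bs k L)) := by
      simp only [shc, LinearMap.sub_apply]
    rw [← cons_bs M L, shc_cons, bar_cons, hs, map_sub, map_sub, bar_cons, ih, act_cons_apply,
      act_cons_apply, act_shc, bar_cons, map_sub (shc (k := k) x), shc_cons, add_comm M, hs']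
    simp only [map_sub, map_smul]
    abel

theorem bar_shc (x : ℕ) (ω : Ch k) :
    bar (shc x ω) = act {x} ω - eps k {x} • ω - shc x (bar ω) := by
  have := ext_bs (f := bar ∘ₗ shc x) (g := act {x} - eps k {x} • LinearMap.id - shc x ∘ₗ bar)
    (fun L => by
      simpa only [LinearMap.comp_apply, LinearMap.sub_apply, LinearMap.smul_apply,
        LinearMap.id_apply] using bar_shc_bs x L) ω
  simpa only [LinearMap.comp_apply, LinearMap.sub_apply, LinearMap.smul_apply,
    LinearMap.id_apply] using this

/-! ### The Koszul resolution -/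

variable (k) in
/-- The augmented Koszul resolution: `some (M, S)` stands for `M ⊗ x₁ ∧ ⋯ ∧ xₙ`, and `none` for the
generator of the augmentation module. -/
abbrev Kz : Type w := Option (Multiset ℕ × List ℕ) →₀ k

def consK (x : ℕ) : Kz k →ₗ[k] Kz k :=
  lin k fun | none => 0 | some (M, S) => bs k (some (M, x :: S))

def actK (M : Multiset ℕ) : Kz k →ₗ[k] Kz k :=
  lin k fun | none => eps k M • bs k none | some (N, S) => bs k (some (M + N, S))

/-- The Koszul differential. -/
def kos1 (M : Multiset ℕ) : List ℕ → Kz k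
  | [] => eps k M • bs k none
  | x :: S => bs k (some ({x} + M, S)) - eps k {x} • bs k (some (M, S)) - consK x (kos1 M S)

/-- The right-hand lists are arbitrary here, with no antisymmetry imposed. They stand for exterior
monomials only when strictly increasing, and exactness is claimed only for those. -/
def kos : Kz k →ₗ[k] Kz k := lin k fun | none => 0 | some (M, S) => kos1 M S

@[simp] theorem consK_none (x : ℕ) : consK x (bs k none) = 0 := lin_bs _ _

@[simp] theorem consK_some (x : ℕ) (M S) :
    consK x (bs k (some (M, S))) = bs k (some (M, x :: S)) := lin_bs _ _

@[simp] theorem actK_none (M : Multiset ℕ) :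
    actK M (bs k none) = eps k M • bs k none := lin_bs _ _

@[simp] theorem actK_some (M N : Multiset ℕ) (S) :
    actK M (bs k (some (N, S))) = bs k (some (M + N, S)) := lin_bs _ _

@[simp] theorem kos_none : kos (bs k none) = 0 := lin_bs _ _

@[simp] theorem kos_nil (M : Multiset ℕ) :
    kos (bs k (some (M, []))) = eps k M • bs k none := lin_bs _ _

theorem kos_cons (M : Multiset ℕ) (x : ℕ) (S : List ℕ) :
    kos (bs k (some (M, x :: S))) = actK {x} (bs k (some (M, S))) -
      eps k {x} • bs k (some (M, S)) - consK x (kos (bs k (some (M, S)))) := by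
  rw [kos, lin_bs, lin_bs, actK_some]; rfl

/-- Wedging with `x` is a homotopy for `x - eps x`. Both halves of the contraction below, the one
for the generator `0` and the one for the positive generators, come from this identity. -/
theorem kos_consK (x : ℕ) (ω : Kz k) :
    consK x (kos ω) + kos (consK x ω) = (actK {x} ω - eps k {x} • ω) :=
  ext_bs (f := consK x ∘ₗ kos + kos ∘ₗ consK x) (g := actK {x} - eps k {x} • LinearMap.id)
    (fun a => by
      rcases a with _ | ⟨M, S⟩
      · simp [-Finsupp.smul_single]
      · simp [kos_cons, -Finsupp.smul_single]) ω

theorem actK_consK (M : Multiset ℕ) (x : ℕ) (ω : Kz k) :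
    actK M (consK x ω) = consK x (actK M ω) :=
  ext_bs (f := actK M ∘ₗ consK x) (g := consK x ∘ₗ actK M)
    (fun a => by
      rcases a with _ | ⟨N, S⟩
      · simp [-Finsupp.smul_single]
      · simp) ω

theorem actK_actK (M N : Multiset ℕ) (ω : Kz k) : actK M (actK N ω) = actK (M + N) ω :=
  ext_bs (f := actK M ∘ₗ actK N) (g := actK (M + N)) (fun a => by
    rcases a with _ | ⟨N, S⟩
    · simp [eps_add, smul_smul, mul_comm, -Finsupp.smul_single]
    · simp [add_assoc]) ω

theorem kos_actK (M : Multiset ℕ) (ω : Kz k) : kos (actK M ω) = actK M (kos ω) :=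
  ext_bs (f := kos ∘ₗ actK M) (g := actK M ∘ₗ kos) (fun a => by
    rcases a with _ | ⟨N, S⟩
    · simp [-Finsupp.smul_single]
    · simp only [LinearMap.comp_apply, actK_some]
      induction S with
      | nil => simp [eps_add, smul_smul, mul_comm, -Finsupp.smul_single]
      | cons x S ih =>
        rw [kos_cons, kos_cons, ih, map_sub, map_sub, map_smul, actK_consK, ← actK_some,
          actK_actK, actK_actK, add_comm M]) ω

/-- The comparison map from the Koszul resolution to the bar resolution. -/
def ant1 (M : Multiset ℕ) : List ℕ → Ch k
  | [] => bs k [M]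
  | x :: S => shc x (ant1 M S)

def ant : Kz k →ₗ[k] Ch k := lin k fun | none => bs k [] | some (M, S) => ant1 M S

variable (k) in
/-- The signed sum of the permutations of a list of generators. -/
def alt : List ℕ → Ch k
  | [] => bs k []
  | x :: S => sh x (alt S)

@[simp] theorem ant_none : ant (bs k none) = bs k [] := lin_bs _ _

@[simp] theorem ant_nil (M : Multiset ℕ) : ant (bs k (some (M, []))) = bs k [M] := lin_bs _ _

theorem ant_cons (M : Multiset ℕ) (x : ℕ) (S : List ℕ) :
    ant (bs k (some (M, x :: S))) = shc x (ant (bs k (some (M, S)))) := by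
  rw [ant, lin_bs, lin_bs]; rfl

/-- The shuffles `shc` never touch the coefficient, so it can be pulled out. -/
theorem ant_eq (M : Multiset ℕ) (S : List ℕ) : ant (bs k (some (M, S))) = cons M (alt k S) := by
  induction S with
  | nil => simp [alt]
  | cons x S ih => rw [ant_cons, ih, shc_cons]; rfl

theorem ant_consK (x : ℕ) (ω : Kz k) : ant (consK x ω) = shc x (ant ω) :=
  ext_bs (f := ant ∘ₗ consK x) (g := shc x ∘ₗ ant) (fun a => by
    rcases a with _ | ⟨N, S⟩
    · simp [shc_nil]
    · simp [ant_cons]) ω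

theorem ant_actK (M : Multiset ℕ) (ω : Kz k) : ant (actK M ω) = act M (ant ω) :=
  ext_bs (f := ant ∘ₗ actK M) (g := act M ∘ₗ ant) (fun a => by
    rcases a with _ | ⟨N, S⟩
    · simp [-Finsupp.smul_single]
    · simp [ant_eq, act_cons_apply]) ω

/-- The recursions `bar_shc` and `kos_cons` have the same shape, with `shc x` in the place of `consK
x`. -/
theorem bar_ant (ω : Kz k) : bar (ant ω) = ant (kos ω) :=
  ext_bs (f := bar ∘ₗ ant) (g := ant ∘ₗ kos) (fun a => by
    rcases a with _ | ⟨N, S⟩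
    · simp
    · simp only [LinearMap.comp_apply]
      induction S with
      | nil => simp [bar_cons_bs, -Finsupp.smul_single]
      | cons x S ih =>
        rw [ant_cons, bar_shc, ih, kos_cons, map_sub, map_sub, ant_actK, ant_consK, map_smul]) ω

end Bar

end

end TensorDeformation

namespace TensorDeformation

noncomputable section

namespace Bar

variable {k : Type w} [Field k]

/-! ### The contraction of the Koszul resolution -/

/-- The least element of a nonempty multiset. -/
def mn (M : Multiset ℕ) : ℕ := sInf {x | x ∈ M}

theorem mn_mem {M : Multiset ℕ} (h : M ≠ 0) : mn M ∈ M :=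
  Nat.sInf_mem (s := {x | x ∈ M}) (Multiset.exists_mem_of_ne_zero h)

theorem mn_le {M : Multiset ℕ} {x : ℕ} (h : x ∈ M) : mn M ≤ x := Nat.sInf_le h

open Classical in
/-- The contraction of the Koszul resolution away from the generator `0`: it moves the least
generator, if that occurs in the coefficient only. -/
def con0 : Option (Multiset ℕ × List ℕ) → Kz k
  | none => 0
  | some (M, S) =>
    if M ≠ 0 ∧ ∀ y ∈ S, mn M < y then bs k (some (M.erase (mn M), mn M :: S)) else 0

def conPos : Kz k →ₗ[k] Kz k := lin k con0

@[simp] theorem conPos_none : conPos (bs k none) = 0 := lin_bs _ _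

theorem conPos_of_pos {M : Multiset ℕ} {S : List ℕ} (h : M ≠ 0) (h' : ∀ y ∈ S, mn M < y) :
    conPos (bs k (some (M, S))) = bs k (some (M.erase (mn M), mn M :: S)) :=
  (lin_bs _ _).trans (if_pos ⟨h, h'⟩)

theorem conPos_of_neg {M : Multiset ℕ} {S : List ℕ} (h : ¬ (M ≠ 0 ∧ ∀ y ∈ S, mn M < y)) :
    conPos (bs k (some (M, S))) = 0 :=
  (lin_bs _ _).trans (if_neg h)

/-- The basis elements in which the generators of the coefficient are at least `x`, and the other
ones are greater than `x`. -/
def aboveSet (x : ℕ) : Set (Option (Multiset ℕ × List ℕ)) :=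
  {a | ∀ M S, a = some (M, S) → (∀ y ∈ M, x ≤ y) ∧ ∀ y ∈ S, x < y}

theorem none_mem_above (x : ℕ) : none ∈ aboveSet x := by
  intro M S h; cases h

theorem some_mem_above {x : ℕ} {M : Multiset ℕ} {S : List ℕ} :
    some (M, S) ∈ aboveSet x ↔ (∀ y ∈ M, x ≤ y) ∧ ∀ y ∈ S, x < y := by
  constructor
  · intro h; exact h M S rfl
  · rintro h M' S' e
    cases e
    exact h

theorem bs_mem {α : Type*} {a : α} {s : Set α} (h : a ∈ s) : bs k a ∈ Finsupp.supported k k s :=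
  Finsupp.single_mem_supported k 1 h

/-- The differential either moves a generator from the right into the coefficient or drops it, so
lower bounds persist. -/
theorem kos_mem_above {x : ℕ} {M : Multiset ℕ} {S : List ℕ} (h : some (M, S) ∈ aboveSet x) :
    kos (bs k (some (M, S))) ∈ Finsupp.supported k k (aboveSet x) := by
  induction S with
  | nil =>
    rw [kos_nil]
    exact Submodule.smul_mem _ _ (bs_mem (none_mem_above x))
  | cons y S ih =>
    rw [some_mem_above] at h
    have hy : x < y := h.2 y (by simp)
    have hS : ∀ z ∈ S, x < z := fun z hz => h.2 z (by simp [hz])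
    rw [kos_cons, actK_some]
    refine Submodule.sub_mem _ (Submodule.sub_mem _ (bs_mem ?_)
      (Submodule.smul_mem _ _ (bs_mem ?_))) ?_
    · rw [some_mem_above]
      refine ⟨fun z hz => ?_, hS⟩
      rcases Multiset.mem_add.1 hz with hz | hz
      · rw [Multiset.mem_singleton] at hz; omega
      · exact h.1 z hz
    · rw [some_mem_above]
      exact ⟨h.1, hS⟩
    · refine map_mem_of_supported (consK y) ?_ (ih (some_mem_above.2 ⟨h.1, hS⟩))
      rintro (_ | ⟨N, T⟩) ha
      · simp
      · rw [consK_some]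
        refine bs_mem (some_mem_above.2 ⟨(some_mem_above.1 ha).1, fun z hz => ?_⟩)
        rcases List.mem_cons.1 hz with rfl | hz
        · exact hy
        · exact (some_mem_above.1 ha).2 z hz

theorem mn_add {x : ℕ} {M : Multiset ℕ} (h : ∀ y ∈ M, x ≤ y) : mn ({x} + M) = x := by
  refine le_antisymm (mn_le (by simp)) ?_
  have : mn ({x} + M) ∈ {x} + M := mn_mem (by simp)
  rcases Multiset.mem_add.1 this with h' | h'
  · rw [Multiset.mem_singleton] at h'; exact h'.ge
  · exact h _ h'

/-- Multiplication by `x` makes `x` the least generator, occurring only in the coefficient, and this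
is the one that the contraction moves. Positivity of `x` is needed for the augmentation module,
where `x` has to act by zero. -/
theorem conPos_actK {x : ℕ} (hx : x ≠ 0) {ω : Kz k}
    (h : ω ∈ Finsupp.supported k k (aboveSet x)) : conPos (actK {x} ω) = consK x ω := by
  refine eq_of_supported (f := conPos ∘ₗ actK {x}) (g := consK x) ?_ h
  rintro (_ | ⟨N, T⟩) ha
  · simp [eps_eq_zero (k := k) (Multiset.mem_singleton_self x) hx]
  · rw [some_mem_above] at ha
    have hm := mn_add ha.1
    rw [LinearMap.comp_apply, actK_some, conPos_of_pos (by simp) (by rw [hm]; exact ha.2), hm,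
      consK_some]
    simp

/-- The least generator of the coefficient is at least `x`, so it is not smaller than everything on
the right once `x` stands there. -/
theorem conPos_consK {x : ℕ} {ω : Kz k}
    (h : ω ∈ Finsupp.supported k k (aboveSet x)) : conPos (consK x ω) = 0 := by
  refine eq_of_supported (f := conPos ∘ₗ consK x) (g := 0) ?_ h
  rintro (_ | ⟨N, T⟩) ha
  · simp
  · rw [some_mem_above] at ha
    rw [LinearMap.comp_apply, consK_some]
    refine conPos_of_neg ?_
    rintro ⟨h₁, h₂⟩
    have := ha.1 _ (mn_mem h₁)
    have := h₂ x (by simp)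
    omega

/-- Let `x` be the least generator that occurs at all. If it occurs in the coefficient only, split
it off as `actK {x}` and apply `kos_consK`. Otherwise it is the head of `S`, the contraction
vanishes on the element, and in the differential only the term that moves `x` to the left survives
the contraction. The element `1` is excluded, as it represents the homology. -/
theorem conPos_kos {M : Multiset ℕ} {S : List ℕ} (hM : ∀ y ∈ M, y ≠ 0) (hS : ∀ y ∈ S, y ≠ 0)
    (hs : S.SortedLT) (hne : M ≠ 0 ∨ S ≠ []) :
    kos (conPos (bs k (some (M, S)))) + conPos (kos (bs k (some (M, S)))) =
      bs k (some (M, S)) := by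
  by_cases h : M ≠ 0 ∧ ∀ y ∈ S, mn M < y
  · have hx := mn_mem h.1
    have hx0 := hM _ hx
    have hmem : some (M.erase (mn M), S) ∈ aboveSet (mn M) :=
      some_mem_above.2 ⟨fun y hy => mn_le (Multiset.mem_of_mem_erase hy), h.2⟩
    have e : bs k (some (M, S)) = actK {mn M} (bs k (some (M.erase (mn M), S))) := by
      rw [actK_some, Multiset.singleton_add, Multiset.cons_erase hx]
    have e' : conPos (bs k (some (M, S))) = consK (mn M) (bs k (some (M.erase (mn M), S))) := by
      rw [conPos_of_pos h.1 h.2, consK_some]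
    rw [e', e, kos_actK, conPos_actK hx0 (kos_mem_above hmem), add_comm, kos_consK,
      eps_eq_zero (k := k) (Multiset.mem_singleton_self _) hx0, zero_smul, sub_zero]
  · rw [conPos_of_neg h, map_zero, zero_add]
    cases S with
    | nil => exact absurd ⟨by simpa using hne, by simp⟩ h
    | cons x S =>
      have hx0 := hS x (by simp)
      have hlt : ∀ y ∈ S, x < y := (List.pairwise_cons.1 hs.pairwise).1
      have hle : ∀ y ∈ M, x ≤ y := by
        by_contra! H
        obtain ⟨y, hy, hyx⟩ := H
        refine h ⟨fun h0 => by simp [h0] at hy, fun z hz => ?_⟩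
        have := mn_le hy
        rcases List.mem_cons.1 hz with rfl | hz
        · omega
        · have := hlt z hz; omega
      have hmem : some (M, S) ∈ aboveSet x := some_mem_above.2 ⟨hle, hlt⟩
      rw [kos_cons, eps_eq_zero (k := k) (Multiset.mem_singleton_self _) hx0, zero_smul, sub_zero,
        map_sub, conPos_actK hx0 (bs_mem hmem), conPos_consK (kos_mem_above hmem), sub_zero,
        consK_some]

/-- `zs M j` has the positive generators of `M`, and `j` times the generator `0`. -/
def zs (M : Multiset ℕ) (j : ℕ) : Multiset ℕ := Multiset.replicate j 0 + M.filter (· ≠ 0)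

theorem zs_count (M : Multiset ℕ) : zs M (M.count 0) = M := by
  rw [zs, ← Multiset.filter_eq']
  exact Multiset.filter_add_not (fun x => x = 0) M

theorem zs_zero (M : Multiset ℕ) : zs M 0 = M.filter (· ≠ 0) := by simp [zs]

theorem zs_succ (M : Multiset ℕ) (j : ℕ) : {0} + zs M j = zs M (j + 1) := by
  rw [zs, zs, Multiset.replicate_succ, ← Multiset.singleton_add, add_assoc]

theorem zs_add {x : ℕ} (hx : x ≠ 0) (M : Multiset ℕ) (j : ℕ) :
    zs ({x} + M) j = {x} + zs M j := by
  rw [zs, zs, Multiset.filter_add, add_left_comm]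
  simp [hx, Multiset.filter_singleton]

theorem zs_add_zero (M : Multiset ℕ) (j : ℕ) : zs ({0} + M) j = zs M j := by
  rw [zs, zs, Multiset.filter_add]
  simp [Multiset.filter_singleton]

/-- The quotient of `z₀ᶜ - 1` by `z₀ - 1`, a geometric sum: the Koszul differential in the direction
of the generator `0` is multiplication by `z₀ - 1`, because `eps {0} = 1`. -/
def divZ : Kz k →ₗ[k] Kz k := lin k fun
  | none => 0
  | some (M, S) => ∑ j ∈ Finset.range (M.count 0), bs k (some (zs M j, S))

/-- The substitution `z₀ = 1`, which leaves the Koszul problem for the positive generators. -/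
def dropZ : Kz k →ₗ[k] Kz k := lin k fun
  | none => bs k none
  | some (M, S) => bs k (some (zs M 0, S))

@[simp] theorem divZ_none : divZ (bs k none) = 0 := lin_bs _ _

@[simp] theorem divZ_some (M S) : divZ (bs k (some (M, S))) =
    ∑ j ∈ Finset.range (M.count 0), bs k (some (zs M j, S)) := lin_bs _ _

@[simp] theorem dropZ_none : dropZ (bs k none) = bs k none := lin_bs _ _

@[simp] theorem dropZ_some (M S) : dropZ (bs k (some (M, S))) = bs k (some (zs M 0, S)) :=
  lin_bs _ _

open Classical in
/-- The contraction of the augmented Koszul resolution. -/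
def con : Kz k →ₗ[k] Kz k := lin k fun
  | none => bs k (some (0, []))
  | some (M, S) => if 0 ∈ S then 0 else
      consK 0 (divZ (bs k (some (M, S)))) + conPos (dropZ (bs k (some (M, S))))

theorem con_none : con (bs k none) = bs k (some (0, [])) := lin_bs _ _

theorem con_of_mem {M : Multiset ℕ} {S : List ℕ} (h : 0 ∈ S) : con (bs k (some (M, S))) = 0 :=
  (lin_bs _ _).trans (if_pos h)

theorem con_of_notMem {M : Multiset ℕ} {S : List ℕ} (h : 0 ∉ S) : con (bs k (some (M, S))) =
    consK 0 (divZ (bs k (some (M, S)))) + conPos (dropZ (bs k (some (M, S)))) :=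
  (lin_bs _ _).trans (if_neg h)

theorem con_consK_zero (ω : Kz k) : con (consK 0 ω) = 0 :=
  ext_bs (f := con ∘ₗ consK 0) (g := 0) (fun a => by
    rcases a with _ | ⟨M, S⟩
    · simp
    · simp [con_of_mem]) ω

theorem divZ_consK (x : ℕ) (ω : Kz k) : divZ (consK x ω) = consK x (divZ ω) :=
  ext_bs (f := divZ ∘ₗ consK x) (g := consK x ∘ₗ divZ) (fun a => by
    rcases a with _ | ⟨M, S⟩
    · simp
    · simp) ω

theorem dropZ_consK (x : ℕ) (ω : Kz k) : dropZ (consK x ω) = consK x (dropZ ω) :=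
  ext_bs (f := dropZ ∘ₗ consK x) (g := consK x ∘ₗ dropZ) (fun a => by
    rcases a with _ | ⟨M, S⟩
    · simp
    · simp) ω

theorem divZ_actK {x : ℕ} (hx : x ≠ 0) (ω : Kz k) : divZ (actK {x} ω) = actK {x} (divZ ω) :=
  ext_bs (f := divZ ∘ₗ actK {x}) (g := actK {x} ∘ₗ divZ) (fun a => by
    rcases a with _ | ⟨M, S⟩
    · simp [-Finsupp.smul_single]
    · simp [zs_add hx, hx.symm, -Multiset.singleton_add]) ω

theorem dropZ_actK {x : ℕ} (hx : x ≠ 0) (ω : Kz k) : dropZ (actK {x} ω) = actK {x} (dropZ ω) :=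
  ext_bs (f := dropZ ∘ₗ actK {x}) (g := actK {x} ∘ₗ dropZ) (fun a => by
    rcases a with _ | ⟨M, S⟩
    · simp [-Finsupp.smul_single]
    · simp [zs_add hx, -Multiset.singleton_add]) ω

/-- The differential commutes with `divZ` up to the augmentation. -/
theorem consK_divZ_kos {M : Multiset ℕ} {S : List ℕ} (hS : 0 ∉ S) (y : ℕ) :
    consK y (divZ (kos (bs k (some (M, S))))) = consK y (kos (divZ (bs k (some (M, S))))) := by
  induction S generalizing y with
  -- Without `consK y` the two sides would differ by a multiple of `none`, which `consK y` kills.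
  | nil => simp [-Finsupp.smul_single]
  | cons x S ih =>
    have hx : x ≠ 0 := fun h => hS (by simp [h])
    have hS' : 0 ∉ S := fun h => hS (by simp [h])
    have e : eps k {x} = 0 := eps_eq_zero (Multiset.mem_singleton_self _) hx
    have e' : kos (consK x (divZ (bs k (some (M, S))))) =
        actK {x} (divZ (bs k (some (M, S)))) - consK x (kos (divZ (bs k (some (M, S))))) := by
      rw [eq_sub_iff_add_eq, add_comm, kos_consK, e, zero_smul, sub_zero]
    rw [kos_cons, e, zero_smul, sub_zero, map_sub, divZ_actK hx, divZ_consK, ih hS',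
      ← consK_some, divZ_consK, e']

/-- The augmentation takes the value `1` on the generator `0`, so it is unchanged by the
substitution `z₀ = 1`; the remaining generators are not affected by it. -/
theorem dropZ_kos {M : Multiset ℕ} {S : List ℕ} (hS : 0 ∉ S) :
    dropZ (kos (bs k (some (M, S)))) = kos (dropZ (bs k (some (M, S)))) := by
  induction S with
  | nil =>
    have : eps k M = eps k (zs M 0) := by
      have h : (∀ x ∈ M, x = 0) ↔ ∀ x ∈ zs M 0, x = 0 := by
        simp only [zs_zero, Multiset.mem_filter]
        exact ⟨fun h x hx => h x hx.1, fun h x hx => by_contra fun hx0 => hx0 (h x ⟨hx, hx0⟩)⟩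
      simp only [eps, h]
    simp [this, -Finsupp.smul_single]
  | cons x S ih =>
    have hx : x ≠ 0 := fun h => hS (by simp [h])
    have hS' : 0 ∉ S := fun h => hS (by simp [h])
    have e : eps k {x} = 0 := eps_eq_zero (Multiset.mem_singleton_self _) hx
    rw [dropZ_some, kos_cons, kos_cons, e, zero_smul, zero_smul, sub_zero, sub_zero, map_sub,
      dropZ_actK hx, dropZ_consK, ih hS', dropZ_some]

/-- The basis elements in which the generator `0` does not occur on the right. -/
def posSet : Set (Option (Multiset ℕ × List ℕ)) := {a | ∃ M S, a = some (M, S) ∧ 0 ∉ S}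

theorem some_mem_posSet {M : Multiset ℕ} {S : List ℕ} : some (M, S) ∈ posSet ↔ 0 ∉ S := by
  constructor
  · rintro ⟨M', S', e, h⟩
    cases e
    exact h
  · exact fun h => ⟨M, S, rfl, h⟩

theorem con_eq {ω : Kz k} (h : ω ∈ Finsupp.supported k k posSet) :
    con ω = consK 0 (divZ ω) + conPos (dropZ ω) := by
  refine eq_of_supported (f := con) (g := consK 0 ∘ₗ divZ + conPos ∘ₗ dropZ) ?_ h
  rintro _ ⟨M, S, rfl, hS⟩
  exact con_of_notMem hS

/-- The list on the right has to be nonempty: otherwise a multiple of `none` appears, where `con`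
has a value of its own. -/
theorem kos_mem_posSet {M : Multiset ℕ} {x : ℕ} {S : List ℕ} (h : 0 ∉ x :: S) :
    kos (bs k (some (M, x :: S))) ∈ Finsupp.supported k k posSet := by
  have hx : 0 ≠ x := fun h' => h (by simp [h'])
  have hS : 0 ∉ S := fun h' => h (by simp [h'])
  rw [kos_cons, actK_some]
  refine Submodule.sub_mem _ (Submodule.sub_mem _ (bs_mem (some_mem_posSet.2 hS))
      (Submodule.smul_mem _ _ (bs_mem (some_mem_posSet.2 hS)))) ?_
  have : some (M, S) ∈ aboveSet 0 := some_mem_above.2 ⟨fun _ _ => Nat.zero_le _, fun y hy =>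
    Nat.pos_of_ne_zero fun h' => hS (h' ▸ hy)⟩
  refine map_mem_of_supported (consK (k := k) x) ?_ (kos_mem_above this)
  rintro (_ | ⟨N, T⟩) ha
  · simp
  · rw [consK_some]
    refine bs_mem (some_mem_posSet.2 fun h0 => ?_)
    rcases List.mem_cons.1 h0 with h0 | h0
    · exact hx h0
    · exact absurd ((some_mem_above.1 ha).2 0 h0) (lt_irrefl 0)

/-- By `kos_consK` the left side is `z₀ - 1` times a geometric sum, which telescopes. -/
theorem kos_consK_divZ (M : Multiset ℕ) (S : List ℕ) :
    kos (consK 0 (divZ (bs k (some (M, S))))) + consK 0 (kos (divZ (bs k (some (M, S))))) =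
      bs k (some (M, S)) - bs k (some (zs M 0, S)) := by
  have e : eps k {0} = 1 := eps_of_forall (by simp)
  rw [add_comm, kos_consK, e, one_smul, divZ_some, map_sum, ← Finset.sum_sub_distrib]
  simp only [actK_some, zs_succ]
  rw [Finset.sum_range_sub (fun j => bs k (some (zs M j, S))), zs_count]

theorem zs_ne {M : Multiset ℕ} : ∀ y ∈ zs M 0, y ≠ 0 := by
  intro y hy
  rw [zs_zero] at hy
  exact (Multiset.mem_filter.1 hy).2

/-- `con` is a contraction of the augmented Koszul resolution. -/
theorem kos_con {M : Multiset ℕ} {S : List ℕ} (hs : S.SortedLT) :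
    kos (con (bs k (some (M, S)))) + con (kos (bs k (some (M, S)))) = bs k (some (M, S)) := by
  by_cases h0 : 0 ∈ S
  -- In an increasing list `0` must be the head. The terms that still contain it on the right are
  -- killed by `con`; the other two differ by a factor `z₀`, so their geometric sums differ in a
  -- single summand, the original element.
  · rw [con_of_mem h0, map_zero, zero_add]
    cases S with
    | nil => simp at h0
    | cons x S =>
      have hlt : ∀ y ∈ S, x < y := (List.pairwise_cons.1 hs.pairwise).1
      obtain rfl : x = 0 := by
        rcases List.mem_cons.1 h0 with h | h
        · exact h.symm
        · have := hlt 0 h; omega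
      have hS : 0 ∉ S := fun h => lt_irrefl _ (hlt 0 h)
      rw [kos_cons, eps_of_forall (by simp), one_smul, map_sub, con_consK_zero, sub_zero, map_sub,
        actK_some, con_of_notMem hS, con_of_notMem hS]
      simp only [divZ_some, dropZ_some, zs_add_zero]
      rw [Multiset.count_add, Multiset.count_singleton_self, add_comm 1, Finset.sum_range_succ,
        map_add, zs_count, consK_some]
      abel
  -- Without `0` on the right, the contraction in `z₀` recovers the element up to its value at `z₀ =
  -- 1`, and `conPos` takes care of that value.
  · have hS : ∀ y ∈ S, y ≠ 0 := fun y hy h => h0 (h ▸ hy)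
    have e := kos_consK_divZ (k := k) M S
    cases S with
    | nil =>
      rw [con_of_notMem h0, map_add, kos_nil, map_smul, con_none]
      have e' : kos (divZ (bs k (some (M, ([] : List ℕ))))) ∈
          Submodule.span k {bs k none} := by
        rw [divZ_some, map_sum]
        refine Submodule.sum_mem _ fun j _ => ?_
        rw [kos_nil]
        exact Submodule.smul_mem _ _ (Submodule.subset_span rfl)
      obtain ⟨c, hc⟩ := Submodule.mem_span_singleton.1 e'
      rw [← hc, map_smul, consK_none, smul_zero, add_zero] at e
      rw [e, dropZ_some]
      -- The missing term `zs M 0` comes from `con` of the augmentation if `M` has no positive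
      -- generators, and from `conPos` otherwise.
      by_cases hM : zs M 0 = 0
      · have : eps k M = 1 := eps_of_forall fun x hx => by
          by_contra hx0
          have : x ∈ zs M 0 := by rw [zs_zero]; exact Multiset.mem_filter.2 ⟨hx, hx0⟩
          simp [hM] at this
        rw [hM, conPos_of_neg (by simp), map_zero, this, one_smul]
        abel
      · obtain ⟨x, hx⟩ := Multiset.exists_mem_of_ne_zero hM
        have hxM : x ∈ M := by rw [zs_zero] at hx; exact (Multiset.mem_filter.1 hx).1
        have h1 := conPos_kos (k := k) (S := []) zs_ne (by simp) hs (Or.inl hM)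
        rw [kos_nil, map_smul, conPos_none, smul_zero, add_zero] at h1
        rw [h1, eps_eq_zero hxM (zs_ne x hx), zero_smul]
        abel
    | cons x S =>
      rw [con_of_notMem h0, con_eq (kos_mem_posSet h0), consK_divZ_kos h0, dropZ_kos h0, map_add]
      have h1 := conPos_kos (k := k) (M := zs M 0) zs_ne hS hs (Or.inr (by simp))
      rw [dropZ_some]
      calc _ = (kos (consK 0 (divZ (bs k (some (M, x :: S))))) +
              consK 0 (kos (divZ (bs k (some (M, x :: S)))))) +
            (kos (conPos (bs k (some (zs M 0, x :: S)))) +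
              conPos (kos (bs k (some (zs M 0, x :: S))))) := by abel
        _ = _ := by rw [e, h1]; abel

end Bar

end

end TensorDeformation

namespace TensorDeformation

noncomputable section

namespace Bar

variable {k : Type w} [Field k]

/-! ### Multidegrees -/

/-- `β` is obtained from `α` by deleting some of the generators `0`. -/
def Loc (α β : Multiset ℕ) : Prop := β ≤ α ∧ β.filter (· ≠ 0) = α.filter (· ≠ 0)

theorem Loc.refl (α : Multiset ℕ) : Loc α α := ⟨le_rfl, rfl⟩

theorem Loc.trans {α β γ : Multiset ℕ} (h : Loc α β) (h' : Loc β γ) : Loc α γ :=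
  ⟨h'.1.trans h.1, h'.2.trans h.2⟩

theorem Loc.add_left {α β : Multiset ℕ} (M : Multiset ℕ) (h : Loc α β) : Loc (M + α) (M + β) :=
  ⟨add_le_add_right h.1 M, by rw [Multiset.filter_add, Multiset.filter_add, h.2]⟩

/-- A monomial with nonzero augmentation consists of generators `0`, so augmenting it deletes
nothing else. This is why the differentials preserve multidegrees only up to `Loc`. -/
theorem Loc.add_of_eps {α β M : Multiset ℕ} (hM : eps k M ≠ 0) (h : Loc α β) :
    Loc (M + α) β := by
  have h0 : ∀ x ∈ M, x = 0 := fun x hx => by_contra fun hx0 => hM (eps_eq_zero hx hx0)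
  refine ⟨h.1.trans (Multiset.le_add_left _ _), ?_⟩
  have h1 : M.filter (· ≠ 0) = 0 := Multiset.filter_eq_nil.2 fun x hx => by simp [h0 x hx]
  rw [Multiset.filter_add, h.2, h1, zero_add]

/-- The lists of length `n` with a multidegree that is obtained from `α`. -/
def locX (n : ℕ) (α : Multiset ℕ) : Set (List (Multiset ℕ)) := {L | L.length = n ∧ Loc α L.sum}

variable (k) in
abbrev WX (n : ℕ) (α : Multiset ℕ) : Submodule k (Ch k) := Finsupp.supported k k (locX n α)

/-- The basis elements of the Koszul resolution of degree `n` with a multidegree that is obtained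
from `α`. -/
def locK (n : ℕ) (α : Multiset ℕ) : Set (Option (Multiset ℕ × List ℕ)) := {a |
  (a = none ∧ n = 0 ∧ Loc α 0) ∨
    ∃ M S, a = some (M, S) ∧ n = S.length + 1 ∧ S.SortedLT ∧ Loc α (M + S)}

variable (k) in
abbrev WK (n : ℕ) (α : Multiset ℕ) : Submodule k (Kz k) := Finsupp.supported k k (locK n α)

theorem locX_mono {n : ℕ} {α β : Multiset ℕ} (h : Loc α β) : locX n β ⊆ locX n α :=
  fun _ hL => ⟨hL.1, h.trans hL.2⟩

theorem WX_mono {n : ℕ} {α β : Multiset ℕ} (h : Loc α β) : WX k n β ≤ WX k n α :=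
  Finsupp.supported_mono (locX_mono h)

theorem locK_mono {n : ℕ} {α β : Multiset ℕ} (h : Loc α β) : locK n β ⊆ locK n α := by
  rintro a (⟨h1, h2, h3⟩ | ⟨M, S, h1, h2, h3, h4⟩)
  · exact Or.inl ⟨h1, h2, h.trans h3⟩
  · exact Or.inr ⟨M, S, h1, h2, h3, h.trans h4⟩

theorem WK_mono {n : ℕ} {α β : Multiset ℕ} (h : Loc α β) : WK k n β ≤ WK k n α :=
  Finsupp.supported_mono (locK_mono h)

theorem bs_mem_WX (L : List (Multiset ℕ)) : bs k L ∈ WX k L.length L.sum :=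
  bs_mem ⟨rfl, Loc.refl _⟩

theorem cons_mem {n : ℕ} {α : Multiset ℕ} (M : Multiset ℕ) {ω : Ch k} (h : ω ∈ WX k n α) :
    cons M ω ∈ WX k (n + 1) (M + α) := by
  refine map_mem_of_supported (cons M) (fun L hL => ?_) h
  rw [cons_bs]
  exact bs_mem ⟨by simp [hL.1], by rw [List.sum_cons]; exact hL.2.add_left M⟩

theorem act_mem {n : ℕ} {α : Multiset ℕ} (M : Multiset ℕ) {ω : Ch k} (h : ω ∈ WX k n α) :
    act M ω ∈ WX k n (M + α) := by
  refine map_mem_of_supported (act M) (fun L hL => ?_) h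
  cases L with
  | nil =>
    rw [act_nil]
    by_cases hM : eps k M = 0
    · rw [hM, zero_smul]; exact zero_mem _
    · exact Submodule.smul_mem _ _ (bs_mem ⟨hL.1, Loc.add_of_eps hM hL.2⟩)
  | cons N L =>
    rw [act_cons]
    refine bs_mem ⟨hL.1, ?_⟩
    rw [List.sum_cons, add_assoc, ← List.sum_cons]
    exact hL.2.add_left M

theorem bar_mem {n : ℕ} {α : Multiset ℕ} {ω : Ch k} (h : ω ∈ WX k (n + 1) α) :
    bar ω ∈ WX k n α := by
  refine map_mem_of_supported bar (fun L hL => ?_) h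
  refine WX_mono hL.2 ?_
  replace hL := hL.1
  clear h
  induction L generalizing n with
  | nil => simp at hL
  | cons M L ih =>
    rw [bar_cons_bs, List.sum_cons]
    have hL' : L.length = n := by simpa using hL
    refine Submodule.sub_mem _ (act_mem M (hL' ▸ bs_mem_WX L)) ?_
    cases n with
    | zero =>
      rw [List.length_eq_zero_iff] at hL'
      subst hL'
      simp
    | succ n => exact cons_mem M (ih hL')

theorem red_mem {n : ℕ} {α : Multiset ℕ} {ω : Ch k} (h : ω ∈ WX k (n + 1) α) :
    red ω ∈ WX k n α := by
  refine map_mem_of_supported red (fun L hL => ?_) h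
  cases L with
  | nil => simp
  | cons M L =>
    rw [red_cons]
    by_cases hM : eps k M = 0
    · rw [hM, zero_smul]; exact zero_mem _
    · refine Submodule.smul_mem _ _ (bs_mem ⟨by simpa using hL.1, hL.2.trans ?_⟩)
      rw [List.sum_cons]
      exact Loc.add_of_eps hM (Loc.refl _)

theorem sh_mem {n : ℕ} {α : Multiset ℕ} (x : ℕ) {ω : Ch k} (h : ω ∈ WX k n α) :
    sh x ω ∈ WX k (n + 1) ({x} + α) := by
  refine map_mem_of_supported (sh x) (fun L hL => ?_) h
  refine WX_mono (hL.2.add_left {x}) ?_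
  replace hL := hL.1
  clear h
  induction L generalizing n with
  | nil =>
    subst hL
    rw [sh_nil]
    exact bs_mem ⟨rfl, Loc.refl _⟩
  | cons M L ih =>
    subst hL
    rw [sh_cons_bs]
    refine Submodule.sub_mem _ (bs_mem_WX _) ?_
    rw [List.sum_cons, add_left_comm]
    exact cons_mem M (ih rfl)

theorem alt_mem (S : List ℕ) : alt k S ∈ WX k S.length S := by
  induction S with
  | nil => exact bs_mem ⟨rfl, Loc.refl _⟩
  | cons x S ih => exact sh_mem x ih

theorem ant_mem {n : ℕ} {α : Multiset ℕ} {ω : Kz k} (h : ω ∈ WK k n α) :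
    ant ω ∈ WX k n α := by
  refine map_mem_of_supported ant ?_ h
  rintro _ (⟨rfl, rfl, h3⟩ | ⟨M, S, rfl, rfl, h3, h4⟩)
  · rw [ant_none]
    exact bs_mem ⟨rfl, h3⟩
  · rw [ant_eq]
    exact WX_mono h4 (cons_mem M (alt_mem S))

theorem actK_mem {n : ℕ} {α : Multiset ℕ} (M : Multiset ℕ) {ω : Kz k} (h : ω ∈ WK k n α) :
    actK M ω ∈ WK k n (M + α) := by
  refine map_mem_of_supported (actK M) ?_ h
  rintro _ (⟨rfl, rfl, h3⟩ | ⟨N, S, rfl, rfl, h3, h4⟩)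
  · rw [actK_none]
    by_cases hM : eps k M = 0
    · rw [hM, zero_smul]; exact zero_mem _
    · exact Submodule.smul_mem _ _ (bs_mem (Or.inl ⟨rfl, rfl, Loc.add_of_eps hM h3⟩))
  · rw [actK_some]
    refine bs_mem (Or.inr ⟨_, _, rfl, rfl, h3, ?_⟩)
    rw [add_assoc]
    exact h4.add_left M

theorem zs_mono (M : Multiset ℕ) {i j : ℕ} (h : i ≤ j) : zs M i ≤ zs M j :=
  add_le_add_left (Multiset.replicate_mono 0 h) _

theorem filter_zs (M : Multiset ℕ) (j : ℕ) : (zs M j).filter (· ≠ 0) = M.filter (· ≠ 0) := by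
  have h1 : (Multiset.replicate j 0).filter (· ≠ 0) = 0 :=
    Multiset.filter_eq_nil.2 fun x hx => not_not.2 (Multiset.eq_of_mem_replicate hx)
  rw [zs, Multiset.filter_add, h1, zero_add, Multiset.filter_filter]
  exact Multiset.filter_congr fun x _ => and_self_iff

theorem loc_zs (M : Multiset ℕ) {j : ℕ} (h : j ≤ M.count 0) : Loc M (zs M j) :=
  ⟨(zs_mono M h).trans (zs_count M).le, filter_zs M j⟩

/-- The contraction moves one generator to the right, where it is smaller than all others, so the
list stays increasing; apart from that, `divZ` and `dropZ` delete copies of `0` only. -/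
theorem con_mem {n : ℕ} {α : Multiset ℕ} {ω : Kz k} (h : ω ∈ WK k n α) :
    con ω ∈ WK k (n + 1) α := by
  refine map_mem_of_supported con ?_ h
  rintro _ (⟨rfl, rfl, h3⟩ | ⟨M, S, rfl, rfl, h3, h4⟩)
  · rw [con_none]
    exact bs_mem (Or.inr ⟨0, [], rfl, rfl, List.Pairwise.nil.sortedLT, h3⟩)
  · by_cases h0 : 0 ∈ S
    · rw [con_of_mem h0]; exact zero_mem _
    have hsort : ∀ x, (∀ y ∈ S, x < y) → (x :: S).SortedLT := fun x hx =>
      (List.pairwise_cons.2 ⟨hx, h3.pairwise⟩).sortedLT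
    rw [con_of_notMem h0, divZ_some, map_sum, dropZ_some]
    refine Submodule.add_mem _ (Submodule.sum_mem _ fun j hj => ?_) ?_
    · rw [consK_some]
      refine bs_mem (Or.inr ⟨_, _, rfl, rfl, hsort 0 fun y hy =>
        Nat.pos_of_ne_zero fun e => h0 (e ▸ hy), h4.trans ?_⟩)
      have := (loc_zs M (Finset.mem_range.1 hj)).add_left (S : Multiset ℕ)
      rw [← zs_succ] at this
      convert this using 1
      · exact add_comm _ _
      · rw [← Multiset.cons_coe, ← Multiset.singleton_add]
        abel
    · by_cases h : zs M 0 ≠ 0 ∧ ∀ y ∈ S, mn (zs M 0) < y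
      · rw [conPos_of_pos h.1 h.2]
        refine bs_mem (Or.inr ⟨_, _, rfl, rfl, hsort _ h.2, h4.trans ?_⟩)
        have := (loc_zs M (Nat.zero_le _)).add_left (S : Multiset ℕ)
        convert this using 1
        · exact add_comm _ _
        · have e := Multiset.cons_erase (mn_mem h.1)
          rw [← Multiset.singleton_add] at e
          rw [← Multiset.cons_coe, ← Multiset.singleton_add, add_left_comm, ← add_assoc, e,
            add_comm]
      · rw [conPos_of_neg h]; exact zero_mem _

theorem kos_con_apply {n : ℕ} {α : Multiset ℕ} {ω : Kz k} (h : ω ∈ WK k n α) :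
    kos (con ω) = ω - con (kos ω) := by
  rw [eq_sub_iff_add_eq]
  refine eq_of_supported (f := kos ∘ₗ con + con ∘ₗ kos) (g := LinearMap.id) ?_ h
  rintro _ (⟨rfl, rfl, h3⟩ | ⟨M, S, rfl, rfl, h3, h4⟩)
  · simp [con_none, eps_zero]
  · exact kos_con h3

/-! ### The comparison map and the homotopy -/

variable (k) in
/-- The comparison map from the bar resolution to the Koszul resolution. -/
def toKos : ℕ → Ch k →ₗ[k] Kz k
  | 0 => lin k fun | [] => bs k none | _ :: _ => 0
  | n + 1 => lin k fun
    | [] => 0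
    -- The entry `0` is the empty multiset, that is, the coefficient `1`. On such elements the map
    -- is the contraction of the image of the boundary; it is extended linearly in the coefficient.
    -- The index counts all entries, coefficient included.
    | M :: L => actK M (con (toKos n (bar (bs k (0 :: L)))))

variable (k) in
/-- The homotopy from the identity of the bar resolution to its endomorphism that factors through
the Koszul resolution. -/
def hpy : ℕ → Ch k →ₗ[k] Ch k
  | 0 => 0
  | n + 1 => lin k fun
    | [] => 0
    -- The expression inside is a cycle, and `cons 0` gives a chain whose boundary is that cycle.
    | M :: L => act M (cons 0 (bs k (0 :: L) - ant (toKos k (n + 1) (bs k (0 :: L))) -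
        hpy n (bar (bs k (0 :: L)))))

theorem toKos_succ_cons (n : ℕ) (M : Multiset ℕ) (L : List (Multiset ℕ)) :
    toKos k (n + 1) (bs k (M :: L)) = actK M (con (toKos k n (bar (bs k (0 :: L))))) :=
  lin_bs _ _

theorem toKos_succ_nil (n : ℕ) : toKos k (n + 1) (bs k []) = 0 := lin_bs _ _

theorem toKos_zero_nil : toKos k 0 (bs k []) = bs k none := lin_bs _ _

theorem hpy_succ_cons (n : ℕ) (M : Multiset ℕ) (L : List (Multiset ℕ)) :
    hpy k (n + 1) (bs k (M :: L)) = act M (cons 0 (bs k (0 :: L) -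
      ant (toKos k (n + 1) (bs k (0 :: L))) - hpy k n (bar (bs k (0 :: L))))) :=
  lin_bs _ _

theorem hpy_succ_nil (n : ℕ) : hpy k (n + 1) (bs k []) = 0 := lin_bs _ _

theorem toKos_act (n : ℕ) (M : Multiset ℕ) (ω : Ch k) :
    toKos k n (act M ω) = actK M (toKos k n ω) := by
  refine ext_bs (f := toKos k n ∘ₗ act M) (g := actK M ∘ₗ toKos k n) (fun L => ?_) ω
  cases n with
  | zero =>
    cases L with
    | nil => simp [toKos_zero_nil, -Finsupp.smul_single]
    | cons N L =>
      have : ∀ N (L : List (Multiset ℕ)), toKos k 0 (bs k (N :: L)) = 0 := fun N L => lin_bs _ _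
      simp [this]
  | succ n =>
    cases L with
    | nil => simp [toKos_succ_nil, -Finsupp.smul_single]
    | cons N L => simp [toKos_succ_cons, actK_actK]

theorem hpy_act (n : ℕ) (M : Multiset ℕ) (ω : Ch k) :
    hpy k n (act M ω) = act M (hpy k n ω) := by
  refine ext_bs (f := hpy k n ∘ₗ act M) (g := act M ∘ₗ hpy k n) (fun L => ?_) ω
  cases n with
  | zero => simp [hpy]
  | succ n =>
    cases L with
    | nil => simp [hpy_succ_nil, -Finsupp.smul_single]
    | cons N L => rw [LinearMap.comp_apply, LinearMap.comp_apply, act_cons, hpy_succ_cons,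
        hpy_succ_cons, act_act]

theorem cons_zero_mem {n : ℕ} {α : Multiset ℕ} {ω : Ch k} (h : ω ∈ WX k n α) :
    cons 0 ω ∈ WX k (n + 1) α := by
  simpa using cons_mem 0 h

theorem zero_cons_mem {n : ℕ} {L : List (Multiset ℕ)} (h : L.length = n) :
    bs k (0 :: L) ∈ WX k (n + 1) L.sum := by
  subst h
  rw [← cons_bs]
  exact cons_zero_mem (bs_mem_WX L)

/-- Besides the multidegree, membership in `WK` records that the lists are increasing, which is what
`kos_con_apply` requires. -/
theorem toKos_mem {n : ℕ} {α : Multiset ℕ} {ω : Ch k} (h : ω ∈ WX k n α) :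
    toKos k n ω ∈ WK k n α := by
  refine map_mem_of_supported (toKos k n) (fun L hL => ?_) h
  refine WK_mono hL.2 ?_
  replace hL := hL.1
  induction n generalizing L α ω with
  | zero =>
    rw [List.length_eq_zero_iff] at hL
    subst hL
    rw [toKos_zero_nil]
    exact bs_mem (Or.inl ⟨rfl, rfl, Loc.refl _⟩)
  | succ n ih =>
    cases L with
    | nil => simp at hL
    | cons M L =>
      have hL' : L.length = n := by simpa using hL
      rw [toKos_succ_cons, List.sum_cons]
      refine actK_mem M (con_mem ?_)
      have hb : bar (bs k (0 :: L)) ∈ WX k n L.sum := by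
        exact bar_mem (zero_cons_mem hL')
      exact map_mem_of_supported (toKos k n) (fun L' hL' => WK_mono hL'.2 (ih hb L' hL'.1)) hb

theorem hpy_mem {n : ℕ} {α : Multiset ℕ} {ω : Ch k} (h : ω ∈ WX k n α) :
    hpy k n ω ∈ WX k (n + 1) α := by
  induction n generalizing α ω with
  | zero => simp [hpy]
  | succ n ih =>
    refine map_mem_of_supported (hpy k (n + 1)) (fun L hL => ?_) h
    refine WX_mono hL.2 ?_
    replace hL := hL.1
    cases L with
    | nil => simp at hL
    | cons M L =>
      have hL' : L.length = n := by simpa using hL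
      have h0 : bs k (0 :: L) ∈ WX k (n + 1) L.sum := zero_cons_mem hL'
      rw [hpy_succ_cons, List.sum_cons]
      exact act_mem M (cons_zero_mem (Submodule.sub_mem _
        (Submodule.sub_mem _ h0 (ant_mem (toKos_mem h0))) (ih (bar_mem h0))))

/-- By linearity the coefficient may be taken to be `1`. Then `kos ∘ con = 1 - con ∘ kos`, and the
second term vanishes because by induction it involves `bar ∘ bar`. -/
theorem kos_toKos {n : ℕ} {α : Multiset ℕ} {ω : Ch k} (h : ω ∈ WX k (n + 1) α) :
    kos (toKos k (n + 1) ω) = toKos k n (bar ω) := by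
  induction n generalizing α ω with
  | zero =>
    refine eq_of_supported (f := kos ∘ₗ toKos k 1) (g := toKos k 0 ∘ₗ bar) (fun L hL => ?_) h
    obtain ⟨M, rfl⟩ := List.length_eq_one_iff.1 hL.1
    simp [toKos_succ_cons, bar_cons_bs, eps_zero, toKos_zero_nil, con_none, -Finsupp.smul_single]
  | succ n ih =>
    refine eq_of_supported (f := kos ∘ₗ toKos k (n + 2)) (g := toKos k (n + 1) ∘ₗ bar)
      (fun L hL => ?_) h
    cases L with
    | nil => simp [locX] at hL
    | cons M L =>
      have hL' : L.length = n + 1 := by simpa using hL.1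
      have h0 : bs k (0 :: L) ∈ WX k (n + 2) L.sum := zero_cons_mem hL'
      have e : bs k (M :: L) = act M (bs k (0 :: L)) := by simp
      rw [LinearMap.comp_apply, LinearMap.comp_apply, e, bar_act, toKos_act, toKos_act, kos_actK,
        toKos_succ_cons, kos_actK, kos_con_apply (toKos_mem (bar_mem h0)), ih (bar_mem h0), bar_bar,
        map_zero, map_zero, sub_zero]
      have := toKos_act (n + 1) 0 (bar (bs k (0 :: L)))
      rw [act_zero] at this
      rw [← this]

theorem bar_cons_zero (ω : Ch k) : bar (cons 0 ω) = ω - cons 0 (bar ω) := by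
  rw [bar_cons, act_zero]

/-- With coefficient `1`, the chain to which `cons 0` is applied in `hpy` has boundary zero, since
`ant` and `toKos` are chain maps and the formula holds one degree lower; so `bar_cons_zero` returns
that chain. -/
theorem bar_hpy {n : ℕ} {α : Multiset ℕ} {ω : Ch k} (h : ω ∈ WX k (n + 1) α) :
    bar (hpy k (n + 1) ω) = ω - ant (toKos k (n + 1) ω) - hpy k n (bar ω) := by
  induction n generalizing α ω with
  | zero =>
    refine eq_of_supported (f := bar ∘ₗ hpy k 1)
      (g := LinearMap.id - ant ∘ₗ toKos k 1 - hpy k 0 ∘ₗ bar) (fun L hL => ?_) h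
    cases L with
    | nil => simp [locX] at hL
    | cons M L =>
      have hL' : L.length = 0 := by simpa using hL.1
      have h0 : bs k (0 :: L) ∈ WX k 1 L.sum := zero_cons_mem hL'
      have e : bs k (M :: L) = act M (bs k (0 :: L)) := by simp
      have hz : bar (bs k (0 :: L) - ant (toKos k 1 (bs k (0 :: L)))) = 0 := by
        rw [map_sub, bar_ant, kos_toKos h0]
        rw [List.length_eq_zero_iff] at hL'
        subst hL'
        simp [bar_cons_bs, toKos_zero_nil, eps_zero]
      simp only [LinearMap.comp_apply, LinearMap.sub_apply, LinearMap.id_apply]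
      rw [hpy_succ_cons, bar_act, e, toKos_act, ant_actK, bar_cons_zero]
      simp only [hpy, LinearMap.zero_apply, sub_zero]
      rw [hz, map_zero, sub_zero, map_sub]
  | succ n ih =>
    refine eq_of_supported (f := bar ∘ₗ hpy k (n + 2))
      (g := LinearMap.id - ant ∘ₗ toKos k (n + 2) - hpy k (n + 1) ∘ₗ bar) (fun L hL => ?_) h
    cases L with
    | nil => simp [locX] at hL
    | cons M L =>
      have hL' : L.length = n + 1 := by simpa using hL.1
      have h0 : bs k (0 :: L) ∈ WX k (n + 2) L.sum := zero_cons_mem hL'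
      have e : bs k (M :: L) = act M (bs k (0 :: L)) := by simp
      have hz : bar (bs k (0 :: L) - ant (toKos k (n + 2) (bs k (0 :: L))) -
          hpy k (n + 1) (bar (bs k (0 :: L)))) = 0 := by
        rw [map_sub, map_sub, bar_ant, kos_toKos h0, ih (bar_mem h0), bar_bar, map_zero, sub_zero,
          sub_self]
      simp only [LinearMap.comp_apply, LinearMap.sub_apply, LinearMap.id_apply]
      rw [hpy_succ_cons, bar_act, bar_cons_zero, hz, map_zero, sub_zero, e, toKos_act, ant_actK,
        bar_act, hpy_act, map_sub, map_sub]

/-- The homotopy on the bar complex. -/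
def prim (n : ℕ) (L : List (Multiset ℕ)) : Ch k := red (hpy k n (bs k (0 :: L)))

theorem prim_mem {n : ℕ} {L : List (Multiset ℕ)} (h : L.length + 1 = n) :
    prim n L ∈ WX k n L.sum := by
  refine red_mem (hpy_mem (h ▸ zero_cons_mem rfl))

/-- The homotopy is linear in the coefficient, so it descends to the bar complex. -/
theorem red_hpy (n : ℕ) (ω : Ch k) : red (hpy k n ω) = lin k (prim n) (red ω) := by
  refine ext_bs (f := red ∘ₗ hpy k n) (g := lin k (prim n) ∘ₗ red) (fun L => ?_) ω
  cases L with
  | nil =>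
    cases n with
    | zero => simp [hpy]
    | succ n => simp [hpy_succ_nil]
  | cons M L =>
    have e : bs k (M :: L) = act M (bs k (0 :: L)) := by simp
    rw [LinearMap.comp_apply, LinearMap.comp_apply, red_cons, map_smul, lin_bs, e, hpy_act, red_act,
      prim]

theorem lin_lin {α : Type*} (F : List (Multiset ℕ) → k) (f : α → Ch k) (ω : α →₀ k) :
    lin k F (lin k f ω) = lin k (fun a => lin k F (f a)) ω :=
  ext_bs (f := lin k F ∘ₗ lin k f) (g := lin k fun a => lin k F (f a)) (fun a => by simp) ω

/-- A cocycle that vanishes on the antisymmetrizations of the lists of generators is a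
coboundary. -/
theorem eq_prim (n : ℕ) (F : List (Multiset ℕ) → k)
    (hF : ∀ L, L.length = n + 1 → lin k F (bd k (bs k L)) = 0)
    (halt : ∀ S : List ℕ, S.length = n → S.SortedLT → lin k F (alt k S) = 0)
    (L : List (Multiset ℕ)) (hL : L.length = n) :
    F L = lin k (fun L' => lin k F (prim n L')) (bd k (bs k L)) := by
  have h0 : bs k (0 :: L) ∈ WX k (n + 1) L.sum := zero_cons_mem hL
  have e₁ := bar_hpy h0
  have e₂ : red (bs k (0 :: L)) = bs k L := by simp [eps_zero]
  have e₃ := congrArg (fun ω => lin k F (red ω)) e₁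
  -- The cocycle condition: reductions of boundaries are boundaries in the bar complex.
  have h₁ : lin k F (red (bar (hpy k (n + 1) (bs k (0 :: L))))) = 0 := by
    rw [red_bar]
    refine (eq_of_supported (f := lin k F ∘ₗ bd k) (g := 0) (fun L' hL' => ?_)
      (red_mem (hpy_mem h0)))
    exact hF L' hL'.1
  -- The Koszul part only involves increasing lists, and the reduction of their image is a multiple
  -- of the antisymmetrization, on which `F` vanishes.
  have h₂ : lin k F (red (ant (toKos k (n + 1) (bs k (0 :: L))))) = 0 := by
    refine (eq_of_supported (f := lin k F ∘ₗ red ∘ₗ ant) (g := 0) ?_ (toKos_mem h0))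
    rintro _ (⟨rfl, h1, h3⟩ | ⟨M, S, rfl, h1, h3, h4⟩)
    · omega
    · rw [LinearMap.comp_apply, LinearMap.comp_apply, ant_eq, red_cons_apply, map_smul,
        halt S (by omega) h3, smul_zero]
      rfl
  rw [h₁] at e₃
  simp only [map_sub, e₂, h₂, sub_zero, red_hpy, red_bar, lin_lin, lin_bs] at e₃
  exact sub_eq_zero.1 e₃.symm

end Bar

end

end TensorDeformation

namespace TensorDeformation

noncomputable section

namespace DAHA

open MvPolynomial

variable (k : Type w) [Field k]

/-! ### The polynomial representation -/

/-- The transposition of the variables `Xᵢ` and `Xᵢ₊₁`. -/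
abbrev sw (i : ℕ) : MvPolynomial ℕ k →ₐ[k] MvPolynomial ℕ k := rename (Equiv.swap i (i + 1))

variable {k}

theorem X_sub_X_ne_zero (i : ℕ) : (X i - X (i + 1) : MvPolynomial ℕ k) ≠ 0 := by
  rw [sub_ne_zero]
  exact fun h => Nat.succ_ne_self i (X_injective h).symm

/-- The difference `p - sᵢ p` is a twisted derivation in `p`, so divisibility needs checking on
variables only, where the quotient is `1`, `-1` or `0`. -/
theorem exists_divided_difference (i : ℕ) (p : MvPolynomial ℕ k) :
    ∃ q, (X i - X (i + 1)) * q = p - sw k i p := by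
  induction p using MvPolynomial.induction_on with
  | C c => exact ⟨0, by simp⟩
  | add p q hp hq =>
    obtain ⟨p', hp⟩ := hp
    obtain ⟨q', hq⟩ := hq
    exact ⟨p' + q', by rw [mul_add, hp, hq, map_add]; ring⟩
  | mul_X p j hp =>
    obtain ⟨p', hp⟩ := hp
    have : ∃ c : MvPolynomial ℕ k, (X i - X (i + 1)) * c = X j - X (Equiv.swap i (i + 1) j) := by
      by_cases h : j = i
      · subst h
        exact ⟨1, by simp⟩
      · by_cases h' : j = i + 1
        · subst h'
          exact ⟨-1, by simp⟩
        · exact ⟨0, by rw [Equiv.swap_apply_of_ne_of_ne h h']; simp⟩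
    obtain ⟨c, hc⟩ := this
    refine ⟨p' * X j + sw k i p * c, ?_⟩
    rw [mul_add, ← mul_assoc, hp, mul_left_comm, hc, map_mul, rename_X]
    ring

/-- The divided difference `(p - sᵢ p) / (Xᵢ - Xᵢ₊₁)`. -/
def dd (i : ℕ) (p : MvPolynomial ℕ k) : MvPolynomial ℕ k :=
  Classical.choose (exists_divided_difference i p)

theorem dd_spec (i : ℕ) (p : MvPolynomial ℕ k) : (X i - X (i + 1)) * dd i p = p - sw k i p :=
  Classical.choose_spec (exists_divided_difference i p)

/-- Polynomials form a domain, so a divided difference may be identified after clearing the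
denominator. -/
theorem dd_eq {i : ℕ} {p q : MvPolynomial ℕ k} (h : (X i - X (i + 1)) * q = p - sw k i p) :
    dd i p = q :=
  mul_left_cancel₀ (X_sub_X_ne_zero i) ((dd_spec i p).trans h.symm)

theorem dd_add (i : ℕ) (p q : MvPolynomial ℕ k) : dd i (p + q) = dd i p + dd i q :=
  dd_eq (by rw [mul_add, dd_spec, dd_spec, map_add]; ring)

theorem dd_smul (i : ℕ) (c : k) (p : MvPolynomial ℕ k) : dd i (c • p) = c • dd i p :=
  dd_eq (by rw [mul_smul_comm, dd_spec, map_smul, smul_sub])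

theorem dd_mul (i : ℕ) (p q : MvPolynomial ℕ k) :
    dd i (p * q) = sw k i p * dd i q + dd i p * q :=
  dd_eq (by rw [mul_add, mul_left_comm, dd_spec, ← mul_assoc, dd_spec, map_mul]; ring)

theorem dd_eq_zero_iff {i : ℕ} {p : MvPolynomial ℕ k} : dd i p = 0 ↔ sw k i p = p := by
  constructor
  · intro h
    have := dd_spec i p
    rw [h, mul_zero] at this
    exact (sub_eq_zero.1 this.symm).symm
  · intro h
    exact dd_eq (by rw [mul_zero, h, sub_self])

theorem dd_X_self (i : ℕ) : dd i (X i : MvPolynomial ℕ k) = 1 := dd_eq (by simp)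

theorem dd_X_succ (i : ℕ) : dd i (X (i + 1) : MvPolynomial ℕ k) = -1 := dd_eq (by simp)

theorem sw_X_of_ne {i j : ℕ} (h : j ≠ i) (h' : j ≠ i + 1) :
    sw k i (X j : MvPolynomial ℕ k) = X j := by
  rw [rename_X, Equiv.swap_apply_of_ne_of_ne h h']

theorem dd_X_of_ne {i j : ℕ} (h : j ≠ i) (h' : j ≠ i + 1) :
    dd i (X j : MvPolynomial ℕ k) = 0 :=
  dd_eq_zero_iff.2 (sw_X_of_ne h h')

variable (k) in
/-- The operator `p ↦ sᵢ p + (p - sᵢ p) / (Xᵢ - Xᵢ₊₁)`. -/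
def dem (i : ℕ) : Module.End k (MvPolynomial ℕ k) where
  toFun p := sw k i p + dd i p
  map_add' p q := by rw [map_add, dd_add]; ring
  map_smul' c p := by rw [map_smul, dd_smul, RingHom.id_apply, smul_add]

theorem dem_apply (i : ℕ) (p : MvPolynomial ℕ k) : dem k i p = sw k i p + dd i p := rfl

theorem dem_mul (i : ℕ) (p q : MvPolynomial ℕ k) :
    dem k i (p * q) = sw k i p * dem k i q + dd i p * q := by
  rw [dem_apply, dem_apply, dd_mul, map_mul]; ring

theorem dem_one (i : ℕ) : dem k i 1 = 1 := by
  rw [dem_apply, dd_eq_zero_iff.2 (map_one _), map_one, add_zero]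

theorem dem_X_self (i : ℕ) (p : MvPolynomial ℕ k) :
    dem k i (X i * p) = X (i + 1) * dem k i p + p := by
  rw [dem_mul, dd_X_self, rename_X, Equiv.swap_apply_left, one_mul]

theorem dem_X_succ (i : ℕ) (p : MvPolynomial ℕ k) :
    dem k i (X (i + 1) * p) = X i * dem k i p - p := by
  rw [dem_mul, dd_X_succ, rename_X, Equiv.swap_apply_right, neg_one_mul, sub_eq_add_neg]

theorem dem_X_of_ne {i j : ℕ} (h : j ≠ i) (h' : j ≠ i + 1) (p : MvPolynomial ℕ k) :
    dem k i (X j * p) = X j * dem k i p := by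
  rw [dem_mul, dd_X_of_ne h h', sw_X_of_ne h h', zero_mul, add_zero]

/-- Operators that agree on `1`, and whose agreement is preserved by the multiplication by
variables, are equal. -/
theorem end_ext {f g : Module.End k (MvPolynomial ℕ k)} (h₁ : f 1 = g 1)
    (h : ∀ p j, f p = g p → f (X j * p) = g (X j * p)) : f = g := by
  refine LinearMap.ext fun p => ?_
  induction p using MvPolynomial.induction_on with
  | C c =>
    have : (C c : MvPolynomial ℕ k) = c • 1 := by rw [smul_eq_C_mul, mul_one]
    rw [this, map_smul, map_smul, h₁]
  | add p q hp hq => rw [map_add, map_add, hp, hq]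
  | mul_X p j hp => rw [mul_comm]; exact h p j hp

/-- For this and the next two relations, the values at `1` agree and each side commutes with the
variables by the same rule, which determines the operators (`end_ext`). -/
theorem dem_dem (i : ℕ) (p : MvPolynomial ℕ k) : dem k i (dem k i p) = p := by
  refine LinearMap.congr_fun (f := dem k i * dem k i) (g := 1) (end_ext ?_ fun p j h => ?_) p
  · simp [dem_one]
  · simp only [Module.End.mul_apply, Module.End.one_apply] at h ⊢
    by_cases h₁ : j = i
    · subst h₁
      rw [dem_X_self, map_add, dem_X_succ, h]; ring
    · by_cases h₂ : j = i + 1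
      · subst h₂
        rw [dem_X_succ, map_sub, dem_X_self, h]; ring
      · rw [dem_X_of_ne h₁ h₂, dem_X_of_ne h₁ h₂, h]

theorem dem_comm {i j : ℕ} (hij : i + 1 < j) : dem k i * dem k j = dem k j * dem k i := by
  refine end_ext ?_ fun p l h => ?_
  · simp [dem_one]
  · simp only [Module.End.mul_apply] at h ⊢
    by_cases h₁ : l = i
    · subst h₁
      rw [dem_X_self, dem_X_of_ne (by omega) (by omega), dem_X_self, map_add,
        dem_X_of_ne (by omega) (by omega), h]
    · by_cases h₂ : l = i + 1
      · subst h₂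
        rw [dem_X_succ, dem_X_of_ne (by omega) (by omega), dem_X_succ, map_sub,
          dem_X_of_ne (by omega) (by omega), h]
      · rw [dem_X_of_ne h₁ h₂]
        by_cases h₃ : l = j
        · subst h₃
          rw [dem_X_self, map_add, dem_X_of_ne (by omega) (by omega), dem_X_self, h]
        · by_cases h₄ : l = j + 1
          · subst h₄
            rw [dem_X_succ, map_sub, dem_X_of_ne (by omega) (by omega), dem_X_succ, h]
          · rw [dem_X_of_ne h₃ h₄, dem_X_of_ne h₁ h₂, dem_X_of_ne h₃ h₄, h]

theorem dem_braid (i : ℕ) : dem k i * dem k (i + 1) * dem k i =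
    dem k (i + 1) * dem k i * dem k (i + 1) := by
  have e₁ : ∀ p, dem k i (X (i + 1 + 1) * p) = X (i + 1 + 1) * dem k i p :=
    dem_X_of_ne (by omega) (by omega)
  have e₂ : ∀ p, dem k (i + 1) (X i * p) = X i * dem k (i + 1) p :=
    dem_X_of_ne (by omega) (by omega)
  refine end_ext ?_ fun p l h => ?_
  · simp [dem_one]
  · simp only [Module.End.mul_apply] at h ⊢
    by_cases h₁ : l = i
    · subst h₁
      simp only [dem_X_self, e₁, e₂, map_add, dem_dem, h]
      ring
    · by_cases h₂ : l = i + 1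
      · subst h₂
        simp only [dem_X_succ, dem_X_self, e₁, e₂, map_add, map_sub, h]
        ring
      · by_cases h₃ : l = i + 1 + 1
        · subst h₃
          simp only [dem_X_succ, e₁, e₂, map_sub, dem_dem, h]
          ring
        · simp only [dem_X_of_ne h₁ h₂, dem_X_of_ne h₂ h₃, h]

variable (k) in
/-- The operators by which the generators act on the polynomials. -/
def genOp {n : ℕ} : Gen n → Module.End k (MvPolynomial ℕ k)
  | .t i _ => dem k i
  | .y i _ => LinearMap.mulLeft k (X i)

theorem genOp_rel {n : ℕ} ⦃a b : FreeAlgebra k (Gen n)⦄ (hab : Rel k n a b) :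
    FreeAlgebra.lift k (genOp k) a = FreeAlgebra.lift k (genOp k) b := by
  cases hab with
  | t_sq i hi =>
    refine LinearMap.ext fun p => ?_
    simp [genOp, dem_dem]
  | braid i hi hi' => simpa [genOp] using dem_braid i
  | t_comm i j hi hj hij => simpa [genOp] using dem_comm hij
  | y_t i hi hi' =>
    refine LinearMap.ext fun p => ?_
    simp [genOp, dem_X_succ]
  | y_comm i j hi hj =>
    refine LinearMap.ext fun p => ?_
    simp [genOp, mul_left_comm]
  | t_y i j hi hj h h' =>
    refine LinearMap.ext fun p => ?_
    simp [genOp, dem_X_of_ne h h']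

variable (k) in
/-- The polynomial representation of the degenerate affine Hecke algebra. -/
def rep (n : ℕ) : DAHA k n →ₐ[k] Module.End k (MvPolynomial ℕ k) :=
  RingQuot.liftAlgHom k ⟨FreeAlgebra.lift k (genOp k), genOp_rel⟩

variable {n : ℕ}

theorem rep_t (i : ℕ) (h : i + 1 < n) : rep k n (t k i h) = dem k i := by
  refine (RingQuot.liftAlgHom_mkAlgHom_apply k _ _ _).trans ?_
  rw [FreeAlgebra.lift_ι_apply]; rfl

theorem rep_y (i : ℕ) (h : i < n) : rep k n (y k i h) = LinearMap.mulLeft k (X i) := by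
  refine (RingQuot.liftAlgHom_mkAlgHom_apply k _ _ _).trans ?_
  rw [FreeAlgebra.lift_ι_apply]; rfl

variable (k) in
/-- The polynomial `a · 1`. -/
def sym (n : ℕ) : DAHA k n →ₗ[k] MvPolynomial ℕ k :=
  LinearMap.applyₗ (1 : MvPolynomial ℕ k) ∘ₗ (rep k n).toLinearMap

theorem sym_apply (a : DAHA k n) : sym k n a = rep k n a 1 := rfl

theorem sym_castAlg {m n : ℕ} (h : m = n) (a : DAHA k m) :
    sym k n (castAlg k (DAHA k) h a) = sym k m a := by
  subst h; rfl

/-! ### Polynomials in the generators `y` -/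

variable (k) in
/-- The generator `yᵢ`, which is `0` by convention when `n ≤ i`. -/
def y' (n i : ℕ) : DAHA k n := if h : i < n then y k i h else 0

theorem y'_comm (n i j : ℕ) : y' k n i * y' k n j = y' k n j * y' k n i := by
  unfold y'
  split_ifs
  · exact y_comm _ _ _ _
  all_goals simp

theorem y'_of_lt {i : ℕ} (h : i < n) : y' k n i = y k i h := dif_pos h

open scoped IsMulCommutative in
variable (k) in
/-- The evaluation of polynomials at the generators `y`. -/
def poly (n : ℕ) : MvPolynomial ℕ k →ₐ[k] DAHA k n :=
  -- Evaluation needs a commutative target, so it goes through the subalgebra generated by the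
  -- commuting `yᵢ`.
  haveI : IsMulCommutative (Algebra.adjoin k (Set.range (y' k n))) :=
    Algebra.isMulCommutative_adjoin k (by
      rintro _ ⟨i, rfl⟩ _ ⟨j, rfl⟩
      exact y'_comm n i j)
  (Algebra.adjoin k (Set.range (y' k n))).val.comp
    (aeval fun i => ⟨y' k n i, Algebra.subset_adjoin ⟨i, rfl⟩⟩)

theorem poly_X (i : ℕ) : poly k n (X i) = y' k n i := by
  simp [poly]

variable (k) in
/-- The substitution of `0` for the variables `Xᵢ`, `n ≤ i`. -/
def trunc (n : ℕ) : MvPolynomial ℕ k →ₐ[k] MvPolynomial ℕ k :=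
  aeval fun i => if i < n then X i else 0

theorem trunc_X (i : ℕ) : trunc k n (X i) = if i < n then X i else 0 := by simp [trunc]

theorem poly_trunc (p : MvPolynomial ℕ k) : poly k n (trunc k n p) = poly k n p := by
  refine DFunLike.congr_fun (f := (poly k n).comp (trunc k n)) (MvPolynomial.algHom_ext fun i => ?_) p
  rw [AlgHom.comp_apply, trunc_X, poly_X]
  split_ifs with h
  · rw [poly_X]
  · rw [map_zero, y', dif_neg h]

theorem rep_poly (p : MvPolynomial ℕ k) :
    rep k n (poly k n p) = LinearMap.mulLeft k (trunc k n p) := by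
  refine DFunLike.congr_fun (f := (rep k n).comp (poly k n))
    (g := (Algebra.lmul k _).comp (trunc k n)) (MvPolynomial.algHom_ext fun i => ?_) p
  rw [AlgHom.comp_apply, AlgHom.comp_apply, trunc_X, poly_X, y']
  split_ifs with h
  · rw [rep_y]; rfl
  · rw [map_zero, map_zero]

theorem sym_poly (p : MvPolynomial ℕ k) : sym k n (poly k n p) = trunc k n p := by
  rw [sym_apply, rep_poly, LinearMap.mulLeft_apply, mul_one]

/-- For a variable this is a defining relation; it passes to products since `dd` satisfies the
twisted Leibniz rule. It moves every `tᵢ` to the right of the polynomials. -/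
theorem t_poly (i : ℕ) (h : i + 1 < n) (p : MvPolynomial ℕ k) :
    t k i h * poly k n p = poly k n (sw k i p) * t k i h + poly k n (dd i p) := by
  induction p using MvPolynomial.induction_on with
  | C c =>
    have : (C c : MvPolynomial ℕ k) = algebraMap k _ c := rfl
    rw [dd_eq_zero_iff.2 (rename_C _ _), rename_C, this, AlgHom.commutes, map_zero, add_zero,
      Algebra.commutes]
  | add p q hp hq => simp only [map_add, dd_add, mul_add, add_mul, hp, hq]; abel
  | mul_X p j hp =>
    have key : t k i h * poly k n (X j) =
        poly k n (sw k i (X j)) * t k i h + poly k n (dd i (X j)) := by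
      rw [poly_X]
      have e := y_t (k := k) i h (by omega)
      have hs := t_sq (k := k) i h
      by_cases h₁ : j = i
      · subst h₁
        rw [dd_X_self, rename_X, Equiv.swap_apply_left, poly_X, y'_of_lt (by omega), y'_of_lt h,
          map_one]
        -- The relation for `yᵢ tᵢ` becomes the one for `tᵢ yᵢ` when multiplied by the involution
        -- `tᵢ` on both sides.
        have e' := congrArg (fun x => t k j h * x * t k j h) e
        simp only [mul_sub, sub_mul, mul_one, hs] at e'
        rw [← mul_assoc, ← mul_assoc, hs, one_mul, mul_assoc, mul_assoc, hs, mul_one] at e'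
        rw [← e']; abel
      · by_cases h₂ : j = i + 1
        · subst h₂
          rw [dd_X_succ, rename_X, Equiv.swap_apply_right, poly_X, y'_of_lt h, y'_of_lt (show i < n by omega),
            map_neg, map_one, ← e]
          abel
        · rw [dd_X_of_ne h₁ h₂, sw_X_of_ne h₁ h₂, poly_X, map_zero, add_zero, y']
          split_ifs with hj
          · exact t_y _ _ _ _ h₁ h₂
          · simp
    rw [map_mul, ← mul_assoc, hp, add_mul, mul_assoc, key, dd_mul, map_mul, map_add, map_mul,
      map_mul, map_mul]
    simp only [mul_add, mul_assoc, add_assoc]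

/-- All `Λₙ` act on one polynomial ring in infinitely many variables; the variables that `Λₙ` does
not involve behave as scalars. -/
theorem rep_X_of_le {i : ℕ} (h : n ≤ i) (a : DAHA k n) (p : MvPolynomial ℕ k) :
    rep k n a (X i * p) = X i * rep k n a p := by
  induction a using DAHA.induction generalizing p with
  | halg c => simp
  | ht j hj => rw [rep_t, dem_X_of_ne (by omega) (by omega)]
  | hy j hj => rw [rep_y, LinearMap.mulLeft_apply, LinearMap.mulLeft_apply, mul_left_comm]
  | hadd a b ha hb => rw [map_add, LinearMap.add_apply, LinearMap.add_apply, ha, hb, mul_add]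
  | hmul a b ha hb => rw [map_mul (rep k n), Module.End.mul_apply, Module.End.mul_apply, hb, ha]

theorem trunc_sw {i : ℕ} (h : i + 1 < n) (p : MvPolynomial ℕ k) :
    trunc k n (sw k i p) = sw k i (trunc k n p) := by
  refine DFunLike.congr_fun (f := (trunc k n).comp (sw k i)) (g := (sw k i).comp (trunc k n))
    (MvPolynomial.algHom_ext fun j => ?_) p
  rw [AlgHom.comp_apply, AlgHom.comp_apply, trunc_X, rename_X, trunc_X]
  have : Equiv.swap i (i + 1) j < n ↔ j < n := by
    rw [Equiv.swap_apply_def]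
    split_ifs <;> omega
  simp only [this]
  split_ifs
  · rw [rename_X]
  · rw [map_zero]

theorem trunc_dem {i : ℕ} (h : i + 1 < n) (p : MvPolynomial ℕ k) :
    trunc k n (dem k i p) = dem k i (trunc k n p) := by
  rw [dem_apply, dem_apply, map_add, trunc_sw h]
  congr 1
  refine (dd_eq ?_).symm
  have := congrArg (trunc k n) (dd_spec i p)
  rw [map_mul, map_sub, map_sub, trunc_X, trunc_X, if_pos h, if_pos (by omega), trunc_sw h] at this
  exact this

theorem trunc_rep (a : DAHA k n) (p : MvPolynomial ℕ k) (hp : trunc k n p = p) :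
    trunc k n (rep k n a p) = rep k n a p := by
  induction a using DAHA.induction generalizing p with
  | halg c => simp [hp]
  | ht j hj => rw [rep_t, trunc_dem hj, hp]
  | hy j hj => rw [rep_y, LinearMap.mulLeft_apply, map_mul, trunc_X, if_pos hj, hp]
  | hadd a b ha hb => rw [map_add, LinearMap.add_apply, map_add, ha p hp, hb p hp]
  | hmul a b ha hb => rw [map_mul, Module.End.mul_apply, ha _ (hb p hp)]

theorem trunc_sym (a : DAHA k n) : trunc k n (sym k n a) = sym k n a :=
  trunc_rep a 1 (map_one _)

end DAHA

end

end TensorDeformation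

namespace TensorDeformation

noncomputable section

/-! ### Normal forms for words in Coxeter generators of type A -/

namespace Cox

variable {G : Type*} [Monoid G]

/-- The Coxeter relations of type `A` for the first `n` elements of a sequence. -/
structure Rels (n : ℕ) (g : ℕ → G) : Prop where
  sq : ∀ i, i < n → g i * g i = 1
  braid : ∀ i, i + 1 < n → g i * g (i + 1) * g i = g (i + 1) * g i * g (i + 1)
  comm : ∀ i j, i + 1 < j → j < n → g i * g j = g j * g i

/-- The submonoid generated by the first `m` elements. -/
def gen (g : ℕ → G) (m : ℕ) : Submonoid G := Submonoid.closure {x | ∃ i < m, x = g i}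

/-- The product `g (j + d - 1) * ⋯ * g j`. -/
def run (g : ℕ → G) (j : ℕ) : ℕ → G
  | 0 => 1
  | d + 1 => g (j + d) * run g j d

theorem run_succ (g : ℕ → G) (j d : ℕ) : run g j (d + 1) = run g (j + 1) d * g j := by
  induction d with
  | zero => simp [run]
  | succ d ih => rw [run, ih, run, mul_assoc, add_right_comm, add_assoc]

theorem run_add (g : ℕ → G) (j d e : ℕ) : run g j (d + e) = run g (j + d) e * run g j d := by
  induction e with
  | zero => simp [run]
  | succ e ih => rw [← add_assoc, run, ih, run, mul_assoc, add_assoc]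

theorem mem_gen (g : ℕ → G) {m i : ℕ} (h : i < m) : g i ∈ gen g m :=
  Submonoid.subset_closure ⟨i, h, rfl⟩

variable {n : ℕ} {g : ℕ → G}

theorem run_comm_below (hg : Rels n g) {i j d : ℕ} (h : i + 1 < j) (hd : j + d ≤ n) :
    run g j d * g i = g i * run g j d := by
  induction d with
  | zero => simp [run]
  | succ d ih =>
    rw [run, mul_assoc, ih (by omega), ← mul_assoc, ← hg.comm i (j + d) (by omega) (by omega),
      mul_assoc]

theorem run_comm_above (hg : Rels n g) {i j d : ℕ} (h : j + d < i) (hi : i < n) :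
    run g j d * g i = g i * run g j d := by
  induction d with
  | zero => simp [run]
  | succ d ih =>
    rw [run, mul_assoc, ih (by omega), ← mul_assoc, hg.comm (j + d) i (by omega) hi, mul_assoc]

/-- The runs represent the cosets of the smaller group. Multiply `h * run` by `g i` on the right: if
`i + 1 < j`, then `g i` passes into `h`; if `i + 1 = j` the run gets longer, if `i = j` shorter; if
`i > j`, then `g i` emerges on the left of the run as `g (i - 1)`. -/
theorem exists_normal_form (hg : Rels n g) {m : ℕ} (hm : m < n) {x : G} (hx : x ∈ gen g (m + 1)) :
    ∃ h ∈ gen g m, ∃ j d, j + d = m + 1 ∧ x = h * run g j d := by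
  induction hx using Submonoid.closure_induction_right with
  | one => exact ⟨1, one_mem _, m + 1, 0, rfl, by simp [run]⟩
  | mul_right x hx y hy ih =>
    obtain ⟨i, hi, rfl⟩ := hy
    obtain ⟨h, hh, j, d, hjd, rfl⟩ := ih
    by_cases h₁ : i + 1 < j
    · refine ⟨h * g i, mul_mem hh (mem_gen g (by omega)), j, d, hjd, ?_⟩
      rw [mul_assoc, run_comm_below hg h₁ (by omega), mul_assoc]
    · by_cases h₂ : i + 1 = j
      · subst h₂
        exact ⟨h, hh, i, d + 1, by omega, by rw [run_succ, mul_assoc]⟩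
      · by_cases h₃ : i = j
        · subst h₃
          obtain ⟨d, rfl⟩ : ∃ e, d = e + 1 := ⟨d - 1, by omega⟩
          refine ⟨h, hh, i + 1, d, by omega, ?_⟩
          rw [run_succ, mul_assoc, mul_assoc, hg.sq i (by omega), mul_one]
        · obtain ⟨a, rfl⟩ : ∃ a, i = j + a + 1 := ⟨i - j - 1, by omega⟩
          obtain ⟨b, rfl⟩ : ∃ b, d = a + 1 + 1 + b := ⟨d - a - 2, by omega⟩
          refine ⟨h * g (j + a), mul_mem hh (mem_gen g (by omega)), j, a + 1 + 1 + b, hjd, ?_⟩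
          have e₁ : run g j a * g (j + a + 1) = g (j + a + 1) * run g j a :=
            run_comm_above hg (by omega) (by omega)
          have e₂ : run g (j + (a + 1 + 1)) b * g (j + a) = g (j + a) * run g (j + (a + 1 + 1)) b :=
            run_comm_below hg (by omega) (by omega)
          -- The braid relation for the two top factors, after `g (j + a + 1)` has passed the lower
          -- part of the run.
          have e₃ : run g j (a + 1 + 1) * g (j + a + 1) = g (j + a) * run g j (a + 1 + 1) := by
            simp only [run, ← add_assoc]
            calc _ = g (j + a + 1) * g (j + a) * (run g j a * g (j + a + 1)) := by
                  simp only [mul_assoc]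
              _ = g (j + a + 1) * g (j + a) * g (j + a + 1) * run g j a := by
                  rw [e₁]; simp only [mul_assoc]
              _ = _ := by rw [← hg.braid (j + a) (by omega)]; simp only [mul_assoc]
          rw [run_add, mul_assoc, mul_assoc, e₃, ← mul_assoc (run g (j + (a + 1 + 1)) b), e₂]
          simp only [mul_assoc]

theorem exists_left_inv (hg : Rels n g) {m : ℕ} (hm : m ≤ n) {x : G} (hx : x ∈ gen g m) :
    ∃ x' ∈ gen g m, x' * x = 1 := by
  induction hx using Submonoid.closure_induction_right with
  | one => exact ⟨1, one_mem _, one_mul 1⟩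
  | mul_right x hx y hy ih =>
    obtain ⟨i, hi, rfl⟩ := hy
    obtain ⟨x', hx', e⟩ := ih
    refine ⟨g i * x', mul_mem (mem_gen g hi) hx', ?_⟩
    rw [mul_assoc, ← mul_assoc x', e, one_mul, hg.sq i (by omega)]

/-- A relation among words in the adjacent transpositions holds for all elements that satisfy the
Coxeter relations. -/
theorem eq_one {g : ℕ → G × Equiv.Perm ℕ} (hg : Rels n g)
    (hs : ∀ i < n, (g i).2 = Equiv.swap i (i + 1)) {m : ℕ} (hm : m ≤ n) {x : G × Equiv.Perm ℕ}
    (hx : x ∈ gen g m) (h1 : x.2 = 1) : x.1 = 1 := by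
  induction m generalizing x with
  | zero =>
    have : gen g 0 = ⊥ := by simp [gen]
    rw [this, Submonoid.mem_bot] at hx
    rw [hx]; rfl
  | succ m ih =>
    obtain ⟨h, hh, j, d, hjd, rfl⟩ := exists_normal_form hg (by omega) hx
    -- The run carries `j` to `m + 1`, which `h` fixes; so a trivial permutation forces `j = m + 1`
    -- and the run to be empty.
    have hrun : ∀ d, j + d ≤ n → (run g j d).2 j = j + d := by
      intro d hd
      induction d with
      | zero => simp [run]
      | succ d ih =>
        rw [run, Prod.snd_mul, Equiv.Perm.mul_apply, ih (by omega), hs _ (by omega),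
          Equiv.swap_apply_left, add_assoc]
    have hfix : h.2 (m + 1) = m + 1 := by
      clear h1 hx
      induction hh using Submonoid.closure_induction_right with
      | one => rfl
      | mul_right x hx y hy ih =>
        obtain ⟨i, hi, rfl⟩ := hy
        rw [Prod.snd_mul, Equiv.Perm.mul_apply, hs i (by omega),
          Equiv.swap_apply_of_ne_of_ne (by omega) (by omega), ih]
    have h2 := congrArg (fun σ : Equiv.Perm ℕ => σ j) h1
    simp only [Prod.snd_mul, Equiv.Perm.mul_apply, Equiv.Perm.one_apply] at h2
    rw [hrun d (by omega), hjd, hfix] at h2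
    obtain rfl : d = 0 := by omega
    rw [run, mul_one] at h1 ⊢
    exact ih (by omega) hh h1

/-- The words form a group, because the generators are involutions, and by `eq_one` a word with
trivial permutation is trivial. Pairing each generator with its transposition carries the
permutation along with the word. -/
theorem fst_eq_of_snd_eq {g : ℕ → G × Equiv.Perm ℕ} (hg : Rels n g)
    (hs : ∀ i < n, (g i).2 = Equiv.swap i (i + 1)) {x y : G × Equiv.Perm ℕ}
    (hx : x ∈ gen g n) (hy : y ∈ gen g n) (h : x.2 = y.2) : x = y := by
  obtain ⟨x', hx', e⟩ := exists_left_inv hg le_rfl hx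
  obtain ⟨x'', hx'', e'⟩ := exists_left_inv hg le_rfl hx'
  have h1 : x'' = x := by rw [← mul_one x'', ← e, ← mul_assoc, e', one_mul]
  have h2 : x' * y = 1 := Prod.ext (eq_one hg hs le_rfl (mul_mem hx' hy) (by
    rw [Prod.snd_mul, ← h, ← Prod.snd_mul, e]; rfl)) (by
    rw [Prod.snd_mul, ← h, ← Prod.snd_mul, e])
  rw [← h1, ← mul_one x'', ← h2, ← mul_assoc, e', one_mul]

end Cox

namespace DAHA

open MvPolynomial

variable {k : Type w} [Field k] {n : ℕ}

/-! ### Leading terms -/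

variable (k) in
/-- The polynomials of degree less than `e`. -/
def degLT (e : ℕ) : Submodule k (MvPolynomial ℕ k) where
  carrier := {p | ∀ m : ℕ →₀ ℕ, e ≤ m.degree → p.coeff m = 0}
  zero_mem' m _ := coeff_zero m
  add_mem' hp hq m h := by rw [coeff_add, hp m h, hq m h, add_zero]
  smul_mem' c p hp m h := by rw [coeff_smul, hp m h, smul_zero]

theorem degLT_mono {d e : ℕ} (h : d ≤ e) : degLT k d ≤ degLT k e :=
  fun _ hp m hm => hp m (h.trans hm)

theorem monomial_mem_degLT {e : ℕ} {m : ℕ →₀ ℕ} (h : m.degree < e) (c : k) :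
    monomial m c ∈ degLT k e := by
  classical
  intro m' hm'
  rw [coeff_monomial, if_neg]
  rintro rfl
  omega

theorem degLT_induction {e : ℕ} {P : MvPolynomial ℕ k → Prop}
    (hadd : ∀ p q, P p → P q → P (p + q)) (h0 : P 0)
    (hm : ∀ m : ℕ →₀ ℕ, m.degree < e → ∀ c : k, P (monomial m c)) {p : MvPolynomial ℕ k}
    (hp : p ∈ degLT k e) : P p := by
  rw [p.as_sum]
  refine Finset.sum_induction _ P hadd h0 fun m hmp => hm m ?_ _
  by_contra h
  exact mem_support_iff.1 hmp (hp m (by omega))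

theorem mul_mem_degLT {d e : ℕ} {p q : MvPolynomial ℕ k} (hp : p ∈ degLT k d)
    (hq : q ∈ degLT k (e + 1)) : p * q ∈ degLT k (d + e) := by
  classical
  intro m hm
  rw [coeff_mul]
  refine Finset.sum_eq_zero fun x hx => ?_
  have hx' := Finset.HasAntidiagonal.mem_antidiagonal.1 hx
  have : m.degree = x.1.degree + x.2.degree := by rw [← hx', map_add]
  by_cases h : d ≤ x.1.degree
  · rw [hp _ h, zero_mul]
  · rw [hq _ (by omega), mul_zero]

theorem sw_mem_degLT {e : ℕ} (σ : Equiv.Perm ℕ) {p : MvPolynomial ℕ k} (hp : p ∈ degLT k e) :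
    rename σ p ∈ degLT k e := by
  refine degLT_induction (P := fun p => rename σ p ∈ degLT k e)
    (fun p q hp hq => by rw [map_add]; exact add_mem hp hq) (by rw [map_zero]; exact zero_mem _)
    (fun m hm c => ?_) hp
  rw [rename_monomial]
  refine monomial_mem_degLT ?_ c
  rwa [Finsupp.degree_mapDomain]

/-- Split off one variable and use the twisted Leibniz rule; the divided difference of a variable is
a constant. -/
theorem dd_mem_degLT {e : ℕ} (i : ℕ) {p : MvPolynomial ℕ k} (hp : p ∈ degLT k (e + 1)) :
    dd i p ∈ degLT k e := by
  refine degLT_induction (P := fun p => dd i p ∈ degLT k e)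
    (fun p q hp hq => by rw [dd_add]; exact add_mem hp hq)
    (by rw [dd_eq_zero_iff.2 (map_zero _)]; exact zero_mem _) (fun m hm c => ?_) hp
  clear hp
  induction e generalizing m with
  | zero =>
    have : m = 0 := (Finsupp.degree_eq_zero_iff m).1 (by omega)
    subst this
    rw [show dd i (monomial 0 c) = 0 from
        dd_eq_zero_iff.2 (rename_C (R := k) (Equiv.swap i (i + 1)) c)]
    exact zero_mem _
  | succ e ih =>
    by_cases h0 : m = 0
    · subst h0
      rw [show dd i (monomial 0 c) = 0 from
        dd_eq_zero_iff.2 (rename_C (R := k) (Equiv.swap i (i + 1)) c)]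
      exact zero_mem _
    obtain ⟨j, hj⟩ := Finsupp.ne_iff.1 h0
    have hj' : 1 ≤ m j := Nat.one_le_iff_ne_zero.2 hj
    have hm' : m = Finsupp.single j 1 + (m - Finsupp.single j 1) := by
      rw [add_tsub_cancel_of_le (Finsupp.single_le_iff.2 hj')]
    have hd : m.degree = 1 + (m - Finsupp.single j 1).degree := by
      conv_lhs => rw [hm']
      rw [map_add, Finsupp.degree_single]
    have e1 : monomial m c = X j * monomial (m - Finsupp.single j 1) c := by
      rw [X, monomial_mul, one_mul, ← hm']
    have hmem : monomial (m - Finsupp.single j 1) c ∈ degLT k (e + 1) :=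
      monomial_mem_degLT (by omega) c
    have hX : ∀ j, (X j : MvPolynomial ℕ k) ∈ degLT k 2 := fun j =>
      monomial_mem_degLT (by rw [Finsupp.degree_single]; omega) 1
    rw [e1, dd_mul, rename_X]
    refine add_mem ?_ ?_
    · rw [mul_comm]
      exact mul_mem_degLT (ih _ (by omega)) (hX _)
    · have h1 : dd i (X j : MvPolynomial ℕ k) ∈ degLT k 1 := by
        have hone : (1 : MvPolynomial ℕ k) ∈ degLT k 1 := monomial_mem_degLT (by simp) 1
        by_cases h₁ : j = i
        · subst h₁; rw [dd_X_self]; exact hone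
        · by_cases h₂ : j = i + 1
          · subst h₂; rw [dd_X_succ]; exact neg_mem hone
          · rw [dd_X_of_ne h₁ h₂]; exact zero_mem _
      rw [add_comm e 1]
      exact mul_mem_degLT h1 hmem

/-- The operator `f` agrees with the permutation `σ` of the variables up to lower terms. -/
def Lead (f : Module.End k (MvPolynomial ℕ k)) (σ : Equiv.Perm ℕ) : Prop :=
  ∀ e, ∀ p ∈ degLT k (e + 1), f p - rename σ p ∈ degLT k e

theorem lead_one : Lead (1 : Module.End k (MvPolynomial ℕ k)) 1 := by
  intro e p _
  have : rename (1 : Equiv.Perm ℕ) p = p := rename_id_apply p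
  rw [this, Module.End.one_apply, sub_self]
  exact zero_mem _

theorem lead_dem (i : ℕ) : Lead (dem k i) (Equiv.swap i (i + 1)) := by
  intro e p hp
  rw [dem_apply, add_sub_cancel_left]
  exact dd_mem_degLT i hp

theorem Lead.mul {f f' : Module.End k (MvPolynomial ℕ k)} {σ σ' : Equiv.Perm ℕ} (h : Lead f σ)
    (h' : Lead f' σ') : Lead (f * f') (σ * σ') := by
  intro e p hp
  have h0 : ∀ e q, q ∈ degLT k e → f q ∈ degLT k e := by
    intro e q hq
    have := add_mem (degLT_mono (Nat.le_refl e) (h e q (degLT_mono (Nat.le_succ e) hq)))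
      (sw_mem_degLT σ hq)
    simpa using this
  have h1 := h e _ (sw_mem_degLT σ' hp)
  have h2 := h0 e _ (h' e p hp)
  have e1 : rename (σ * σ') p = rename σ (rename σ' p) := by rw [rename_rename]; rfl
  rw [e1, Module.End.mul_apply]
  have := add_mem h2 h1
  rwa [map_sub, sub_add_sub_cancel] at this

/-! ### Faithfulness of the polynomial representation -/

variable (k) in
/-- The generators `tᵢ` with the underlying transpositions. -/
def tg (n i : ℕ) : DAHA k n × Equiv.Perm ℕ :=
  if h : i + 1 < n then (t k i h, Equiv.swap i (i + 1)) else 1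

theorem tg_of_lt {i : ℕ} (h : i + 1 < n) : tg k n i = (t k i h, Equiv.swap i (i + 1)) := dif_pos h

theorem tg_rels : Cox.Rels (n - 1) (tg k n) where
  sq i hi := by
    rw [tg_of_lt (by omega)]
    exact Prod.ext (t_sq _ _) (Equiv.swap_mul_self _ _)
  braid i hi := by
    rw [tg_of_lt (by omega), tg_of_lt (by omega)]
    refine Prod.ext (braid _ _ _) ?_
    have h₁ := Equiv.swap_mul_swap_mul_swap (x := i + 1 + 1) (y := i + 1) (z := i)
      (by omega) (by omega)
    have h₂ := Equiv.swap_mul_swap_mul_swap (x := i) (y := i + 1) (z := i + 1 + 1)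
      (by omega) (by omega)
    rw [Equiv.swap_comm (i + 1) i, Equiv.swap_comm (i + 1 + 1) (i + 1)] at h₁
    change Equiv.swap i (i + 1) * Equiv.swap (i + 1) (i + 1 + 1) * Equiv.swap i (i + 1) =
      Equiv.swap (i + 1) (i + 1 + 1) * Equiv.swap i (i + 1) * Equiv.swap (i + 1) (i + 1 + 1)
    rw [h₁, h₂, Equiv.swap_comm]
  comm i j hij hj := by
    rw [tg_of_lt (by omega), tg_of_lt (by omega)]
    refine Prod.ext (t_comm _ _ _ _ hij) ?_
    refine Equiv.Perm.Disjoint.commute ?_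
    refine Equiv.Perm.disjoint_swap_swap ?_
    simp
    omega

theorem tg_snd {i : ℕ} (hi : i < n - 1) : (tg k n i).2 = Equiv.swap i (i + 1) := by
  rw [tg_of_lt (by omega)]

variable (k n) in
/-- The monoid of the products of the generators `tᵢ`. -/
abbrev words : Submonoid (DAHA k n × Equiv.Perm ℕ) := Cox.gen (tg k n) (n - 1)

/-- The normal forms for the symmetric group inside `Λₙ`: no two words share a permutation, which is
what the independence argument needs. -/
theorem words_ext {x y : words k n} (h : x.1.2 = y.1.2) : x = y :=
  Subtype.ext (Cox.fst_eq_of_snd_eq tg_rels (fun _ hi => tg_snd hi) x.2 y.2 h)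

theorem lead_words {x : DAHA k n × Equiv.Perm ℕ} (hx : x ∈ words k n) :
    Lead (rep k n x.1) x.2 := by
  induction hx using Submonoid.closure_induction_right with
  | one => rw [Prod.fst_one, map_one]; exact lead_one
  | mul_right x hx y hy ih =>
    obtain ⟨i, hi, rfl⟩ := hy
    rw [Prod.fst_mul, Prod.snd_mul, map_mul]
    refine ih.mul ?_
    rw [tg_of_lt (by omega), rep_t]
    exact lead_dem i

variable (k n) in
/-- The map `(f_w) ↦ ∑ f_w(y) w`. -/
def normalSum : (words k n →₀ MvPolynomial ℕ k) →ₗ[k] DAHA k n :=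
  Finsupp.lsum k fun x => LinearMap.mulRight k x.1.1 ∘ₗ (poly k n).toLinearMap

theorem normalSum_single (x : words k n) (p : MvPolynomial ℕ k) :
    normalSum k n (Finsupp.single x p) = poly k n p * x.1.1 := by
  simp [normalSum]

/-- The image contains `1` and is a left ideal: by `t_poly`, multiplication by `tᵢ` turns `f w` into
`sᵢ(f) tᵢ w` plus a polynomial times `w`, and `tᵢ w` is again a word. -/
theorem normalSum_surjective : Function.Surjective (normalSum k n) := by
  have key : ∀ a u : DAHA k n, u ∈ LinearMap.range (normalSum k n) →
      a * u ∈ LinearMap.range (normalSum k n) := by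
    intro a
    induction a using DAHA.induction with
    | halg c =>
      intro u hu
      rw [← Algebra.smul_def]
      exact Submodule.smul_mem _ _ hu
    | ht i hi =>
      rintro _ ⟨F, rfl⟩
      induction F using Finsupp.induction_linear with
      | zero => rw [map_zero, mul_zero]; exact zero_mem _
      | add F F' h h' => rw [map_add, mul_add]; exact add_mem h h'
      | single x p =>
        rw [normalSum_single, ← mul_assoc, t_poly, add_mul]
        have hx : tg k n i * x.1 ∈ words k n := mul_mem (Cox.mem_gen _ (by omega)) x.2
        refine add_mem ⟨Finsupp.single ⟨_, hx⟩ (sw k i p), ?_⟩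
          ⟨Finsupp.single x (dd i p), normalSum_single _ _⟩
        rw [normalSum_single, Prod.fst_mul, tg_of_lt hi, mul_assoc]
    | hy i hi =>
      rintro _ ⟨F, rfl⟩
      induction F using Finsupp.induction_linear with
      | zero => rw [map_zero, mul_zero]; exact zero_mem _
      | add F F' h h' => rw [map_add, mul_add]; exact add_mem h h'
      | single x p =>
        refine ⟨Finsupp.single x (X i * p), ?_⟩
        rw [normalSum_single, normalSum_single, map_mul, poly_X, y'_of_lt hi, mul_assoc]
    | hadd a b ha hb => intro u hu; rw [add_mul]; exact add_mem (ha u hu) (hb u hu)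
    | hmul a b ha hb => intro u hu; rw [mul_assoc]; exact ha _ (hb u hu)
  intro a
  have : (1 : DAHA k n) ∈ LinearMap.range (normalSum k n) :=
    ⟨Finsupp.single 1 1, by rw [normalSum_single, map_one, one_mul]; rfl⟩
  simpa using key a 1 this

theorem rep_normalSum (F : words k n →₀ MvPolynomial ℕ k) (p : MvPolynomial ℕ k) :
    rep k n (normalSum k n F) p = ∑ x ∈ F.support, trunc k n (F x) * rep k n x.1.1 p := by
  rw [normalSum, Finsupp.lsum_apply, Finsupp.sum, map_sum, LinearMap.sum_apply]
  refine Finset.sum_congr rfl fun x _ => ?_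
  rw [LinearMap.comp_apply, LinearMap.mulRight_apply, map_mul]
  change rep k n (poly k n (F x)) (rep k n x.1.1 p) = _
  rw [rep_poly, LinearMap.mulLeft_apply]

/-- The linear independence of the permutations of the variables. -/
theorem perm_independent (s : Finset (words k n)) (c : words k n → MvPolynomial ℕ k)
    (h : ∀ m : ℕ →₀ ℕ, ∑ x ∈ s, c x * rename x.1.2 (monomial m (1 : k)) = 0) :
    ∀ x ∈ s, c x = 0 := by
  let f : words k n → (MvPolynomial ℕ k →* MvPolynomial ℕ k) := fun x =>
    ((rename x.1.2 : MvPolynomial ℕ k →ₐ[k] MvPolynomial ℕ k) : MvPolynomial ℕ k →* MvPolynomial ℕ k)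
  have hf : Function.Injective f := by
    intro x y hxy
    refine words_ext (Equiv.ext fun i => ?_)
    have := DFunLike.congr_fun hxy (X i)
    change rename x.1.2 (X i) = rename y.1.2 (X i) at this
    rw [rename_X, rename_X] at this
    exact X_injective this
  -- Dedekind: distinct multiplicative maps into a domain are linearly independent over it.
  have hli := (linearIndependent_monoidHom (MvPolynomial ℕ k) (MvPolynomial ℕ k)).comp f hf
  refine linearIndependent_iff'.1 hli s c (funext fun p => ?_)
  rw [Finset.sum_apply]
  change ∑ x ∈ s, c x * rename x.1.2 p = 0
  induction p using MvPolynomial.induction_on' with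
  | monomial m a =>
    have e : monomial m a = a • monomial m (1 : k) := by rw [smul_monomial, smul_eq_mul, mul_one]
    simp only [e, map_smul, mul_smul_comm]
    rw [← Finset.smul_sum, h m, smul_zero]
  | add p q hp hq => simp only [map_add, mul_add, Finset.sum_add_distrib, hp, hq, add_zero]

theorem sub_homogeneousComponent_mem {d : ℕ} {p : MvPolynomial ℕ k} (hp : p ∈ degLT k (d + 1)) :
    p - homogeneousComponent d p ∈ degLT k d := by
  intro m hm
  rw [coeff_sub, coeff_homogeneousComponent]
  split_ifs with h
  · rw [sub_self]
  · rw [hp m (by omega), sub_zero]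

/-- Suppose `∑ f_w(y) w` acts by zero and the `f_w` have degree at most `d`. Applied to a monomial
of degree `e`, its component of degree `d + e` is the sum of the degree `d` parts of the `f_w` times
the permuted monomials, as words act by permutations up to lower terms. By independence those parts
vanish, and `d` goes down until nothing is left. -/
theorem rep_injective : Function.Injective (rep k n) := by
  rw [injective_iff_map_eq_zero]
  intro a ha
  obtain ⟨F, rfl⟩ := normalSum_surjective a
  have hsum : ∀ p, ∑ x ∈ F.support, trunc k n (F x) * rep k n x.1.1 p = 0 := by
    intro p
    rw [← rep_normalSum, ha]; rfl
  have step : ∀ d, (∀ x ∈ F.support, trunc k n (F x) ∈ degLT k (d + 1)) →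
      ∀ x ∈ F.support, trunc k n (F x) ∈ degLT k d := by
    intro d hd x hx
    have hc := perm_independent F.support
      (fun x => homogeneousComponent d (trunc k n (F x))) (fun m => ?_) x hx
    · have := sub_homogeneousComponent_mem (hd x hx)
      rwa [hc, sub_zero] at this
    · set e := m.degree with he
      have hm : monomial m (1 : k) ∈ degLT k (e + 1) := monomial_mem_degLT (by omega) 1
      -- Subtracting the zero value of the operator leaves, for each word, errors of degree below `d
      -- + e`: one from the lower terms of the coefficient, one from those of the word.
      have h1 : ∑ x ∈ F.support, homogeneousComponent d (trunc k n (F x)) *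
          rename x.1.2 (monomial m (1 : k)) ∈ degLT k (d + e) := by
        rw [← sub_zero (∑ x ∈ F.support, _), ← hsum (monomial m 1), ← Finset.sum_sub_distrib]
        refine Submodule.sum_mem _ fun x hx => ?_
        have h2 := mul_mem_degLT (sub_homogeneousComponent_mem (hd x hx)) (sw_mem_degLT x.1.2 hm)
        have h3 := mul_mem_degLT (lead_words x.2 e _ hm) (hd x hx)
        have h4 := add_mem h2 (add_comm e d ▸ h3)
        convert neg_mem h4 using 1
        ring
      have h2 : (∑ x ∈ F.support, homogeneousComponent d (trunc k n (F x)) *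
          rename x.1.2 (monomial m (1 : k))).IsHomogeneous (d + e) := by
        refine IsHomogeneous.sum _ _ _ fun x _ =>
          (homogeneousComponent_isHomogeneous d _).mul ?_
        rw [rename_monomial]
        refine isHomogeneous_monomial _ ?_
        rw [Finsupp.degree_mapDomain]
      ext m'
      rw [coeff_zero]
      by_cases hm' : m'.degree = d + e
      · exact h1 m' hm'.ge
      · exact h2.coeff_eq_zero hm'
  have hex : ∃ d, ∀ x ∈ F.support, trunc k n (F x) ∈ degLT k d := by
    refine ⟨F.support.sup (fun x => (trunc k n (F x)).totalDegree) + 1, fun x hx m hm => ?_⟩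
    have h1 := Finset.le_sup (f := fun x => (trunc k n (F x)).totalDegree) hx
    refine coeff_eq_zero_of_totalDegree_lt ?_
    have : m.degree = ∑ i ∈ m.support, m i := rfl
    rw [← this]
    exact lt_of_le_of_lt h1 (by omega)
  obtain ⟨d, hd⟩ := hex
  have h0 : ∀ x ∈ F.support, trunc k n (F x) ∈ degLT k 0 := by
    induction d with
    | zero => exact hd
    | succ d ih => exact ih (step d hd)
  rw [normalSum, Finsupp.lsum_apply]
  refine Finset.sum_eq_zero fun x hx => ?_
  have : trunc k n (F x) = 0 := by
    ext m
    rw [coeff_zero]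
    exact h0 x hx m (Nat.zero_le _)
  -- Only the truncation of `F x` is known to vanish, but `poly` factors through it.
  change poly k n (F x) * x.1.1 = 0
  rw [← poly_trunc, this, map_zero, zero_mul]

/-- An element that commutes with the generators `y` is a polynomial in them. -/
theorem eq_poly_of_commute {a : DAHA k n} (h : ∀ i (hi : i < n), a * y k i hi = y k i hi * a) :
    a = poly k n (sym k n a) := by
  refine rep_injective ?_
  -- The operator of `a` commutes with multiplication by every variable, for the index `n` and
  -- beyond by `rep_X_of_le`; hence it is multiplication by its value at `1`, and faithfulness
  -- applies.
  rw [rep_poly, trunc_sym]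
  refine LinearMap.ext fun p => ?_
  rw [LinearMap.mulLeft_apply]
  induction p using MvPolynomial.induction_on with
  | C c =>
    have : (C c : MvPolynomial ℕ k) = c • 1 := by rw [smul_eq_C_mul, mul_one]
    rw [this, map_smul, mul_smul_comm, mul_one]; rfl
  | add p q hp hq => rw [map_add, hp, hq, mul_add]
  | mul_X p i hp =>
    rw [mul_comm p, mul_left_comm, ← hp]
    by_cases hi : i < n
    · have := LinearMap.congr_fun (congrArg (rep k n) (h i hi)) p
      rw [map_mul, map_mul, Module.End.mul_apply, Module.End.mul_apply, rep_y] at this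
      exact this
    · exact rep_X_of_le (by omega) a p

theorem poly_commute_y (p : MvPolynomial ℕ k) (i : ℕ) (hi : i < n) :
    poly k n p * y k i hi = y k i hi * poly k n p := by
  rw [← y'_of_lt hi, ← poly_X, ← map_mul, ← map_mul, mul_comm]

/-- Applying both sides to `1` gives `dd i p = p - sᵢ p`, which is also `(Xᵢ - Xᵢ₊₁) dd i p`. As `Xᵢ
- Xᵢ₊₁ - 1` has constant term `-1`, it is not zero, so the divided difference vanishes. The converse
is `t_poly`. -/
theorem poly_commute_t_iff (p : MvPolynomial ℕ k) (i : ℕ) (hi : i + 1 < n) :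
    t k i hi * poly k n p = poly k n p * t k i hi ↔ sw k i (trunc k n p) = trunc k n p := by
  constructor
  · intro h
    have := LinearMap.congr_fun (congrArg (rep k n) h) 1
    rw [map_mul, map_mul, rep_t, rep_poly, Module.End.mul_apply, Module.End.mul_apply, dem_one,
      LinearMap.mulLeft_apply, mul_one, dem_apply, add_comm, ← eq_sub_iff_add_eq] at this
    have e := dd_spec i (trunc k n p)
    rw [this, ← sub_eq_zero, ← sub_one_mul, mul_eq_zero] at e
    rcases e with e | e
    · exfalso
      have hc := congrArg (coeff 0) e
      simp at hc
    · exact (sub_eq_zero.1 e).symm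
  · intro h
    rw [← poly_trunc, t_poly, h, dd_eq_zero_iff.2 h, map_zero, add_zero]

end DAHA

end

end TensorDeformation

namespace TensorDeformation

noncomputable section

namespace DAHA

open MvPolynomial

variable {k : Type w} [Field k] {n : ℕ}

/-! ### Coefficients -/

/-- The exponent that agrees with `e` below `n`, and vanishes from `n` on. -/
def cut (n : ℕ) (e : ℕ → ℕ) : ℕ →₀ ℕ :=
  Finsupp.onFinset (Finset.range n) (fun i => if i < n then e i else 0) (fun _ h => by
    by_contra h'
    exact h (if_neg (by simpa using h')))

theorem cut_apply (n : ℕ) (e : ℕ → ℕ) (i : ℕ) : cut n e i = if i < n then e i else 0 := rfl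

theorem cut_congr {e e' : ℕ → ℕ} (h : ∀ i < n, e i = e' i) : cut n e = cut n e' := by
  ext i
  rw [cut_apply, cut_apply]
  split_ifs with hi
  · exact h i hi
  · rfl

theorem cut_cut (e : ℕ → ℕ) : cut n (cut n e) = cut n e :=
  cut_congr fun _ hi => if_pos hi

theorem cut_eq_self_iff {u : ℕ →₀ ℕ} : cut n u = u ↔ ∀ i, n ≤ i → u i = 0 := by
  constructor
  · intro h i hi
    rw [← h, cut_apply, if_neg (by omega)]
  · intro h
    ext i
    rw [cut_apply]
    split_ifs with hi
    · rfl
    · exact (h i (by omega)).symm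

theorem monomial_eq_prod_X_pow (u : ℕ →₀ ℕ) (c : k) :
    monomial u c = C c * u.prod fun i e => X i ^ e := monomial_eq

theorem trunc_monomial (u : ℕ →₀ ℕ) (c : k) :
    trunc k n (monomial u c) = if cut n u = u then monomial u c else 0 := by
  rw [trunc, aeval_monomial]
  split_ifs with h
  · rw [monomial_eq_prod_X_pow]
    congr 1
    refine Finset.prod_congr rfl fun i hi => ?_
    change (if i < n then X i else 0 : MvPolynomial ℕ k) ^ (u i) = X i ^ (u i)
    rw [if_pos]
    by_contra hi'
    exact Finsupp.mem_support_iff.1 hi (cut_eq_self_iff.1 h i (by omega))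
  · rw [cut_eq_self_iff] at h
    push Not at h
    obtain ⟨i, hi, hu⟩ := h
    have : (u.prod fun i e => (if i < n then X i else 0 : MvPolynomial ℕ k) ^ e) = 0 :=
      Finset.prod_eq_zero (Finsupp.mem_support_iff.2 hu) (by
        change (if i < n then X i else 0 : MvPolynomial ℕ k) ^ (u i) = 0
        rw [if_neg (by omega), zero_pow hu])
    rw [this, mul_zero]

theorem coeff_trunc (u : ℕ →₀ ℕ) (p : MvPolynomial ℕ k) :
    coeff u (trunc k n p) = if cut n u = u then coeff u p else 0 := by
  classical
  induction p using MvPolynomial.induction_on' with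
  | monomial v c =>
    rw [trunc_monomial]
    by_cases h : v = u
    · subst h
      split_ifs <;> simp
    · rw [coeff_monomial, if_neg h, ite_self]
      split_ifs
      · rw [coeff_monomial, if_neg h]
      · simp
  | add p q hp hq =>
    rw [map_add, coeff_add, coeff_add, hp, hq]
    split_ifs <;> simp

theorem trunc_eq_self_iff {p : MvPolynomial ℕ k} :
    trunc k n p = p ↔ ∀ u : ℕ →₀ ℕ, cut n u ≠ u → coeff u p = 0 := by
  constructor
  · intro h u hu
    rw [← h, coeff_trunc, if_neg hu]
  · intro h
    ext u
    rw [coeff_trunc]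
    split_ifs with hu
    · rfl
    · exact (h u hu).symm

/-- The coefficient of the monomial in the first `n` variables with exponents `e`. -/
def cf (n : ℕ) (p : MvPolynomial ℕ k) (e : ℕ → ℕ) : k := coeff (cut n e) p

theorem cf_congr (p : MvPolynomial ℕ k) {e e' : ℕ → ℕ} (h : ∀ i < n, e i = e' i) :
    cf n p e = cf n p e' := by
  rw [cf, cf, cut_congr h]

theorem cf_add (p q : MvPolynomial ℕ k) (e : ℕ → ℕ) : cf n (p + q) e = cf n p e + cf n q e :=
  coeff_add _ _ _

theorem cf_smul (c : k) (p : MvPolynomial ℕ k) (e : ℕ → ℕ) : cf n (c • p) e = c * cf n p e :=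
  coeff_smul _ _ _

theorem ext_cf {p q : MvPolynomial ℕ k} (hp : trunc k n p = p) (hq : trunc k n q = q)
    (h : ∀ e, cf n p e = cf n q e) : p = q := by
  ext u
  by_cases hu : cut n u = u
  · have := h u
    rwa [cf, cf, hu] at this
  · rw [trunc_eq_self_iff.1 hp u hu, trunc_eq_self_iff.1 hq u hu]

/-- The translation of the variables. -/
abbrev tr (k : Type w) [Field k] (m : ℕ) : MvPolynomial ℕ k →ₐ[k] MvPolynomial ℕ k :=
  rename (· + m)

theorem add_right_injective' (m : ℕ) : Function.Injective (fun i : ℕ => i + m) :=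
  add_left_injective m

theorem mapDomain_tr_apply (m : ℕ) (v : ℕ →₀ ℕ) (i : ℕ) :
    v.mapDomain (· + m) i = if i < m then 0 else v (i - m) := by
  split_ifs with h
  · refine Finsupp.mapDomain_of_notMem_range _ _ ?_
    rintro ⟨j, hj⟩
    simp only at hj
    omega
  · have := Finsupp.mapDomain_apply (add_right_injective' m) v (i - m)
    rwa [Nat.sub_add_cancel (by omega)] at this

theorem trunc_tr {m n : ℕ} {q : MvPolynomial ℕ k} (hq : trunc k n q = q) :
    trunc k (m + n) (tr k m q) = tr k m q := by
  rw [← hq]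
  refine DFunLike.congr_fun (f := (trunc k (m + n)).comp ((tr k m).comp (trunc k n)))
    (g := (tr k m).comp (trunc k n)) (MvPolynomial.algHom_ext fun i => ?_) q
  simp only [AlgHom.comp_apply, trunc_X]
  split_ifs with h
  · rw [rename_X, trunc_X, if_pos (by omega)]
  · rw [map_zero, map_zero]

theorem trunc_of_le {m n : ℕ} (h : m ≤ n) {p : MvPolynomial ℕ k} (hp : trunc k m p = p) :
    trunc k n p = p := by
  rw [trunc_eq_self_iff] at hp ⊢
  intro u hu
  refine hp u fun h' => hu ?_
  rw [cut_eq_self_iff] at h' ⊢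
  exact fun i hi => h' i (h.trans hi)

/-- The two factors involve disjoint sets of variables, so on monomials the exponents below `m` and
those from `m` on can be compared separately. -/
theorem cf_mul_tr {m n : ℕ} {p : MvPolynomial ℕ k} (hp : trunc k m p = p) (q : MvPolynomial ℕ k)
    (e : ℕ → ℕ) : cf (m + n) (p * tr k m q) e = cf m p e * cf n q (fun i => e (i + m)) := by
  classical
  have key : ∀ (u v : ℕ →₀ ℕ) (c d : k), cut m u = u →
      cf (m + n) (monomial u c * tr k m (monomial v d)) e =
        cf m (monomial u c) e * cf n (monomial v d) (fun i => e (i + m)) := by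
    intro u v c d hu
    rw [rename_monomial, monomial_mul, cf, cf, cf, coeff_monomial, coeff_monomial, coeff_monomial,
      ite_zero_mul_ite_zero]
    congr 1
    refine propext ⟨fun h => ⟨?_, ?_⟩, fun h => ?_⟩
    · ext i
      have hi := DFunLike.congr_fun h i
      rw [Finsupp.add_apply, mapDomain_tr_apply, cut_apply] at hi
      rw [cut_apply]
      split_ifs at hi ⊢ with h1 h2
      · simpa using hi
      · omega
      · exact cut_eq_self_iff.1 hu i (by omega)
      · exact cut_eq_self_iff.1 hu i (by omega)
    · ext i
      have hi := DFunLike.congr_fun h (i + m)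
      rw [Finsupp.add_apply, mapDomain_tr_apply, cut_apply, if_neg (by omega),
        Nat.add_sub_cancel, cut_eq_self_iff.1 hu (i + m) (by omega), zero_add] at hi
      rw [hi, cut_apply]
      congr 1
      exact propext ⟨fun h => by omega, fun h => by omega⟩
    · ext i
      rw [Finsupp.add_apply, mapDomain_tr_apply, h.1, h.2, cut_apply, cut_apply, cut_apply]
      split_ifs with h1 h2
      · rfl
      · omega
      · rw [Nat.sub_add_cancel (by omega), zero_add]
      · omega
      · omega
      · rfl
  have hq : ∀ (u : ℕ →₀ ℕ) (c : k), cut m u = u →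
      cf (m + n) (monomial u c * tr k m q) e =
        cf m (monomial u c) e * cf n q (fun i => e (i + m)) := by
    intro u c hu
    induction q using MvPolynomial.induction_on' with
    | monomial v d => exact key u v c d hu
    | add q q' h h' => rw [map_add, mul_add, cf_add, cf_add, h, h', mul_add]
  have hp' : ∀ u ∈ p.support, cut m u = u := by
    intro u hu
    by_contra h
    exact mem_support_iff.1 hu (trunc_eq_self_iff.1 hp u h)
  have hsum : ∀ (s : Finset (ℕ →₀ ℕ)) (c : (ℕ →₀ ℕ) → k), (∀ u ∈ s, cut m u = u) →
      cf (m + n) ((∑ u ∈ s, monomial u (c u)) * tr k m q) e =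
        cf m (∑ u ∈ s, monomial u (c u)) e * cf n q (fun i => e (i + m)) := by
    intro s c
    induction s using Finset.induction_on with
    | empty => simp [cf]
    | insert u s hus ih =>
      intro hs
      rw [Finset.sum_insert hus, add_mul, cf_add, cf_add, add_mul,
        hq u _ (hs u (Finset.mem_insert_self u s)),
        ih fun v hv => hs v (Finset.mem_insert_of_mem hv)]
  have := hsum p.support (fun u => coeff u p) hp'
  rwa [← p.as_sum] at this

theorem cf_one (e : ℕ → ℕ) : cf n (1 : MvPolynomial ℕ k) e = if ∀ i < n, e i = 0 then 1 else 0 := by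
  classical
  rw [cf, coeff_one]
  congr 1
  refine propext ⟨fun h i hi => ?_, fun h => ?_⟩
  · have := DFunLike.congr_fun h i
    rw [cut_apply, if_pos hi] at this
    exact this.symm
  · ext i
    rw [cut_apply]
    split_ifs with hi
    · exact (h i hi).symm
    · rfl

/-! ### Blocks -/

/-- The multisets of the exponents in the successive blocks of variables of sizes `l`. -/
def blocks : List ℕ → (ℕ → ℕ) → List (Multiset ℕ)
  | [], _ => []
  | m :: l, e => (Multiset.range m).map e :: blocks l fun i => e (i + m)

theorem length_blocks (l : List ℕ) (e : ℕ → ℕ) : (blocks l e).length = l.length := by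
  induction l generalizing e with
  | nil => rfl
  | cons m l ih => rw [blocks, List.length_cons, List.length_cons, ih]

theorem map_card_blocks (l : List ℕ) (e : ℕ → ℕ) : (blocks l e).map Multiset.card = l := by
  induction l generalizing e with
  | nil => rfl
  | cons m l ih => rw [blocks, List.map_cons, ih, Multiset.card_map, Multiset.card_range]

theorem blocks_congr (l : List ℕ) {e e' : ℕ → ℕ} (h : ∀ i < l.sum, e i = e' i) :
    blocks l e = blocks l e' := by
  induction l generalizing e e' with
  | nil => rfl
  | cons m l ih =>
    rw [List.sum_cons] at h
    rw [blocks, blocks, ih (e := fun i => e (i + m)) (e' := fun i => e' (i + m))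
      fun i hi => h _ (by omega)]
    congr 1
    refine Multiset.map_congr rfl fun i hi => h i ?_
    rw [Multiset.mem_range] at hi
    omega

theorem blocks_cut (l : List ℕ) (e : ℕ → ℕ) : blocks l (cut l.sum e) = blocks l e :=
  blocks_congr l fun _ hi => if_pos hi

theorem mem_sum_blocks (l : List ℕ) (e : ℕ → ℕ) {i : ℕ} (h : i < l.sum) :
    e i ∈ (blocks l e).sum := by
  induction l generalizing e i with
  | nil => simp at h
  | cons m l ih =>
    rw [List.sum_cons] at h
    rw [blocks, List.sum_cons, Multiset.mem_add]
    by_cases hi : i < m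
    · exact Or.inl (Multiset.mem_map_of_mem e (Multiset.mem_range.2 hi))
    · have := ih (fun i => e (i + m)) (i := i - m) (by omega)
      rw [Nat.sub_add_cancel (by omega)] at this
      exact Or.inr this

theorem exists_blocks (L : List (Multiset ℕ)) : ∃ e, blocks (L.map Multiset.card) e = L := by
  induction L with
  | nil => exact ⟨fun _ => 0, rfl⟩
  | cons M L ih =>
    obtain ⟨e, he⟩ := ih
    refine ⟨fun i => if i < M.card then M.toList.getD i 0 else e (i - M.card), ?_⟩
    rw [List.map_cons, blocks]
    congr 1
    · conv_rhs => rw [← Multiset.coe_toList M]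
      rw [← Multiset.coe_range, Multiset.map_coe]
      congr 1
      refine List.ext_getElem (by simp) fun i h1 h2 => ?_
      have h3 : i < M.card := by simpa using h1
      simp [h3]
    · rw [← he, map_card_blocks]
      refine blocks_congr _ fun i _ => ?_
      rw [if_neg (by omega), Nat.add_sub_cancel]

/-- Exponents with given multisets in the successive blocks. -/
def pick (L : List (Multiset ℕ)) : ℕ → ℕ := Classical.choose (exists_blocks L)

theorem blocks_pick (L : List (Multiset ℕ)) : blocks (L.map Multiset.card) (pick L) = L :=
  Classical.choose_spec (exists_blocks L)

/-- The indices `i` such that `i` and `i + 1` belong to the same block. -/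
def InBlock : List ℕ → ℕ → Prop
  | [], _ => False
  | m :: l, i => i + 1 < m ∨ (m ≤ i ∧ InBlock l (i - m))

theorem InBlock.lt {l : List ℕ} {i : ℕ} (h : InBlock l i) : i + 1 < l.sum := by
  induction l generalizing i with
  | nil => exact h.elim
  | cons m l ih =>
    rw [List.sum_cons]
    rcases h with h | ⟨h, h'⟩
    · omega
    · have := ih h'; omega

/-- The replacement of the first values of `e` by the entries of a list. -/
def fill (e : ℕ → ℕ) (L : List ℕ) (i : ℕ) : ℕ := L.getD i (e i)

/-- Permutations of lists are generated by swaps of neighbours; the prefix `A` holds the entries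
already passed, so a swap takes place at position `A.length`. -/
theorem fill_perm {α : Type*} {F : (ℕ → ℕ) → α} {m : ℕ}
    (hF : ∀ i, i + 1 < m → ∀ e, F (e ∘ Equiv.swap i (i + 1)) = F e) (e : ℕ → ℕ) {L L' : List ℕ}
    (h : L.Perm L') (A : List ℕ) (hA : A.length + L.length ≤ m) :
    F (fill e (A ++ L)) = F (fill e (A ++ L')) := by
  induction h generalizing A with
  | nil => rfl
  | cons x h ih =>
    have := ih (A ++ [x]) (by simp at hA ⊢; omega)
    simpa using this
  | swap x y L =>
    rw [← hF A.length (by simp at hA; omega)]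
    congr 1
    funext i
    simp only [Function.comp_apply, fill]
    by_cases h1 : i = A.length
    · subst h1
      simp
    · by_cases h2 : i = A.length + 1
      · subst h2
        simp
      · rw [Equiv.swap_apply_of_ne_of_ne h1 h2]
        by_cases h3 : i < A.length
        · rw [List.getD_append _ _ _ _ h3, List.getD_append _ _ _ _ h3]
        · obtain ⟨j, rfl⟩ : ∃ j, i = A.length + (j + 2) := ⟨i - A.length - 2, by omega⟩
          rw [List.getD_append_right _ _ _ _ (by omega), List.getD_append_right _ _ _ _ (by omega),
            Nat.add_sub_cancel_left]
          rfl
  | trans h h' ih ih' => rw [ih A hA, ih' A (by rw [← h.length_eq]; exact hA)]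

/-- A function of the exponents that is invariant under the transpositions inside the blocks
depends on the multisets of exponents only. -/
theorem eq_of_blocks_eq {α : Type*} {l : List ℕ} {F : (ℕ → ℕ) → α}
    (hF : ∀ i, InBlock l i → ∀ e, F (e ∘ Equiv.swap i (i + 1)) = F e) {e e' : ℕ → ℕ}
    (he : ∀ i, l.sum ≤ i → e i = e' i) (h : blocks l e = blocks l e') : F e = F e' := by
  induction l generalizing F e e' with
  | nil =>
    congr 1
    exact funext fun i => he i (Nat.zero_le _)
  | cons m l ih =>
    rw [blocks, blocks, List.cons.injEq] at h
    rw [List.sum_cons] at he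
    -- First the values in the leading block are rearranged into those of `e'`; then, with that
    -- block frozen, the induction runs over the remaining ones.
    let g : (ℕ → ℕ) → ℕ → ℕ := fun u i => if i < m then e' i else u (i - m)
    have h1 : F e = F (g fun i => e (i + m)) := by
      have hp : ((List.range m).map e).Perm ((List.range m).map e') := by
        rw [← Multiset.coe_eq_coe, ← Multiset.map_coe, ← Multiset.map_coe]
        exact h.1
      have := fill_perm (F := F) (m := m) (fun i hi => hF i (Or.inl hi)) e hp [] (by simp)
      rw [List.nil_append, List.nil_append] at this
      convert this using 2
      · funext i
        by_cases hi : i < m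
        · simp [fill, hi]
        · simp [fill, hi]
      · funext i
        by_cases hi : i < m
        · simp [fill, hi, g]
        · simp [fill, hi, g, Nat.sub_add_cancel (not_lt.1 hi)]
    have h2 : F (g fun i => e' (i + m)) = F e' := by
      congr 1
      funext i
      by_cases hi : i < m
      · simp [hi, g]
      · simp [hi, g, Nat.sub_add_cancel (not_lt.1 hi)]
    rw [h1, ← h2]
    refine ih (F := fun u => F (g u)) (fun i hi u => ?_) (fun i hi => he _ (by omega)) h.2
    have e1 : g (u ∘ Equiv.swap i (i + 1)) = g u ∘ Equiv.swap (i + m) (i + m + 1) := by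
      funext j
      simp only [g, Function.comp_apply]
      by_cases hj : j < m
      · rw [Equiv.swap_apply_of_ne_of_ne (a := i + m) (b := i + m + 1) (by omega) (by omega),
          if_pos hj, if_pos hj]
      · rw [if_neg hj]
        by_cases h1 : j = i + m
        · subst h1
          rw [Equiv.swap_apply_left (i + m), Nat.add_sub_cancel, Equiv.swap_apply_left,
            if_neg (by omega)]
          congr 1; omega
        · by_cases h2 : j = i + m + 1
          · subst h2
            rw [Equiv.swap_apply_right (i + m), if_neg (by omega),
              show i + m + 1 - m = i + 1 by omega, Equiv.swap_apply_right]
            congr 1; omega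
          · rw [Equiv.swap_apply_of_ne_of_ne (a := i + m) h1 h2, if_neg hj,
              Equiv.swap_apply_of_ne_of_ne (by omega) (by omega)]
    change F (g (u ∘ _)) = F (g u)
    rw [e1]
    refine hF _ (Or.inr ⟨by omega, ?_⟩) _
    rwa [Nat.add_sub_cancel]

/-! ### Block-symmetric polynomials and their coefficients. -/

variable (k) in
/-- The polynomials that are invariant under the permutations inside the blocks. -/
def Inv (l : List ℕ) : Submodule k (MvPolynomial ℕ k) where
  carrier := {p | trunc k l.sum p = p ∧ ∀ i, InBlock l i → sw k i p = p}
  zero_mem' := ⟨map_zero _, fun _ _ => map_zero _⟩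
  add_mem' hp hq := ⟨by rw [map_add, hp.1, hq.1], fun i hi => by
    rw [map_add, hp.2 i hi, hq.2 i hi]⟩
  smul_mem' c p hp := ⟨by rw [map_smul, hp.1], fun i hi => by rw [map_smul, hp.2 i hi]⟩

theorem cf_sw {i : ℕ} (hi : i + 1 < n) (p : MvPolynomial ℕ k) (e : ℕ → ℕ) :
    cf n (sw k i p) (e ∘ Equiv.swap i (i + 1)) = cf n p e := by
  have : cut n (e ∘ Equiv.swap i (i + 1)) = (cut n e).mapDomain (Equiv.swap i (i + 1)) := by
    ext j
    have h1 : j = Equiv.swap i (i + 1) (Equiv.swap i (i + 1) j) := (Equiv.swap_apply_self _ _ _).symm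
    have h2 : Equiv.swap i (i + 1) j < n ↔ j < n := by
      rw [Equiv.swap_apply_def]
      split_ifs <;> omega
    conv_rhs => rw [h1]
    rw [Finsupp.mapDomain_apply (Equiv.injective _), cut_apply, cut_apply]
    simp only [h2]
    rfl
  rw [cf, this, coeff_rename_mapDomain _ (Equiv.injective _), cf]

/-- This is what turns a block-symmetric polynomial into a function on lists of multisets, with
`ofBlocks` in the other direction. -/
theorem cf_eq_of_blocks_eq {l : List ℕ} {p : MvPolynomial ℕ k} (hp : p ∈ Inv k l) {e e' : ℕ → ℕ}
    (h : blocks l e = blocks l e') : cf l.sum p e = cf l.sum p e' := by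
  have h1 : ∀ e, cf l.sum p e = cf l.sum p (cut l.sum e) := fun e => by
    rw [cf, cf, cut_cut]
  rw [h1 e, h1 e']
  refine eq_of_blocks_eq (l := l) (F := cf l.sum p) (fun i hi e => ?_) (fun i hi => ?_) ?_
  · conv_lhs => rw [← hp.2 i hi]
    exact cf_sw hi.lt p e
  · rw [cut_apply, cut_apply, if_neg (by omega), if_neg (by omega)]
  · rw [blocks_cut, blocks_cut, h]

theorem mem_Inv_of_cf {l : List ℕ} {p : MvPolynomial ℕ k} (h1 : trunc k l.sum p = p)
    (h2 : ∀ i, InBlock l i → ∀ e, cf l.sum p (e ∘ Equiv.swap i (i + 1)) = cf l.sum p e) :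
    p ∈ Inv k l := by
  refine ⟨h1, fun i hi => ext_cf (n := l.sum) ?_ h1 fun e => ?_⟩
  · rw [trunc_sw hi.lt, h1]
  · have h3 := cf_sw hi.lt p (e ∘ Equiv.swap i (i + 1))
    rw [h2 i hi] at h3
    rw [← h3]
    congr 1
    funext j
    simp

theorem blocks_swap {l : List ℕ} {i : ℕ} (h : InBlock l i) (e : ℕ → ℕ) :
    blocks l (e ∘ Equiv.swap i (i + 1)) = blocks l e := by
  induction l generalizing i e with
  | nil => exact h.elim
  | cons m l ih =>
    rw [blocks, blocks]
    rcases h with h | ⟨h, h'⟩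
    · congr 1
      · rw [← Multiset.map_map]
        congr 1
        have hd := (Multiset.nodup_range m).map (Equiv.swap i (i + 1)).injective
        refine (Multiset.Nodup.ext hd (Multiset.nodup_range m)).2 fun j => ?_
        rw [Multiset.mem_map]
        constructor
        · rintro ⟨a, ha, rfl⟩
          rw [Multiset.mem_range] at ha ⊢
          rw [Equiv.swap_apply_def]
          split_ifs <;> omega
        · intro hj
          refine ⟨Equiv.swap i (i + 1) j, ?_, Equiv.swap_apply_self _ _ _⟩
          rw [Multiset.mem_range] at hj ⊢
          rw [Equiv.swap_apply_def]
          split_ifs <;> omega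
      · congr 1
        funext j
        rw [Function.comp_apply, Equiv.swap_apply_of_ne_of_ne (by omega) (by omega)]
    · congr 1
      · refine Multiset.map_congr rfl fun j hj => ?_
        rw [Multiset.mem_range] at hj
        rw [Function.comp_apply, Equiv.swap_apply_of_ne_of_ne (by omega) (by omega)]
      · rw [← ih h' fun j => e (j + m)]
        congr 1
        funext j
        obtain ⟨i, rfl⟩ : ∃ a, i = a + m := ⟨i - m, by omega⟩
        rw [Nat.add_sub_cancel]
        simp only [Function.comp_apply]
        congr 1
        have : Function.Injective (fun j : ℕ => j + m) := add_right_injective' m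
        have h3 := this.map_swap (x := i) (y := i + 1) (z := j)
        rw [add_right_comm] at h3
        exact h3.symm

/-- The finiteness condition for functions on lists of multisets to be the coefficients of a
polynomial. -/
def FinOn (l : List ℕ) (G : List (Multiset ℕ) → k) : Prop :=
  {L : List (Multiset ℕ) | L.map Multiset.card = l ∧ G L ≠ 0}.Finite

theorem finite_exponents {l : List ℕ} {G : List (Multiset ℕ) → k} (hG : FinOn l G) :
    {u : ℕ →₀ ℕ | cut l.sum u = u ∧ G (blocks l u) ≠ 0}.Finite := by
  refine Set.Finite.subset (Set.Finite.biUnion hG fun L _ =>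
    -- The inner sum joins the multisets, the outer one adds up the exponents; the total bounds each
    -- single exponent.
    Set.finite_Iic (cut l.sum fun _ => L.sum.sum)) ?_
  rintro u ⟨hu, hGu⟩
  refine Set.mem_biUnion (x := blocks l u) ⟨map_card_blocks l u, hGu⟩ ?_
  intro i
  rw [cut_apply]
  split_ifs with hi
  · exact Multiset.single_le_sum (fun _ _ => Nat.zero_le _) _ (mem_sum_blocks l u hi)
  · exact (cut_eq_self_iff.1 hu i (by omega)).le

/-- The polynomial with given coefficients that depend on the multisets of the exponents only. -/
def ofBlocks (l : List ℕ) (G : List (Multiset ℕ) → k) (hG : FinOn l G) : MvPolynomial ℕ k :=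
  ∑ u ∈ (finite_exponents hG).toFinset, monomial u (G (blocks l u))

theorem coeff_ofBlocks {l : List ℕ} {G : List (Multiset ℕ) → k} (hG : FinOn l G) (u : ℕ →₀ ℕ) :
    coeff u (ofBlocks l G hG) = if cut l.sum u = u then G (blocks l u) else 0 := by
  classical
  rw [ofBlocks, coeff_sum]
  simp only [coeff_monomial]
  rw [Finset.sum_ite_eq']
  simp only [Set.Finite.mem_toFinset, Set.mem_ofPred_eq]
  by_cases h1 : cut l.sum u = u
  · by_cases h2 : G (blocks l u) = 0 <;> simp [h1, h2]
  · simp [h1]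

theorem cf_ofBlocks {l : List ℕ} {G : List (Multiset ℕ) → k} (hG : FinOn l G) (e : ℕ → ℕ) :
    cf l.sum (ofBlocks l G hG) e = G (blocks l e) := by
  rw [cf, coeff_ofBlocks, if_pos (cut_cut e), blocks_cut]

theorem ofBlocks_mem {l : List ℕ} {G : List (Multiset ℕ) → k} (hG : FinOn l G) :
    ofBlocks l G hG ∈ Inv k l := by
  refine mem_Inv_of_cf ?_ fun i hi e => ?_
  · rw [trunc_eq_self_iff]
    intro u hu
    rw [coeff_ofBlocks, if_neg hu]
  · rw [cf_ofBlocks, cf_ofBlocks, blocks_swap hi]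

theorem finOn_of_mem {l : List ℕ} {p : MvPolynomial ℕ k} {G : List (Multiset ℕ) → k}
    (h : ∀ e, cf l.sum p e = G (blocks l e)) : FinOn l G := by
  refine Set.Finite.subset (p.support.finite_toSet.image fun u : ℕ →₀ ℕ => blocks l u) ?_
  rintro L ⟨rfl, hL⟩
  refine ⟨cut (L.map Multiset.card).sum (pick L), ?_, ?_⟩
  · rw [Finset.mem_coe, mem_support_iff]
    change cf _ p (pick L) ≠ 0
    rwa [h, blocks_pick]
  · simp only
    rw [blocks_cut, blocks_pick]

end DAHA

end

end TensorDeformation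

namespace TensorDeformation

noncomputable section

namespace DAHA

open MvPolynomial

variable {k : Type w} [Field k] {n : ℕ}

/-! ### Block subalgebras -/

variable (k) in
/-- The subalgebra generated by the `yᵢ` and by the `tᵢ` for which `i` and `i + 1` belong to the same
block. -/
def blockAlg (l : List ℕ) (n : ℕ) : Subalgebra k (DAHA k n) :=
  Algebra.adjoin k ({a | ∃ i hi, a = y k i hi} ∪ {a | ∃ i hi, InBlock l i ∧ a = t k i hi})

theorem y_mem_blockAlg (l : List ℕ) (i : ℕ) (hi : i < n) : y k i hi ∈ blockAlg k l n :=
  Algebra.subset_adjoin (Or.inl ⟨i, hi, rfl⟩)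

theorem t_mem_blockAlg {l : List ℕ} {i : ℕ} (h : InBlock l i) (hi : i + 1 < n) :
    t k i hi ∈ blockAlg k l n :=
  Algebra.subset_adjoin (Or.inr ⟨i, hi, h, rfl⟩)

theorem blockAlg_le {l : List ℕ} {S : Subalgebra k (DAHA k n)} (hy : ∀ i hi, y k i hi ∈ S)
    (ht : ∀ i hi, InBlock l i → t k i hi ∈ S) : blockAlg k l n ≤ S := by
  refine Algebra.adjoin_le ?_
  rintro a (⟨i, hi, rfl⟩ | ⟨i, hi, h, rfl⟩)
  · exact hy i hi
  · exact ht i hi h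

theorem tensor_mem_blockAlg {m : ℕ} {l : List ℕ} (h : m + 0 ≤ m + n) (h' : n + m ≤ m + n)
    (a : DAHA k m) {b : DAHA k n} (hb : b ∈ blockAlg k l n) :
    shift 0 h a * shift m h' b ∈ blockAlg k (m :: l) (m + n) := by
  refine mul_mem ?_ ?_
  · induction a using DAHA.induction with
    | halg c => rw [AlgHom.commutes]; exact Subalgebra.algebraMap_mem _ _
    | ht i hi => rw [shift_t]; exact t_mem_blockAlg (l := m :: l) (i := i) (Or.inl hi) _
    | hy i hi => rw [shift_y]; exact y_mem_blockAlg _ _ _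
    | hadd a b ha hb => rw [map_add]; exact add_mem ha hb
    | hmul a b ha hb => rw [map_mul]; exact mul_mem ha hb
  · refine blockAlg_le (S := (blockAlg k (m :: l) (m + n)).comap (shift m h')) ?_ ?_ hb
    · intro i hi
      rw [Subalgebra.mem_comap, shift_y]
      exact y_mem_blockAlg _ _ _
    · intro i hi hil
      rw [Subalgebra.mem_comap, shift_t]
      refine t_mem_blockAlg (l := m :: l) (i := i + m) (Or.inr ⟨by omega, ?_⟩) _
      rwa [Nat.add_sub_cancel]

/-- Commuting with the `yᵢ` makes `a` a polynomial, and then commuting with each `tᵢ` inside a block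
is invariance under its transposition; generators suffice. -/
theorem commute_blockAlg_iff {l : List ℕ} (hn : n = l.sum) (a : DAHA k n) :
    (∀ b ∈ blockAlg k l n, b * a = a * b) ↔ a = poly k n (sym k n a) ∧ sym k n a ∈ Inv k l := by
  constructor
  · intro h
    have h1 := eq_poly_of_commute fun i hi => (h _ (y_mem_blockAlg l i hi)).symm
    refine ⟨h1, hn ▸ trunc_sym a, fun i hi => ?_⟩
    have h2 := h _ (t_mem_blockAlg hi (hn ▸ hi.lt))
    rwa [h1, poly_commute_t_iff, trunc_sym] at h2
  · rintro ⟨h1, -, h2⟩ b hb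
    have : blockAlg k l n ≤ Subalgebra.centralizer k {a} := by
      refine blockAlg_le (fun i hi => ?_) fun i hi hil => ?_
      · rw [Subalgebra.mem_centralizer_iff]
        rintro _ rfl
        rw [h1, poly_commute_y]
      · rw [Subalgebra.mem_centralizer_iff]
        rintro _ rfl
        rw [h1]
        refine ((poly_commute_t_iff _ _ _).2 ?_).symm
        rw [trunc_sym]
        exact h2 i hil
    exact ((Subalgebra.mem_centralizer_iff k).1 (this hb) a rfl).symm

theorem shift_poly {m n : ℕ} (s : ℕ) (h : m + s ≤ n) (p : MvPolynomial ℕ k) :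
    shift s h (poly k m p) = poly k n (tr k s (trunc k m p)) := by
  refine DFunLike.congr_fun (f := (shift s h).comp (poly k m))
    (g := (poly k n).comp ((tr k s).comp (trunc k m))) (MvPolynomial.algHom_ext fun i => ?_) p
  simp only [AlgHom.comp_apply, trunc_X, poly_X]
  split_ifs with hi
  · rw [y'_of_lt hi, shift_y, rename_X, poly_X, y'_of_lt]
  · rw [y', dif_neg hi, map_zero, map_zero, map_zero]

theorem tr_zero (p : MvPolynomial ℕ k) : tr k 0 p = p := rename_id_apply p

theorem μ_poly (m n : ℕ) {p q : MvPolynomial ℕ k} (hp : trunc k m p = p) (hq : trunc k n q = q) :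
    μ m n (poly k m p ⊗ₜ poly k n q) = poly k (m + n) (p * tr k m q) := by
  rw [μ_tmul, shift_poly, shift_poly, hp, hq, tr_zero, map_mul]

theorem sym_one : sym k n 1 = 1 := by
  rw [sym_apply, map_one (rep k n)]; rfl

end DAHA

/-! ### The degenerate affine Hecke category -/

open DAHA

variable {k : Type w} [Field k] {n : ℕ}

/-- The symbol of a morphism of the degenerate affine Hecke category. -/
def sy {X Y : heckeCat k} (f : X ⟶ Y) : MvPolynomial ℕ k := sym k X.deg (SW.val f)

theorem sy_add {X Y : heckeCat k} (f g : X ⟶ Y) : sy (f + g) = sy f + sy g :=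
  map_add (sym k X.deg) _ _

theorem sy_smul {X Y : heckeCat k} (c : k) (f : X ⟶ Y) : sy (c • f) = c • sy f :=
  map_smul (sym k X.deg) _ _

theorem sy_zero {X Y : heckeCat k} : sy (0 : X ⟶ Y) = 0 := map_zero (sym k X.deg)

theorem sy_id (X : heckeCat k) : sy (𝟙 X) = 1 := sym_one

/-- The morphisms `[m] ⟶ [n]`, `m = n`, that are given by the unit. -/
def IsUnital {X Y : heckeCat k} (f : X ⟶ Y) : Prop :=
  ∃ h : X.deg = Y.deg, f = (SW.isoOfEq h).hom

theorem IsUnital.id (X : heckeCat k) : IsUnital (𝟙 X) := ⟨rfl, rfl⟩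

theorem IsUnital.comp {X Y Z : heckeCat k} {f : X ⟶ Y} {g : Y ⟶ Z} (hf : IsUnital f)
    (hg : IsUnital g) : IsUnital (f ≫ g) := by
  obtain ⟨h, rfl⟩ := hf
  obtain ⟨h', rfl⟩ := hg
  exact ⟨h.trans h', SW.ofEq_comp_ofEq h h'⟩

theorem IsUnital.tensor {X Y X' Y' : heckeCat k} {f : X ⟶ Y} {g : X' ⟶ Y'} (hf : IsUnital f)
    (hg : IsUnital g) : IsUnital (f ⊗ₘ g) := by
  obtain ⟨h, rfl⟩ := hf
  obtain ⟨h', rfl⟩ := hg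
  exact ⟨congrArg₂ (· + ·) h h', SW.tensorHom_ofEq h h'⟩

theorem IsUnital.whiskerLeft (X : heckeCat k) {Y Z : heckeCat k} {f : Y ⟶ Z} (hf : IsUnital f) :
    IsUnital (X ◁ f) := by
  rw [← id_tensorHom]
  exact (IsUnital.id X).tensor hf

/-- Symbols for all objects live in the same polynomial ring, so the identifications behind
associators and unitors are invisible to them. -/
theorem IsUnital.sy_comp {X Y Z : heckeCat k} {f : X ⟶ Y} (hf : IsUnital f) (g : Y ⟶ Z) :
    sy (f ≫ g) = sy g := by
  obtain ⟨h, rfl⟩ := hf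
  rw [sy, SW.val_ofEq_comp]
  exact sym_castAlg h.symm (SW.val g)

theorem IsUnital.sy_comp' {X Y Z : heckeCat k} (f : X ⟶ Y) {g : Y ⟶ Z} (hg : IsUnital g) :
    sy (f ≫ g) = sy f := by
  obtain ⟨h, rfl⟩ := hg
  rw [sy, SW.val_comp_ofEq]
  rfl

theorem isUnital_mergeIso : ∀ (i : ℕ) (X : List (heckeCat k)),
    IsUnital (mergeIso i X).hom ∧ IsUnital (mergeIso i X).inv
  | 0, _ :: _ :: _ => ⟨⟨Nat.add_assoc _ _ _, rfl⟩, ⟨(Nat.add_assoc _ _ _).symm, rfl⟩⟩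
  | 0, [_] => ⟨.id _, .id _⟩
  | i + 1, X :: l => ⟨(isUnital_mergeIso i l).1.whiskerLeft X, (isUnital_mergeIso i l).2.whiskerLeft X⟩
  | 0, [] => ⟨.id _, .id _⟩
  | _ + 1, [] => ⟨.id _, .id _⟩

theorem isUnital_splitIso : ∀ (m : ℕ) (X : List (heckeCat k)),
    IsUnital (splitIso m X).hom ∧ IsUnital (splitIso m X).inv
  | 0, _ => ⟨⟨(Nat.zero_add _).symm, rfl⟩, ⟨Nat.zero_add _, rfl⟩⟩
  | _ + 1, [] => ⟨⟨(Nat.zero_add _).symm, rfl⟩, ⟨Nat.zero_add _, rfl⟩⟩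
  | m + 1, X :: l =>
    ⟨((isUnital_splitIso m l).1.whiskerLeft X).comp ⟨(Nat.add_assoc _ _ _).symm, rfl⟩,
      IsUnital.comp ⟨Nat.add_assoc _ _ _, rfl⟩ ((isUnital_splitIso m l).2.whiskerLeft X)⟩

/-- The sizes of the factors of a tensor product. -/
abbrev degs (X : List (heckeCat k)) : List ℕ := X.map SW.deg

theorem deg_tens (X : List (heckeCat k)) : (tens X).deg = (degs X).sum := by
  induction X with
  | nil => rfl
  | cons X l ih =>
    change X.deg + (tens l).deg = _
    rw [ih]; rfl

theorem deg_injective : Function.Injective (SW.deg : heckeCat k → ℕ) := by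
  rintro ⟨m⟩ ⟨n⟩ h
  exact congrArg SW.mk h

/-- There are no nonzero morphisms between different objects, so naturality is a condition on each
list of objects separately. -/
theorem tensHom_eq_zero {X Y : List (heckeCat k)} (f : HomList X Y) (h : X ≠ Y) :
    tensHom f = 0 := by
  induction f with
  | nil => exact absurd rfl h
  | @cons X Y l l' f fs ih =>
    change f ⊗ₘ tensHom fs = 0
    by_cases h1 : X = Y
    · rw [ih fun h2 => h (by rw [h1, h2]), SW.tensorHom_zero]
    · rw [SW.hom_eq_zero f fun h2 => h1 (deg_injective h2), SW.zero_tensorHom]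

theorem val_tensHom_mem {X Y : List (heckeCat k)} (f : HomList X Y) :
    (SW.val (tensHom f) : DAHA k (tens X).deg) ∈ blockAlg k (degs X) (tens X).deg := by
  induction f with
  | nil => exact one_mem _
  | @cons X Y l l' f fs ih => exact tensor_mem_blockAlg _ _ _ ih

/-- The endomorphism of `[n]` given by an element of `Λₙ`. -/
def endo (X : heckeCat k) (a : DAHA k X.deg) : X ⟶ X :=
  (⟨a, fun h => absurd rfl h⟩ : SW.Hom X X)

theorem exists_tensHom_eq_y (X : List (heckeCat k)) (i : ℕ) (hi : i < (tens X).deg) :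
    ∃ f : HomList X X, SW.val (tensHom f) = y k i hi := by
  induction X generalizing i with
  | nil => exact absurd hi (Nat.not_lt_zero _)
  | cons X l ih =>
    by_cases h : i < X.deg
    · refine ⟨.cons (endo X (y k i h)) (.refl l), ?_⟩
      change μ X.deg (tens l).deg (y k i h ⊗ₜ SW.val (tensHom (.refl l))) = _
      rw [tensHom_refl]
      change μ X.deg (tens l).deg (y k i h ⊗ₜ 1) = _
      rw [μ_tmul, map_one, mul_one, shift_y]
      rfl
    · have hi' : i - X.deg < (tens l).deg := by
        change i < X.deg + (tens l).deg at hi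
        omega
      obtain ⟨f, hf⟩ := ih (i - X.deg) hi'
      refine ⟨.cons (𝟙 X) f, ?_⟩
      change μ X.deg (tens l).deg (1 ⊗ₜ SW.val (tensHom f)) = _
      rw [hf, μ_tmul, map_one, one_mul, shift_y]
      congr 1
      omega

theorem exists_tensHom_eq_t (X : List (heckeCat k)) (i : ℕ) (h : InBlock (degs X) i)
    (hi : i + 1 < (tens X).deg) : ∃ f : HomList X X, SW.val (tensHom f) = t k i hi := by
  induction X generalizing i with
  | nil => exact h.elim
  | cons X l ih =>
    rcases h with h | ⟨h, h'⟩
    · refine ⟨.cons (endo X (t k i h)) (.refl l), ?_⟩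
      change μ X.deg (tens l).deg (t k i h ⊗ₜ SW.val (tensHom (.refl l))) = _
      rw [tensHom_refl]
      change μ X.deg (tens l).deg (t k i h ⊗ₜ 1) = _
      rw [μ_tmul, map_one, mul_one, shift_t]
      rfl
    · have hi' : i - X.deg + 1 < (tens l).deg := by
        change i + 1 < X.deg + (tens l).deg at hi
        omega
      obtain ⟨f, hf⟩ := ih (i - X.deg) h' hi'
      refine ⟨.cons (𝟙 X) f, ?_⟩
      change μ X.deg (tens l).deg (1 ⊗ₜ SW.val (tensHom f)) = _
      rw [hf, μ_tmul, map_one, one_mul, shift_t]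
      congr 1
      omega

/-- Tensor products of endomorphisms lie in the block algebra and include its generators, so
naturality amounts to commuting with that algebra. -/
theorem natural_iff (X : List (heckeCat k)) (a : tens X ⟶ tens X) :
    (∀ f : HomList X X, tensHom f ≫ a = a ≫ tensHom f) ↔
      SW.val a = poly k (tens X).deg (sy a) ∧ sy a ∈ Inv k (degs X) := by
  refine Iff.trans ?_ (commute_blockAlg_iff (deg_tens X) (SW.val a : DAHA k (tens X).deg))
  have key : ∀ f : HomList X X, tensHom f ≫ a = a ≫ tensHom f ↔
      (SW.val (tensHom f) : DAHA k (tens X).deg) * SW.val a =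
        (SW.val a : DAHA k (tens X).deg) * SW.val (tensHom f) := by
    intro f
    constructor
    · intro h
      have := congrArg SW.val h
      rw [SW.val_comp _ _ rfl, SW.val_comp _ _ rfl] at this
      exact this.symm
    · intro h
      refine SW.hom_ext ?_
      rw [SW.val_comp _ _ rfl, SW.val_comp _ _ rfl]
      exact h.symm
  constructor
  · intro h b hb
    refine (Subalgebra.mem_centralizer_iff k).1 (blockAlg_le
      (S := Subalgebra.centralizer k {(SW.val a : DAHA k (tens X).deg)}) ?_ ?_ hb) _ rfl |>.symm
    · intro i hi
      obtain ⟨f, hf⟩ := exists_tensHom_eq_y X i hi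
      rw [Subalgebra.mem_centralizer_iff]
      rintro _ rfl
      rw [← hf]
      exact ((key f).1 (h f)).symm
    · intro i hi hX
      obtain ⟨f, hf⟩ := exists_tensHom_eq_t X i hX hi
      rw [Subalgebra.mem_centralizer_iff]
      rintro _ rfl
      rw [← hf]
      exact ((key f).1 (h f)).symm
  · intro h f
    exact (key f).2 (h _ (val_tensHom_mem f))

theorem val_app (a : E (heckeCat k) k n) (X : List (heckeCat k)) (h : X.length = n) :
    SW.val (a.app X h) = poly k (tens X).deg (sy (a.app X h)) :=
  ((natural_iff X _).1 fun f => a.naturality f h h).1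

theorem sy_app_mem (a : E (heckeCat k) k n) (X : List (heckeCat k)) (h : X.length = n) :
    sy (a.app X h) ∈ Inv k (degs X) :=
  ((natural_iff X _).1 fun f => a.naturality f h h).2

theorem ext_sy {a b : E (heckeCat k) k n} (h : ∀ X hX, sy (a.app X hX) = sy (b.app X hX)) :
    a = b := by
  refine E.ext fun X hX => SW.hom_ext ?_
  rw [val_app, val_app, h]

/-- The cochain with given symbols. -/
def ofSy (p : List ℕ → MvPolynomial ℕ k) (hp : ∀ l, l.length = n → p l ∈ Inv k l) :
    E (heckeCat k) k n :=
  ⟨fun X => endo _ (poly k _ (p (degs X.1))), by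
    intro X Y f
    by_cases h : X.1 = Y.1
    · obtain rfl := Subtype.ext h
      refine (natural_iff X.1 _).2 ?_ f
      have hs : sy (endo (tens X.1) (poly k _ (p (degs X.1)))) = p (degs X.1) := by
        refine (sym_poly _).trans ?_
        rw [deg_tens]
        exact (hp _ (by simp [X.2])).1
      rw [hs]
      exact ⟨rfl, hp _ (by simp [X.2])⟩
    · rw [tensHom_eq_zero f h, Limits.zero_comp, Limits.comp_zero]⟩

theorem sy_ofSy (p : List ℕ → MvPolynomial ℕ k) (hp : ∀ l, l.length = n → p l ∈ Inv k l)
    (X : List (heckeCat k)) (h : X.length = n) : sy ((ofSy p hp).app X h) = p (degs X) := by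
  refine (sym_poly _).trans ?_
  rw [deg_tens]
  exact (hp _ (by simp [h])).1

theorem sy_tensor {X X' : heckeCat k} {f : X ⟶ X} {g : X' ⟶ X'}
    (hf : SW.val f = poly k X.deg (sy f)) (hg : SW.val g = poly k X'.deg (sy g)) :
    sy (f ⊗ₘ g) = sy f * tr k X.deg (sy g) := by
  have hf' : trunc k X.deg (sy f) = sy f := trunc_sym _
  have hg' : trunc k X'.deg (sy g) = sy g := trunc_sym _
  have h1 : SW.val (f ⊗ₘ g) = poly k (X.deg + X'.deg) (sy f * tr k X.deg (sy g)) := by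
    rw [SW.val_tensor, hf, hg]
    exact μ_poly _ _ hf' hg'
  have h2 : sy (f ⊗ₘ g) = sym k (X.deg + X'.deg) (poly k (X.deg + X'.deg) (sy f * tr k X.deg (sy g))) :=
    congrArg (sym k (X.deg + X'.deg)) h1
  rw [h2, sym_poly, map_mul, trunc_of_le (Nat.le_add_right _ _) hf', trunc_tr hg']

theorem sy_cup {m n : ℕ} (a : E (heckeCat k) k m) (b : E (heckeCat k) k n) (X : List (heckeCat k))
    (h : X.length = m + n) (h₁ : (X.take m).length = m) (h₂ : (X.drop m).length = n) :
    sy ((cup a b).app X h) = sy (a.app (X.take m) h₁) *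
      tr k (degs (X.take m)).sum (sy (b.app (X.drop m) h₂)) := by
  change sy ((splitIso m X).hom ≫ (a.app (X.take m) h₁ ⊗ₘ b.app (X.drop m) h₂) ≫
    (splitIso m X).inv) = _
  rw [(isUnital_splitIso m X).1.sy_comp, IsUnital.sy_comp' _ (isUnital_splitIso m X).2,
    sy_tensor (val_app _ _ _) (val_app _ _ _), deg_tens]

theorem sy_inner (i : Fin n) (a : E (heckeCat k) k n) (X : List (heckeCat k))
    (h : X.length = n + 1) (h' : (merge i X).length = n) :
    sy ((cofaceInner i a).app X h) = sy (a.app (merge i X) h') := by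
  change sy ((mergeIso i X).inv ≫ a.app (merge i X) h' ≫ (mergeIso i X).hom) = _
  rw [(isUnital_mergeIso i X).2.sy_comp, IsUnital.sy_comp' _ (isUnital_mergeIso i X).1]

end

end TensorDeformation

namespace TensorDeformation

noncomputable section

/-! ### The bar differentials as alternating sums of faces. -/

namespace Bar

variable {k : Type w} [Field k]

/-- The list with the two consecutive entries `Lᵢ`, `Lᵢ₊₁` replaced by their sum. -/
def mergeM : ℕ → List (Multiset ℕ) → List (Multiset ℕ)
  | 0, M :: N :: L => (M + N) :: L
  | 0, [M] => [M]
  | i + 1, M :: L => M :: mergeM i L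
  | _, [] => []

theorem length_mergeM : ∀ (i : ℕ) (L : List (Multiset ℕ)), i + 1 < L.length →
    (mergeM i L).length + 1 = L.length
  | 0, _ :: _ :: _, _ => rfl
  | 0, [_], h => by simp at h
  | i + 1, M :: L, h => by
      have := length_mergeM i L (by simpa using h)
      simp [mergeM, this]
  | 0, [], h => by simp at h
  | _ + 1, [], h => by simp at h

theorem lin_cons (f : List (Multiset ℕ) → k) (M : Multiset ℕ) (ω : Ch k) :
    lin k f (cons M ω) = lin k (fun L => f (M :: L)) ω :=
  ext_bs (f := lin k f ∘ₗ cons M) (g := lin k fun L => f (M :: L)) (fun L => by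
    rw [LinearMap.comp_apply, cons_bs, lin_bs, lin_bs]) ω

/-- Unfolding the recursion, the head merges with its successor and every later face picks up one
sign; the last entry meets the empty list and is augmented. -/
theorem lin_bar (n : ℕ) (L : List (Multiset ℕ)) (h : L.length = n + 1)
    (f : List (Multiset ℕ) → k) : lin k f (bar (bs k L)) =
      ∑ i ∈ Finset.range n, (-1) ^ i * f (mergeM i L) +
        (-1) ^ n * (f (L.take n) * eps k (L.drop n).sum) := by
  induction n generalizing L f with
  | zero =>
    obtain ⟨M, rfl⟩ := List.length_eq_one_iff.1 h
    rw [bar_cons_bs, bar_nil, map_zero, sub_zero, act_nil, map_smul, lin_bs, Finset.sum_range_zero,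
      zero_add, pow_zero, one_mul, smul_eq_mul, mul_comm]
    simp
  | succ n ih =>
    obtain _ | ⟨M, L⟩ := L
    · simp at h
    have h' : L.length = n + 1 := by simpa using h
    rw [bar_cons_bs, map_sub, lin_cons, ih L h', Finset.sum_range_succ']
    obtain _ | ⟨N, L⟩ := L
    · simp at h'
    rw [act_cons, lin_bs, List.take_succ_cons (i := n), List.drop_succ_cons]
    have e : ∀ i, mergeM (i + 1) (M :: N :: L) = M :: mergeM i (N :: L) := fun _ => rfl
    simp only [e, pow_succ, mul_neg, mul_one, neg_mul, Finset.sum_neg_distrib, pow_zero, one_mul]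
    rw [show mergeM 0 (M :: N :: L) = (M + N) :: L from rfl]
    ring

/-- The first face comes from `red` and the others from `lin_bar`. The end faces are written with
`take` and `drop` to match the cup products with the unit in `d_eq`. -/
theorem lin_bd (n : ℕ) (L : List (Multiset ℕ)) (h : L.length = n + 1)
    (f : List (Multiset ℕ) → k) : lin k f (bd k (bs k L)) =
      eps k (L.take 1).sum * f (L.drop 1) +
        ∑ i ∈ Finset.range n, (-1) ^ (i + 1) * f (mergeM i L) +
        (-1) ^ (n + 1) * (f (L.take n) * eps k (L.drop n).sum) := by
  rw [bd, LinearMap.sub_apply, map_sub, lin_bar n L h]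
  obtain _ | ⟨M, L⟩ := L
  · simp at h
  rw [red_cons, map_smul, lin_bs]
  simp only [pow_succ, mul_neg, mul_one, neg_mul, Finset.sum_neg_distrib, smul_eq_mul,
    List.take_succ_cons, List.take_zero, List.sum_cons, List.sum_nil, add_zero, List.drop_succ_cons,
    List.drop_zero]
  ring

theorem lin_bd_congr {n : ℕ} {L : List (Multiset ℕ)} (h : L.length = n + 1)
    {f g : List (Multiset ℕ) → k} (hfg : ∀ L, L.length = n → f L = g L) :
    lin k f (bd k (bs k L)) = lin k g (bd k (bs k L)) := by
  rw [lin_bd n L h, lin_bd n L h, hfg _ (by simp [h]), hfg (L.take n) (by simp [h])]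
  congr 2
  refine Finset.sum_congr rfl fun i hi => ?_
  rw [Finset.mem_range] at hi
  rw [hfg _ (by have := length_mergeM i L (by omega); omega)]

end Bar

open DAHA Bar

variable {k : Type w} [Field k] {n : ℕ}

/-! ### Blocks of exponents -/

namespace DAHA

theorem blocks_append (l l' : List ℕ) (e : ℕ → ℕ) :
    blocks (l ++ l') e = blocks l e ++ blocks l' fun i => e (i + l.sum) := by
  induction l generalizing e with
  | nil => rfl
  | cons m l ih =>
    rw [List.cons_append, blocks, ih, blocks, List.cons_append, List.sum_cons]
    simp only [add_assoc, add_comm m]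

theorem range_map_add (m n : ℕ) (e : ℕ → ℕ) : (Multiset.range (m + n)).map e =
    (Multiset.range m).map e + (Multiset.range n).map fun i => e (i + m) := by
  rw [Multiset.range_add, Multiset.map_add, Multiset.map_map]
  simp only [Function.comp_def, add_comm m]

end DAHA

theorem blocks_merge : ∀ (i : ℕ) (X : List (heckeCat k)) (e : ℕ → ℕ),
    blocks (degs (merge i X)) e = mergeM i (blocks (degs X) e)
  | 0, X :: Y :: l, e => by
      change (Multiset.range (X.deg + Y.deg)).map e ::
        blocks (degs l) (fun i => e (i + (X.deg + Y.deg))) = _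
      rw [range_map_add]
      simp only [degs, List.map_cons, blocks, mergeM, add_assoc, add_comm X.deg]
  | 0, [_], _ => rfl
  | i + 1, X :: l, e => by
      change (Multiset.range X.deg).map e :: blocks (degs (merge i l)) (fun i => e (i + X.deg)) = _
      rw [blocks_merge i l]
      rfl
  | 0, [], _ => rfl
  | _ + 1, [], _ => rfl

theorem sum_degs_merge : ∀ (i : ℕ) (X : List (heckeCat k)),
    (degs (merge i X)).sum = (degs X).sum
  | 0, X :: Y :: l => by
      change X.deg + Y.deg + (degs l).sum = X.deg + (Y.deg + (degs l).sum)
      omega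
  | 0, [_] => rfl
  | i + 1, X :: l => by
      change X.deg + (degs (merge i l)).sum = X.deg + (degs l).sum
      rw [sum_degs_merge i l]
  | 0, [] => rfl
  | _ + 1, [] => rfl

/-! ### The cochains on the bar complex -/

variable (k) in
/-- The objects of given sizes. -/
abbrev objs (l : List ℕ) : List (heckeCat k) := l.map SW.mk

theorem objs_degs (X : List (heckeCat k)) : objs k (degs X) = X := by
  rw [objs, degs, List.map_map]
  exact List.map_id X

theorem degs_objs (l : List ℕ) : degs (objs k l) = l := by
  rw [objs, degs, List.map_map]
  exact List.map_id l

/-- The coefficients of the symbols of a cochain, as a cochain on the bar complex. -/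
def coch (a : E (heckeCat k) k n) (L : List (Multiset ℕ)) : k :=
  if h : L.length = n then
    cf (L.map Multiset.card).sum
      (sy (a.app (objs k (L.map Multiset.card)) (by simp [h]))) (pick L)
  else 0

theorem app_congr (a : E (heckeCat k) k n) {X Y : List (heckeCat k)} (h : X = Y)
    (hX : X.length = n) (hY : Y.length = n) : sy (a.app X hX) = sy (a.app Y hY) := by
  subst h; rfl

/-- By block symmetry the chosen exponents `pick` may be replaced by any others with the same
multisets. -/
theorem cf_sy_app (a : E (heckeCat k) k n) (X : List (heckeCat k)) (h : X.length = n)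
    (e : ℕ → ℕ) : cf (degs X).sum (sy (a.app X h)) e = coch a (blocks (degs X) e) := by
  have hl : (blocks (degs X) e).length = n := by rw [length_blocks]; simp [h]
  have hX : objs k ((blocks (degs X) e).map Multiset.card) = X := by
    rw [map_card_blocks, objs_degs]
  rw [coch, dif_pos hl, app_congr a hX _ h, map_card_blocks]
  refine cf_eq_of_blocks_eq (sy_app_mem a X h) ?_
  have := blocks_pick (blocks (degs X) e)
  rw [map_card_blocks] at this
  exact this.symm

theorem exists_blocks_eq (L : List (Multiset ℕ)) :
    ∃ (X : List (heckeCat k)) (e : ℕ → ℕ), X.length = L.length ∧ blocks (degs X) e = L :=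
  ⟨objs k (L.map Multiset.card), pick L, by simp, by rw [degs_objs, blocks_pick]⟩

theorem trunc_sy_app (a : E (heckeCat k) k n) (X : List (heckeCat k)) (h : X.length = n) :
    trunc k (degs X).sum (sy (a.app X h)) = sy (a.app X h) :=
  (sy_app_mem a X h).1

theorem ext_coch {a b : E (heckeCat k) k n} (h : ∀ L, L.length = n → coch a L = coch b L) :
    a = b := by
  refine ext_sy fun X hX => ext_cf (trunc_sy_app a X hX) (trunc_sy_app b X hX) fun e => ?_
  rw [cf_sy_app, cf_sy_app, h]
  rw [length_blocks]
  simp [hX]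

theorem coch_cup {m n : ℕ} (a : E (heckeCat k) k m) (b : E (heckeCat k) k n)
    (L : List (Multiset ℕ)) (h : L.length = m + n) :
    coch (cup a b) L = coch a (L.take m) * coch b (L.drop m) := by
  obtain ⟨X, e, hX, rfl⟩ := exists_blocks_eq (k := k) L
  have hX' : X.length = m + n := hX.trans h
  have h1 : (X.take m).length = m := by simp [hX']
  have h2 : (X.drop m).length = n := by simp [hX']
  have hd : degs X = degs (X.take m) ++ degs (X.drop m) := by
    rw [degs, degs, degs, ← List.map_append, List.take_append_drop]
  rw [← cf_sy_app _ X hX', sy_cup a b X hX' h1 h2, hd, List.sum_append,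
    cf_mul_tr (trunc_sy_app a _ _), cf_sy_app, cf_sy_app, blocks_append]
  have h3 : (blocks (degs (X.take m)) e).length = m := by rw [length_blocks]; simp [hX']
  rw [List.take_left' h3, List.drop_left' h3]

/-- The polynomial `1` has coefficient `1` where all exponents vanish and `0` elsewhere; this is
where the augmentation `0 ↦ 1` comes from. -/
theorem coch_one (L : List (Multiset ℕ)) (h : L.length = n) :
    coch (one (heckeCat k) k n) L = eps k L.sum := by
  obtain ⟨X, e, hX, rfl⟩ := exists_blocks_eq (k := k) L
  rw [← cf_sy_app _ X (hX.trans h)]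
  have : sy ((one (heckeCat k) k n).app X (hX.trans h)) = 1 := sy_id _
  rw [this, cf_one]
  split_ifs with h1
  · rw [eps_of_forall]
    rw [← blocks_congr _ (e := fun _ => 0) (fun i hi => (h1 i hi).symm)]
    generalize degs X = l
    induction l with
    | nil => simp [blocks]
    | cons m l ih =>
      intro x hx
      rw [blocks, List.sum_cons, Multiset.mem_add] at hx
      rcases hx with hx | hx
      · obtain ⟨_, -, rfl⟩ := Multiset.mem_map.1 hx
        rfl
      · exact ih x hx
  · push Not at h1
    obtain ⟨i, hi, hei⟩ := h1
    exact (eps_eq_zero (mem_sum_blocks _ e hi) hei).symm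

theorem coch_inner (i : Fin n) (a : E (heckeCat k) k n) (L : List (Multiset ℕ))
    (h : L.length = n + 1) : coch (cofaceInner i a) L = coch a (mergeM i L) := by
  obtain ⟨X, e, hX, rfl⟩ := exists_blocks_eq (k := k) L
  have hX' : X.length = n + 1 := hX.trans h
  have h' : (merge i X).length = n := by rw [length_merge _ _ (by omega)]; omega
  rw [← cf_sy_app _ X hX', sy_inner i a X hX' h', ← blocks_merge, ← cf_sy_app _ _ h',
    sum_degs_merge]

theorem coch_add (a b : E (heckeCat k) k n) (L : List (Multiset ℕ)) :
    coch (a + b) L = coch a L + coch b L := by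
  unfold coch
  split_ifs with h
  · rw [E.app_add, sy_add, cf_add]
  · rw [add_zero]

theorem coch_smul (c : k) (a : E (heckeCat k) k n) (L : List (Multiset ℕ)) :
    coch (c • a) L = c * coch a L := by
  unfold coch
  split_ifs with h
  · rw [E.app_smul, sy_smul, cf_smul]
  · rw [mul_zero]

variable (n) in
/-- The value of the associated cochain on a list, as a linear map. -/
def cochLin (L : List (Multiset ℕ)) : E (heckeCat k) k n →ₗ[k] k where
  toFun a := coch a L
  map_add' a b := coch_add a b L
  map_smul' c a := coch_smul c a L

theorem coch_sum {ι : Type*} (s : Finset ι) (a : ι → E (heckeCat k) k n) (L : List (Multiset ℕ)) :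
    coch (∑ i ∈ s, a i) L = ∑ i ∈ s, coch (a i) L :=
  map_sum (cochLin n L) a s

theorem coch_cast {m n : ℕ} (h : m = n) (a : E (heckeCat k) k m) (L : List (Multiset ℕ)) :
    coch (E.cast h a) L = coch a L := by
  subst h; rfl

/-- The outer cofaces are cup products with the unit, hence factors `eps`; the inner ones join
blocks, hence add multisets. So the deformation complex is a complex of functions on the bar
complex. -/
theorem coch_d (a : E (heckeCat k) k n) (L : List (Multiset ℕ)) (h : L.length = n + 1) :
    coch (d (heckeCat k) k n a) L = lin k (coch a) (bd k (bs k L)) := by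
  rw [d_eq, innerSum_apply, coch_add, coch_add, coch_cast, coch_cup _ _ _ (by omega), coch_smul,
    coch_cup _ _ _ h, coch_sum, lin_bd n L h, coch_one _ (by simp [h]), coch_one _ (by simp [h]),
    ← Fin.sum_univ_eq_sum_range fun i => (-1) ^ (i + 1) * coch a (mergeM i L)]
  congr 2
  refine Finset.sum_congr rfl fun i _ => ?_
  rw [coch_smul, coch_inner i a L h]

/-! ### Primitives -/

/-- With the cardinalities fixed, only finitely many lists of multisets have bounded total exponent.
-/
theorem finOn_iff {l : List ℕ} {G : List (Multiset ℕ) → k} :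
    FinOn l G ↔ ∃ N, ∀ L : List (Multiset ℕ), L.map Multiset.card = l → G L ≠ 0 → L.sum.sum ≤ N := by
  constructor
  · intro h
    obtain ⟨N, hN⟩ := (h.image fun L => L.sum.sum).bddAbove
    exact ⟨N, fun L h1 h2 => hN ⟨L, ⟨h1, h2⟩, rfl⟩⟩
  · rintro ⟨N, hN⟩
    refine Set.Finite.subset ((Set.finite_Iic (cut l.sum fun _ => N)).image
      fun u : ℕ →₀ ℕ => blocks l u) ?_
    rintro L ⟨rfl, hL⟩
    refine ⟨cut (L.map Multiset.card).sum (pick L), fun i => ?_, ?_⟩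
    · rw [cut_apply, cut_apply]
      split_ifs with hi
      · have h1 := mem_sum_blocks (L.map Multiset.card) (pick L) hi
        rw [blocks_pick] at h1
        exact (Multiset.single_le_sum (fun _ _ => Nat.zero_le _) _ h1).trans (hN L rfl hL)
      · exact le_rfl
    · simp only
      rw [blocks_cut, blocks_pick]

theorem finOn_coch (a : E (heckeCat k) k n) (l : List ℕ) : FinOn l (coch a) := by
  by_cases h : l.length = n
  · have h' : (objs k l).length = n := by simp [h]
    have := finOn_of_mem (G := coch a) fun e => cf_sy_app a (objs k l) h' e
    rwa [degs_objs] at this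
  · refine finOn_iff.2 ⟨0, fun L hL hG => absurd ?_ hG⟩
    refine dif_neg fun h1 => h ?_
    rw [← hL, ← h1, List.length_map]

theorem card_sum (L : List (Multiset ℕ)) : L.sum.card = (L.map Multiset.card).sum := by
  induction L with
  | nil => rfl
  | cons M L ih => rw [List.sum_cons, Multiset.card_add, ih, List.map_cons, List.sum_cons]

/-- Deleting generators `0` changes the sizes of the blocks, so a bound is needed for all sizes of
total at most `c` at once; there are finitely many. -/
theorem exists_bound (a : E (heckeCat k) k n) (c : ℕ) :
    ∃ N, ∀ L : List (Multiset ℕ), L.length = n → L.sum.card ≤ c → coch a L ≠ 0 → L.sum.sum ≤ N := by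
  choose N hN using fun l => finOn_iff.1 (finOn_coch a l)
  have hf : {l : List ℕ | l.length = n ∧ l.sum ≤ c}.Finite := by
    refine ((List.finite_length_eq (Fin (c + 1)) n).image (List.map Fin.val)).subset ?_
    rintro l ⟨hl, hc⟩
    have hx : ∀ x ∈ l, x < c + 1 := fun x hx =>
      Nat.lt_succ_of_le ((List.single_le_sum (fun _ _ => Nat.zero_le _) x hx).trans hc)
    refine ⟨l.pmap (fun x h => (⟨x, h⟩ : Fin (c + 1))) hx, by simp [hl], ?_⟩
    rw [List.map_pmap]
    simp
  obtain ⟨B, hB⟩ := (hf.image N).bddAbove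
  refine ⟨B, fun L h1 h2 h3 => (hN _ L rfl h3).trans (hB ⟨_, ⟨?_, ?_⟩, rfl⟩)⟩
  · simp [h1]
  · rwa [card_sum] at h2

theorem sum_filter_ne_zero (α : Multiset ℕ) : (α.filter (fun x => x ≠ 0)).sum = α.sum := by
  induction α using Multiset.induction_on with
  | empty => rfl
  | cons x α ih =>
    by_cases h : x = 0
    · rw [Multiset.filter_cons_of_neg (p := fun x => x ≠ 0) _ (by simpa using h), ih, Multiset.sum_cons, h, zero_add]
    · rw [Multiset.filter_cons_of_pos (p := fun x => x ≠ 0) _ h, Multiset.sum_cons, Multiset.sum_cons, ih]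

theorem _root_.TensorDeformation.Bar.Loc.sum_eq {α β : Multiset ℕ} (h : Loc α β) : β.sum = α.sum := by
  rw [← sum_filter_ne_zero β, h.2, sum_filter_ne_zero]

/-- Every list that occurs in `prim` has the same total exponent as `L`, as zeros contribute
nothing, and no more entries in total; so the uniform bound for `a` applies. -/
theorem finOn_prim (a : E (heckeCat k) k (n + 1)) (l : List ℕ) (hl : l.length = n) :
    FinOn l fun L => lin k (coch a) (prim (n + 1) L) := by
  obtain ⟨N, hN⟩ := exists_bound a l.sum
  refine finOn_iff.2 ⟨N, ?_⟩
  rintro L rfl hL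
  have hL' : L.length = n := by simpa using hl
  have hm := prim_mem (k := k) (n := n + 1) (L := L) (by omega)
  by_contra hlt
  refine hL ((Finsupp.linearCombination_apply k _).trans (Finset.sum_eq_zero fun L' h' => ?_))
  obtain ⟨h1, h2⟩ := hm h'
  have : coch a L' = 0 := by
    by_contra h3
    refine hlt ?_
    rw [← h2.sum_eq]
    refine hN L' h1 ?_ h3
    rw [← card_sum]
    exact Multiset.card_le_card h2.1
  simp only [this, smul_zero]

/-- The primitive from `eq_prim` satisfies the finiteness condition, so it is the coefficient
function of an actual cochain. In degree `0` the only antisymmetrization is the empty list, and `a`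
itself vanishes. -/
theorem mem_B_of_alt {a : E (heckeCat k) k n} (ha : a ∈ Z (heckeCat k) k n)
    (halt : ∀ S : List ℕ, S.length = n → S.SortedLT → lin k (coch a) (alt k S) = 0) :
    a ∈ B (heckeCat k) k n := by
  have hF : ∀ L : List (Multiset ℕ), L.length = n + 1 → lin k (coch a) (bd k (bs k L)) = 0 := by
    intro L hL
    have ha' : d (heckeCat k) k n a = 0 := ha
    rw [← coch_d a L hL, ha']
    exact map_zero (cochLin (n + 1) L)
  have h := eq_prim n (coch a) hF halt
  cases n with
  | zero =>
    have : a = 0 := ext_coch fun L hL => by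
      have := halt [] rfl (fun i => i.elim0)
      rw [List.length_eq_zero_iff.1 hL]
      change lin k (coch a) (bs k []) = 0 at this
      rw [lin_bs] at this
      rw [this]
      exact (map_zero (cochLin 0 [])).symm
    rw [this]
    exact zero_mem _
  | succ n =>
    let G : List (Multiset ℕ) → k := fun L => lin k (coch a) (prim (n + 1) L)
    let p : List ℕ → MvPolynomial ℕ k := fun l =>
      if hl : l.length = n then ofBlocks l G (finOn_prim a l hl) else 0
    have hp : ∀ l (hl : l.length = n), p l = ofBlocks l G (finOn_prim a l hl) := fun l hl => dif_pos hl
    have hp' : ∀ l, l.length = n → p l ∈ Inv k l := fun l hl => by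
      rw [hp l hl]
      exact ofBlocks_mem _
    have hG : ∀ L, L.length = n → coch (ofSy p hp') L = G L := by
      intro L hL
      obtain ⟨X, e, hX, rfl⟩ := exists_blocks_eq (k := k) L
      rw [← cf_sy_app _ X (hX.trans hL), sy_ofSy, hp _ (by simp [hX.trans hL]), cf_ofBlocks]
    refine ⟨ofSy p hp', ext_coch fun L hL => ?_⟩
    rw [coch_d _ L hL, h L hL]
    exact lin_bd_congr hL hG

end

end TensorDeformation

namespace TensorDeformation

noncomputable section

open DAHA Bar MvPolynomial

variable {k : Type w} [Field k] {n : ℕ}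

/-! ### Exterior powers -/

namespace Wedge

variable (k) in
/-- The element `xʲ` of the exterior algebra of `k[x]`. -/
def wi (j : ℕ) : ExteriorAlgebra k (Polynomial k) := ExteriorAlgebra.ι k (Polynomial.monomial j 1)

variable (k) in
/-- The element `x^{e 0} ∧ ⋯ ∧ x^{e (n - 1)}`. -/
def wd : ℕ → (ℕ → ℕ) → ExteriorAlgebra k (Polynomial k)
  | 0, _ => 1
  | n + 1, e => wi k (e 0) * wd n fun i => e (i + 1)

theorem wd_congr {e e' : ℕ → ℕ} (h : ∀ i < n, e i = e' i) : wd k n e = wd k n e' := by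
  induction n generalizing e e' with
  | zero => rfl
  | succ n ih => rw [wd, wd, h 0 (by omega), ih fun i hi => h (i + 1) (by omega)]

theorem wd_add (m n : ℕ) (e : ℕ → ℕ) :
    wd k (m + n) e = wd k m e * wd k n fun i => e (i + m) := by
  induction m generalizing e with
  | zero => rw [Nat.zero_add, wd, one_mul]; rfl
  | succ m ih =>
    rw [Nat.succ_add, wd, ih, wd, mul_assoc]
    simp only [add_assoc, add_comm m]

theorem wi_mul_wi (i j : ℕ) : wi k i * wi k j = -(wi k j * wi k i) :=
  eq_neg_of_add_eq_zero_left (ExteriorAlgebra.ι_add_mul_swap _ _)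

theorem wd_swap {i : ℕ} (h : i + 1 < n) (e : ℕ → ℕ) :
    wd k n (e ∘ Equiv.swap i (i + 1)) = -wd k n e := by
  induction n generalizing i e with
  | zero => omega
  | succ n ih =>
    cases i with
    | zero =>
      obtain ⟨n, rfl⟩ : ∃ a, n = a + 1 := ⟨n - 1, by omega⟩
      simp only [wd, Function.comp_apply, zero_add, Equiv.swap_apply_left, Equiv.swap_apply_right]
      have h1 : ∀ j : ℕ, Equiv.swap 0 1 (j + 1 + 1) = j + 1 + 1 := fun j =>
        Equiv.swap_apply_of_ne_of_ne (by omega) (by omega)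
      simp only [h1]
      rw [← mul_assoc, wi_mul_wi, neg_mul, mul_assoc]
    | succ i =>
      have h1 : ∀ j : ℕ, Equiv.swap (i + 1) (i + 1 + 1) (j + 1) = Equiv.swap i (i + 1) j + 1 := by
        intro j
        exact ((add_left_injective 1).map_swap (x := i) (y := i + 1) (z := j)).symm
      have h2 := ih (i := i) (by omega) fun i => e (i + 1)
      rw [wd, wd, ← mul_neg, ← h2]
      simp only [Function.comp_apply, h1]
      rw [Equiv.swap_apply_of_ne_of_ne (by omega) (by omega)]
      rfl

theorem wd_eq_zero {i : ℕ} (h : i + 1 < n) {e : ℕ → ℕ} (he : e i = e (i + 1)) :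
    wd k n e = 0 := by
  induction n generalizing i e with
  | zero => omega
  | succ n ih =>
    cases i with
    | zero =>
      obtain ⟨n, rfl⟩ : ∃ a, n = a + 1 := ⟨n - 1, by omega⟩
      rw [wd, wd, ← mul_assoc, ← he, wi, ExteriorAlgebra.ι_sq_zero, zero_mul]
    | succ i => rw [wd, ih (i := i) (e := fun i => e (i + 1)) (by omega) he, mul_zero]

theorem wi_mul_wd (j : ℕ) (e : ℕ → ℕ) : wi k j * wd k n e = (-1 : k) ^ n • (wd k n e * wi k j) := by
  induction n generalizing e with
  | zero => simp [wd]
  | succ n ih =>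
    rw [wd, ← mul_assoc, wi_mul_wi, neg_mul, mul_assoc, ih, mul_smul_comm, ← mul_assoc, pow_succ,
      mul_neg_one, neg_smul]

theorem wd_mem (n : ℕ) (e : ℕ → ℕ) : wd k n e ∈ ⋀[k]^n (Polynomial k) := by
  induction n generalizing e with
  | zero => exact SetLike.one_mem_graded _
  | succ n ih =>
    change _ ∈ LinearMap.range (ExteriorAlgebra.ι k) ^ (n + 1)
    rw [wd, pow_succ']
    exact Submodule.mul_mem_mul ⟨_, rfl⟩ (ih _)

variable (k) in
/-- The linear map to the exterior algebra that sends `∏ Xᵢ ^ eᵢ` to `x^{e 0} ∧ ⋯ ∧ x^{e (n - 1)}`. -/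
def wedge (n : ℕ) : MvPolynomial ℕ k →ₗ[k] ExteriorAlgebra k (Polynomial k) :=
  (basisMonomials ℕ k).constr k fun u => wd k n u

theorem wedge_monomial (u : ℕ →₀ ℕ) (c : k) : wedge k n (monomial u c) = c • wd k n u := by
  have h : monomial u c = c • basisMonomials ℕ k u := by
    rw [coe_basisMonomials, smul_monomial, smul_eq_mul, mul_one]
  rw [h, map_smul, wedge, Module.Basis.constr_basis]

theorem wedge_eq_sum (p : MvPolynomial ℕ k) :
    wedge k n p = ∑ u ∈ p.support, coeff u p • wd k n u := by
  conv_lhs => rw [p.as_sum, map_sum]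
  exact Finset.sum_congr rfl fun u _ => wedge_monomial u _

theorem wedge_mem (p : MvPolynomial ℕ k) : wedge k n p ∈ ⋀[k]^n (Polynomial k) := by
  rw [wedge_eq_sum]
  exact Submodule.sum_mem _ fun u _ => Submodule.smul_mem _ _ (wd_mem n u)

/-- Exchanging two neighbouring exponents pairs the monomials with opposite contributions; a
monomial fixed by the exchange has a repeated exponent and contributes zero, so the argument also
works in characteristic two. -/
theorem wedge_eq_zero {i : ℕ} (h : i + 1 < n) {p : MvPolynomial ℕ k} (hp : sw k i p = p) :
    wedge k n p = 0 := by
  have hc : ∀ u : ℕ →₀ ℕ, coeff (u.mapDomain (Equiv.swap i (i + 1))) p = coeff u p := by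
    intro u
    conv_lhs => rw [← hp]
    exact coeff_rename_mapDomain _ (Equiv.injective _) _ _
  have he : ∀ u : ℕ →₀ ℕ, (u.mapDomain (Equiv.swap i (i + 1)) : ℕ → ℕ) =
      u ∘ Equiv.swap i (i + 1) := by
    intro u
    funext j
    have h1 : j = Equiv.swap i (i + 1) (Equiv.swap i (i + 1) j) := (Equiv.swap_apply_self _ _ _).symm
    conv_lhs => rw [h1]
    rw [Finsupp.mapDomain_apply (Equiv.injective _)]
    rfl
  rw [wedge_eq_sum]
  refine Finset.sum_involution (fun u _ => u.mapDomain (Equiv.swap i (i + 1))) ?_ ?_ ?_ ?_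
  · intro u _
    rw [hc, he, wd_swap h, smul_neg, add_neg_cancel]
  · intro u _ hu hs
    refine hu ?_
    rw [wd_eq_zero h, smul_zero]
    conv_rhs => rw [← hs]
    rw [he, Function.comp_apply, Equiv.swap_apply_right]
  · intro u hu
    rw [mem_support_iff] at hu ⊢
    rwa [hc]
  · intro u _
    refine DFunLike.coe_injective ?_
    rw [he, he]
    funext j
    simp

theorem wedge_mul_tr (m n : ℕ) {p : MvPolynomial ℕ k} (hp : trunc k m p = p)
    (q : MvPolynomial ℕ k) : wedge k (m + n) (p * tr k m q) = wedge k m p * wedge k n q := by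
  have key : ∀ (u v : ℕ →₀ ℕ) (c d : k), cut m u = u →
      wedge k (m + n) (monomial u c * tr k m (monomial v d)) =
        wedge k m (monomial u c) * wedge k n (monomial v d) := by
    intro u v c d hu
    rw [rename_monomial, monomial_mul, wedge_monomial, wedge_monomial, wedge_monomial,
      smul_mul_smul_comm, wd_add]
    congr 2
    · refine wd_congr fun i hi => ?_
      rw [Finsupp.add_apply, mapDomain_tr_apply, if_pos hi, add_zero]
    · refine wd_congr fun i _ => ?_
      rw [Finsupp.add_apply, mapDomain_tr_apply, if_neg (by omega), Nat.add_sub_cancel,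
        cut_eq_self_iff.1 hu _ (by omega), zero_add]
  have hq : ∀ (u : ℕ →₀ ℕ) (c : k), cut m u = u → wedge k (m + n) (monomial u c * tr k m q) =
      wedge k m (monomial u c) * wedge k n q := by
    intro u c hu
    induction q using MvPolynomial.induction_on' with
    | monomial v d => exact key u v c d hu
    | add q q' h h' => rw [map_add, mul_add, map_add, map_add, h, h', mul_add]
  conv_lhs => rw [p.as_sum, Finset.sum_mul, map_sum]
  conv_rhs => rw [p.as_sum, map_sum, Finset.sum_mul]
  refine Finset.sum_congr rfl fun u hu => hq u _ ?_
  by_contra h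
  exact mem_support_iff.1 hu (trunc_eq_self_iff.1 hp u h)

theorem wedge_one_zero : wedge k 0 1 = 1 := by
  rw [← C_1, C_apply, wedge_monomial, one_smul, wd]

theorem wedge_one_one : wedge k 1 1 = wi k 0 := by
  rw [← C_1, C_apply, wedge_monomial, one_smul, wd, wd, mul_one]
  rfl

theorem wi_mul_wedge (j : ℕ) (p : MvPolynomial ℕ k) :
    wi k j * wedge k n p = (-1 : k) ^ n • (wedge k n p * wi k j) := by
  rw [wedge_eq_sum, Finset.mul_sum, Finset.sum_mul, Finset.smul_sum]
  refine Finset.sum_congr rfl fun u _ => ?_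
  rw [mul_smul_comm, wi_mul_wd, smul_mul_assoc, smul_comm]

theorem wedge_aeval (v : Polynomial k) :
    wedge k 1 (Polynomial.aeval (X 0) v) = ExteriorAlgebra.ι k v := by
  induction v using Polynomial.induction_on' with
  | add p q hp hq => rw [map_add, map_add, map_add, hp, hq]
  | monomial j c =>
    rw [Polynomial.aeval_monomial, X_pow_eq_monomial, algebraMap_eq, C_mul_monomial, mul_one,
      wedge_monomial, wd, wd, mul_one, Finsupp.single_eq_same, wi, ← map_smul,
      Polynomial.smul_monomial, smul_eq_mul, mul_one]

/-! ### Contractions -/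

variable (k) in
/-- The contraction with the coefficients of `xʲ`, for the entries `j` of a list. -/
def contr : List ℕ → ExteriorAlgebra k (Polynomial k) →ₗ[k] k
  | [] => ExteriorAlgebra.algebraMapInv.toLinearMap
  | j :: S => contr S ∘ₗ CliffordAlgebra.contractLeft (Polynomial.lcoeff k j)

variable (k) in
/-- The coefficients of the lists with first entry `M`. -/
def pull (M : Multiset ℕ) : Ch k →ₗ[k] Ch k :=
  lin k fun L => open Classical in if L.head? = some M then bs k L.tail else 0

theorem pull_nil (M : Multiset ℕ) : pull k M (bs k []) = 0 := by
  rw [pull, lin_bs]; rfl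

theorem pull_cons (M N : Multiset ℕ) (L : List (Multiset ℕ)) :
    pull k M (bs k (N :: L)) = open Classical in if N = M then bs k L else 0 := by
  classical
  rw [pull, lin_bs]
  simp

theorem pull_apply (M : Multiset ℕ) (L : List (Multiset ℕ)) (ω : Ch k) :
    pull k M ω L = ω (M :: L) := by
  classical
  refine ext_bs (f := Finsupp.lapply L ∘ₗ pull k M) (g := Finsupp.lapply (M :: L)) (fun L' => ?_) ω
  cases L' with
  | nil => simp [pull_nil]
  | cons N L' =>
    rw [LinearMap.comp_apply, pull_cons]
    by_cases h : N = M
    · subst h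
      simp [Finsupp.single_apply]
    · simp [h]

theorem cons_apply (N M : Multiset ℕ) (L : List (Multiset ℕ)) (ω : Ch k) :
    cons N ω (M :: L) = open Classical in if N = M then ω L else 0 := by
  classical
  rw [← pull_apply]
  refine ext_bs (f := Finsupp.lapply L ∘ₗ pull k M ∘ₗ cons N)
    (g := if N = M then Finsupp.lapply L else 0) (fun L' => ?_) ω |>.trans ?_
  · rw [LinearMap.comp_apply, LinearMap.comp_apply, cons_bs, pull_cons]
    split_ifs <;> simp
  · split_ifs <;> simp

/-- Read on coefficients, the recursion of the shuffles has the form of the antiderivation rule for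
contractions; compare `contract_wi_mul`. -/
theorem sh_apply_cons (x : ℕ) (M : Multiset ℕ) (L : List (Multiset ℕ)) (ω : Ch k) :
    sh x ω (M :: L) = (open Classical in if M = {x} then ω L else 0) - sh x (pull k M ω) L := by
  classical
  refine (ext_bs (f := Finsupp.lapply (M :: L) ∘ₗ sh x)
    (g := (if M = {x} then Finsupp.lapply L else 0) - Finsupp.lapply L ∘ₗ sh x ∘ₗ pull k M)
    (fun L' => ?_) ω).trans ?_
  · cases L' with
    | nil =>
      simp only [LinearMap.comp_apply, LinearMap.sub_apply, pull_nil, map_zero, sub_zero]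
      rw [sh_nil, Finsupp.lapply_apply, Finsupp.single_apply]
      by_cases h : M = {x}
      · simp [h, Finsupp.single_apply, eq_comm]
      · simp [h, Ne.symm h]
    | cons N L' =>
      simp only [LinearMap.comp_apply, LinearMap.sub_apply, pull_cons]
      rw [sh_cons_bs, map_sub, Finsupp.lapply_apply, Finsupp.lapply_apply, cons_apply,
        Finsupp.single_apply]
      congr 1
      · by_cases h : M = {x}
        · simp [h, Finsupp.single_apply]
        · simp [h, Ne.symm h]
      · split_ifs <;> simp
  · split_ifs <;> simp

theorem sh_apply_nil (x : ℕ) (ω : Ch k) : sh x ω [] = 0 := by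
  classical
  refine ext_bs (f := Finsupp.lapply [] ∘ₗ sh x) (g := 0) (fun L => ?_) ω
  cases L with
  | nil => rw [LinearMap.comp_apply, sh_nil]; simp
  | cons N L =>
    rw [LinearMap.comp_apply, sh_cons_bs, map_sub]
    have : ∀ ω : Ch k, cons N ω [] = 0 := fun ω =>
      ext_bs (f := Finsupp.lapply [] ∘ₗ cons N) (g := 0) (fun L => by simp) ω
    simp [this]

/-- The list of the singletons of the first `n` values of `e`. -/
abbrev sing (n : ℕ) (e : ℕ → ℕ) : List (Multiset ℕ) := blocks (List.replicate n 1) e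

theorem sing_succ (n : ℕ) (e : ℕ → ℕ) : sing (n + 1) e = {e 0} :: sing n fun i => e (i + 1) := rfl

theorem contract_wi_mul (x j : ℕ) (b : ExteriorAlgebra k (Polynomial k)) :
    CliffordAlgebra.contractLeft (Polynomial.lcoeff k x) (wi k j * b) =
      (if j = x then b else 0) -
        wi k j * CliffordAlgebra.contractLeft (Polynomial.lcoeff k x) b := by
  refine (CliffordAlgebra.contractLeft_ι_mul (Polynomial.lcoeff k x) _ b).trans ?_
  rw [Polynomial.lcoeff_apply, Polynomial.coeff_monomial, ite_smul, one_smul, zero_smul]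
  rfl

/-- Contraction with `x` and shuffling with `x` obey the same recursion, so they correspond to each
other when functionals on wedges are given by coefficients of chains of singletons. -/
theorem contract_wd (x : ℕ) {μ : ExteriorAlgebra k (Polynomial k) →ₗ[k] k} {ω : Ch k}
    (h : ∀ e, μ (wd k n e) = ω (sing n e)) (e : ℕ → ℕ) :
    μ (CliffordAlgebra.contractLeft (Polynomial.lcoeff k x) (wd k (n + 1) e)) =
      sh x ω (sing (n + 1) e) := by
  classical
  have key : ∀ n (μ : ExteriorAlgebra k (Polynomial k) →ₗ[k] k) (ω : Ch k) (e : ℕ → ℕ),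
      (∀ e, μ (wd k n e) = ω (sing n e)) →
      μ (wi k (e 0) * CliffordAlgebra.contractLeft (Polynomial.lcoeff k x)
        (wd k n fun i => e (i + 1))) = sh x (pull k {e 0} ω) (sing n fun i => e (i + 1)) →
      μ (CliffordAlgebra.contractLeft (Polynomial.lcoeff k x) (wd k (n + 1) e)) =
        sh x ω (sing (n + 1) e) := by
    intro n μ ω e h1 h2
    rw [wd, contract_wi_mul, map_sub, h2, sing_succ, sh_apply_cons]
    by_cases h3 : e 0 = x
    · rw [if_pos h3, if_pos (by rw [h3]), h1]
    · rw [if_neg h3, if_neg (by simpa using h3), map_zero]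
  induction n generalizing μ ω e with
  | zero =>
    refine key 0 μ ω e h ?_
    have h1 : CliffordAlgebra.contractLeft (Polynomial.lcoeff k x)
        (1 : ExteriorAlgebra k (Polynomial k)) = 0 := CliffordAlgebra.contractLeft_one _ _
    rw [wd, h1, mul_zero, map_zero]
    exact (sh_apply_nil x _).symm
  | succ n ih =>
    refine key (n + 1) μ ω e h ?_
    -- Multiplying the argument of the functional by the first factor corresponds to restricting the
    -- chain to lists with that first entry.
    refine ih (μ := μ ∘ₗ LinearMap.mulLeft k (wi k (e 0))) (fun f => ?_) fun i => e (i + 1)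
    rw [pull_apply]
    exact h fun i => Nat.casesOn i (e 0) f

theorem contr_wd (S : List ℕ) (e : ℕ → ℕ) :
    contr k S (wd k S.length e) = alt k S (sing S.length e) := by
  induction S generalizing e with
  | nil =>
    change ExteriorAlgebra.algebraMapInv (1 : ExteriorAlgebra k (Polynomial k)) = bs k [] []
    simp
  | cons x S ih => exact contract_wd x ih e

theorem sh_mem_sing (x : ℕ) {n : ℕ} {ω : Ch k}
    (h : ω ∈ Finsupp.supported k k (Set.range (sing n))) :
    sh x ω ∈ Finsupp.supported k k (Set.range (sing (n + 1))) := by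
  refine map_mem_of_supported (sh x) ?_ h
  rintro _ ⟨e, rfl⟩
  clear h
  induction n generalizing e with
  | zero =>
    change sh x (bs k []) ∈ _
    rw [sh_nil]
    exact bs_mem ⟨fun _ => x, rfl⟩
  | succ n ih =>
    rw [sing_succ, sh_cons_bs]
    have h1 : {x} :: {e 0} :: (sing n fun i => e (i + 1)) ∈ Set.range (sing (n + 1 + 1)) :=
      ⟨fun i => Nat.casesOn i x e, rfl⟩
    refine sub_mem (bs_mem h1) ?_
    refine map_mem_of_supported (cons {e 0}) ?_ (ih fun i => e (i + 1))
    rintro _ ⟨f, rfl⟩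
    rw [cons_bs]
    exact bs_mem ⟨fun i => Nat.casesOn i (e 0) f, rfl⟩

theorem alt_mem_sing (S : List ℕ) :
    alt k S ∈ Finsupp.supported k k (Set.range (sing S.length)) := by
  induction S with
  | nil => exact bs_mem ⟨fun _ => 0, rfl⟩
  | cons x S ih => exact sh_mem_sing x ih

theorem sing_injective {e e' : ℕ → ℕ} (h : sing n e = sing n e') : ∀ i < n, e i = e' i := by
  induction n generalizing e e' with
  | zero => intro i hi; omega
  | succ n ih =>
    rw [sing_succ, sing_succ, List.cons.injEq] at h
    intro i hi
    cases i with
    | zero => simpa using h.1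
    | succ i => exact ih h.2 i (by omega)

/-- For blocks of size one, lists of multisets are the same as exponents, so `F` on such lists is
the coefficient function of `p`. -/
theorem lin_eq_sum {p : MvPolynomial ℕ k} (hp : trunc k n p = p) {F : List (Multiset ℕ) → k}
    (hF : ∀ e, cf n p e = F (sing n e)) {ω : Ch k}
    (hω : ω ∈ Finsupp.supported k k (Set.range (sing n))) :
    lin k F ω = ∑ u ∈ p.support, coeff u p * ω (sing n u) := by
  classical
  have h := eq_of_supported (f := lin k F)
    (g := ∑ u ∈ p.support, coeff u p • Finsupp.lapply (sing n u)) (s := Set.range (sing n)) ?_ hω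
  · rw [h]
    simp
  · rintro _ ⟨e, rfl⟩
    rw [lin_bs, ← hF]
    simp only [LinearMap.sum_apply, LinearMap.smul_apply, Finsupp.lapply_apply, smul_eq_mul]
    rw [Finset.sum_eq_single (cut n e)]
    · have : sing n (cut n e) = sing n e := blocks_congr _ fun i hi => if_pos (by simpa using hi)
      rw [this, Finsupp.single_eq_same, mul_one]
      rfl
    · intro u hu hne
      rw [Finsupp.single_apply, if_neg, mul_zero]
      intro h
      refine hne ?_
      have hu' : cut n u = u := by
        by_contra h'
        exact mem_support_iff.1 hu (trunc_eq_self_iff.1 hp u h')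
      rw [← hu']
      exact (cut_congr (sing_injective h)).symm
    · intro h
      rw [notMem_support_iff.1 h, zero_mul]

/-- The values on antisymmetrizations depend on the image in the exterior algebra alone; this gives
injectivity in cohomology. -/
theorem lin_alt {p : MvPolynomial ℕ k} (hp : trunc k n p = p) {F : List (Multiset ℕ) → k}
    (hF : ∀ e, cf n p e = F (sing n e)) {S : List ℕ} (hS : S.length = n) :
    lin k F (alt k S) = contr k S (wedge k n p) := by
  subst hS
  rw [lin_eq_sum hp hF (alt_mem_sing S), wedge_eq_sum, map_sum]
  refine Finset.sum_congr rfl fun u _ => ?_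
  rw [map_smul, contr_wd, smul_eq_mul]

end Wedge

end

end TensorDeformation

namespace TensorDeformation

noncomputable section

open DAHA Bar Wedge MvPolynomial

variable {k : Type w} [Field k] {n : ℕ}

/-! ### The comparison with the exterior algebra -/

variable (k) in
/-- The list `[1], …, [1]` of objects. -/
def pts (n : ℕ) : List (heckeCat k) := List.replicate n ⟨1⟩

theorem length_pts (n : ℕ) : (pts k n).length = n := List.length_replicate

theorem degs_pts (n : ℕ) : degs (pts k n) = List.replicate n 1 := List.map_replicate

theorem sum_degs_pts (n : ℕ) : (degs (pts k n)).sum = n := by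
  rw [degs_pts]; simp

variable (k n) in
/-- The evaluation of a cochain at `[1], …, [1]`, in the exterior algebra. -/
def ev : E (heckeCat k) k n →ₗ[k] ExteriorAlgebra k (Polynomial k) where
  toFun a := wedge k n (sy (a.app (pts k n) (length_pts n)))
  map_add' a b := by rw [E.app_add, sy_add, map_add]
  map_smul' c a := by rw [E.app_smul, sy_smul, map_smul]; rfl

theorem ev_apply (a : E (heckeCat k) k n) {X : List (heckeCat k)} (hX : X = pts k n)
    (h : X.length = n) : wedge k n (sy (a.app X h)) = ev k n a := by
  subst hX; rfl

theorem trunc_sy_pts (a : E (heckeCat k) k n) {X : List (heckeCat k)} (hX : X = pts k n)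
    (h : X.length = n) : trunc k n (sy (a.app X h)) = sy (a.app X h) := by
  subst hX
  have := trunc_sy_app a _ h
  rwa [sum_degs_pts] at this

theorem ev_cup {m n : ℕ} (a : E (heckeCat k) k m) (b : E (heckeCat k) k n) :
    ev k (m + n) (cup a b) = ev k m a * ev k n b := by
  have h1 : (pts k (m + n)).take m = pts k m := by simp [pts]
  have h2 : (pts k (m + n)).drop m = pts k n := by simp [pts]
  have h3 : ((pts k (m + n)).take m).length = m := by rw [h1, length_pts]
  have h4 : ((pts k (m + n)).drop m).length = n := by rw [h2, length_pts]
  have h5 : (degs ((pts k (m + n)).take m)).sum = m := by rw [h1, sum_degs_pts]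
  rw [← ev_apply _ rfl (length_pts (m + n)), sy_cup a b _ _ h3 h4, ← ev_apply a h1 h3,
    ← ev_apply b h2 h4, ← wedge_mul_tr m n (trunc_sy_pts a h1 _), h5]

theorem sy_one (X : List (heckeCat k)) (h : X.length = n) :
    sy ((one (heckeCat k) k n).app X h) = 1 := sy_id _

theorem ev_one_zero : ev k 0 (one (heckeCat k) k 0) = 1 := by
  rw [← wedge_one_zero, ← ev_apply _ rfl (length_pts 0), sy_one]

theorem ev_one_one : ev k 1 (one (heckeCat k) k 1) = wi k 0 := by
  rw [← wedge_one_one, ← ev_apply _ rfl (length_pts 1), sy_one]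

theorem inBlock_merge_pts : ∀ (i n : ℕ), i < n → InBlock (degs (merge i (pts k (n + 1)))) i
  | 0, _ + 1, _ => Or.inl Nat.one_lt_two
  | i + 1, n + 1, h => Or.inr ⟨Nat.succ_pos _, inBlock_merge_pts i n (by omega)⟩

/-- At `[1], …, [1]` this coface is a value of `a` at a list in which two neighbours have become
`[2]`; it is symmetric in the two variables, so its wedge vanishes. -/
theorem ev_inner (i : Fin n) (a : E (heckeCat k) k n) : ev k (n + 1) (cofaceInner i a) = 0 := by
  have h : (merge i (pts k (n + 1))).length = n := by
    rw [length_merge _ _ (by rw [length_pts]; omega), length_pts]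
    rfl
  rw [← ev_apply _ rfl (length_pts (n + 1)), sy_inner i a _ _ h]
  exact wedge_eq_zero (i := i) (by omega) ((sy_app_mem a _ h).2 i (inBlock_merge_pts i n i.2))

theorem ev_cast {m n : ℕ} (h : m = n) (a : E (heckeCat k) k m) :
    ev k n (E.cast h a) = ev k m a := by
  subst h; rfl

theorem ev_mem (a : E (heckeCat k) k n) : ev k n a ∈ ⋀[k]^n (Polynomial k) := wedge_mem _

theorem wi_mul_ev (j : ℕ) (a : E (heckeCat k) k n) :
    wi k j * ev k n a = (-1 : k) ^ n • (ev k n a * wi k j) :=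
  wi_mul_wedge j _

/-- The outer cofaces become left and right multiplication by `x⁰`, and these cancel by graded
commutativity. -/
theorem ev_d (a : E (heckeCat k) k n) : ev k (n + 1) (d (heckeCat k) k n a) = 0 := by
  rw [d_eq, innerSum_apply, map_add, map_add, ev_cast, ev_cup, map_sum, map_smul, ev_cup,
    ev_one_one, wi_mul_ev]
  simp only [map_smul, ev_inner, smul_zero, Finset.sum_const_zero, add_zero]
  rw [pow_succ, mul_neg_one, neg_smul, add_neg_cancel]

theorem ev_of_mem_B {a : E (heckeCat k) k n} (ha : a ∈ B (heckeCat k) k n) : ev k n a = 0 := by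
  cases n with
  | zero =>
    obtain rfl : a = 0 := ha
    exact map_zero _
  | succ n =>
    obtain ⟨b, rfl⟩ := ha
    exact ev_d b

/-- By `lin_alt` the values on antisymmetrizations are contractions of the image, so they vanish and
`mem_B_of_alt` applies. -/
theorem mem_B_of_ev {a : E (heckeCat k) k n} (ha : a ∈ Z (heckeCat k) k n) (h : ev k n a = 0) :
    a ∈ B (heckeCat k) k n := by
  refine mem_B_of_alt ha fun S hS _ => ?_
  have h1 : ∀ e, cf n (sy (a.app (pts k n) (length_pts n))) e = coch a (sing n e) := by
    intro e
    have := cf_sy_app a (pts k n) (length_pts n) e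
    rwa [sum_degs_pts, degs_pts] at this
  rw [lin_alt (trunc_sy_pts a rfl _) h1 hS]
  change contr k S (ev k n a) = 0
  rw [h, map_zero]

/-! ### Cocycles of degree one -/

/-- The power sum `∑ᵢ v(Xᵢ)` in `m` variables. -/
def powerSum (v : Polynomial k) (m : ℕ) : MvPolynomial ℕ k :=
  ∑ i ∈ Finset.range m, Polynomial.aeval (X i) v

theorem powerSum_mem (v : Polynomial k) (m : ℕ) : powerSum v m ∈ Inv k [m] := by
  constructor
  · rw [powerSum, map_sum, List.sum_singleton]
    refine Finset.sum_congr rfl fun i hi => ?_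
    rw [← Polynomial.aeval_algHom_apply, trunc_X, if_pos (Finset.mem_range.1 hi)]
  · rintro i (hi | ⟨-, hi⟩)
    · rw [powerSum, map_sum]
      refine Finset.sum_equiv (Equiv.swap i (i + 1)) (fun j => ?_) fun j _ => ?_
      · rw [Finset.mem_range, Finset.mem_range, Equiv.swap_apply_def]
        split_ifs <;> omega
      · rw [← Polynomial.aeval_algHom_apply, rename_X]
    · exact hi.elim

theorem powerSum_add (v : Polynomial k) (m n : ℕ) :
    powerSum v (m + n) = powerSum v m + tr k m (powerSum v n) := by
  rw [powerSum, Finset.sum_range_add, powerSum, powerSum, map_sum]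
  congr 1
  refine Finset.sum_congr rfl fun i _ => ?_
  rw [← Polynomial.aeval_algHom_apply, rename_X, add_comm]

/-- The cocycle of degree one associated with a polynomial. -/
def powerCocycle (v : Polynomial k) : E (heckeCat k) k 1 :=
  ofSy (fun l => powerSum v l.sum) fun l hl => by
    obtain ⟨m, rfl⟩ := List.length_eq_one_iff.1 hl
    rw [List.sum_singleton]
    exact powerSum_mem v m

theorem sy_powerCocycle (v : Polynomial k) (X : List (heckeCat k)) (h : X.length = 1) :
    sy ((powerCocycle v).app X h) = powerSum v (degs X).sum :=
  sy_ofSy _ _ X h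

/-- In degree one the cocycle condition says that the value at `[m + n]` is the sum of those on the
two blocks, and power sums are additive in this sense. -/
theorem powerCocycle_mem (v : Polynomial k) : powerCocycle v ∈ Z (heckeCat k) k 1 := by
  refine LinearMap.mem_ker.2 (ext_sy fun X hX => ?_)
  obtain ⟨A, B, rfl⟩ := List.length_eq_two.1 hX
  have ht : ([A, B].take 1).length = 1 := rfl
  have hd : ([A, B].drop 1).length = 1 := rfl
  have hm : (merge (0 : Fin 1) [A, B]).length = 1 := rfl
  rw [d_app _ _ hX hX, sy_add, sy_add, sy_smul, Fin.sum_univ_one, sy_smul,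
    sy_cup _ _ _ hX ht hd, sy_cup _ _ _ hX ht hd, sy_inner 0 _ _ hX hm, sy_powerCocycle,
    sy_powerCocycle, sy_powerCocycle, sy_one, sy_one, map_one, mul_one, one_mul]
  have h2 : sy ((0 : E (heckeCat k) k (1 + 1)).app [A, B] hX) = 0 := sy_zero
  rw [h2]
  change tr k (A.deg + 0) (powerSum v (B.deg + 0)) + (-1 : k) ^ (0 + 1) • powerSum v (A.deg + B.deg + 0) +
    (-1 : k) ^ (1 + 1) • powerSum v (A.deg + 0) = 0
  simp only [add_zero, powerSum_add, zero_add, pow_one, neg_smul, one_smul, even_two, Even.neg_pow,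
    one_add_one_eq_two, one_pow]
  abel

theorem ev_powerCocycle (v : Polynomial k) : ev k 1 (powerCocycle v) = ExteriorAlgebra.ι k v := by
  rw [← wedge_aeval]
  refine congrArg (wedge k 1) ((sy_powerCocycle v _ _).trans ?_)
  rw [sum_degs_pts, powerSum, Finset.sum_range_one]

/-- The exterior power is spanned by products of vectors, and cup products of the cocycles of degree
one are cocycles that map to them. -/
theorem exists_ev_eq {x : ExteriorAlgebra k (Polynomial k)} (hx : x ∈ ⋀[k]^n (Polynomial k)) :
    ∃ a ∈ Z (heckeCat k) k n, ev k n a = x := by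
  suffices h : LinearMap.range (ExteriorAlgebra.ι k (M := Polynomial k)) ^ n ≤
      (Z (heckeCat k) k n).map (ev k n) from h hx
  clear hx
  induction n with
  | zero =>
    rw [pow_zero, Submodule.one_le]
    exact ⟨_, one_mem_Z _ _, ev_one_zero⟩
  | succ n ih =>
    rw [pow_succ]
    refine Submodule.mul_le.2 ?_
    rintro y hy _ ⟨v, rfl⟩
    obtain ⟨a, ha, rfl⟩ := ih hy
    exact ⟨cup a (powerCocycle v), cup_mem_Z ha (powerCocycle_mem v), by
      rw [ev_cup, ev_powerCocycle]⟩

/-! ### The isomorphism in cohomology. -/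

variable (k n) in
/-- The evaluation of cocycles. -/
def evZ : Z (heckeCat k) k n →ₗ[k] ⋀[k]^n (Polynomial k) :=
  ((ev k n).codRestrict _ ev_mem).comp (Z (heckeCat k) k n).subtype

theorem evZ_surjective : Function.Surjective (evZ k n) := by
  rintro ⟨x, hx⟩
  obtain ⟨a, ha, rfl⟩ := exists_ev_eq hx
  exact ⟨⟨a, ha⟩, rfl⟩

theorem ker_evZ : LinearMap.ker (evZ k n) =
    (B (heckeCat k) k n).submoduleOf (Z (heckeCat k) k n) := by
  ext a
  rw [LinearMap.mem_ker, ← Subtype.coe_inj]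
  exact ⟨fun h => mem_B_of_ev a.2 h, fun h => ev_of_mem_B h⟩

variable (k n) in
/-- The isomorphism of the exterior powers of `k[x]` with the deformation cohomology of the degenerate affine
Hecke category. -/
def cohomologyEquiv : ⋀[k]^n (Polynomial k) ≃ₗ[k] H (heckeCat k) k n :=
  ((Submodule.quotEquivOfEq _ _ ker_evZ.symm).trans
    ((evZ k n).quotKerEquivOfSurjective evZ_surjective)).symm

theorem cohomologyEquiv_evZ (a : Z (heckeCat k) k n) :
    cohomologyEquiv k n (evZ k n a) = Submodule.Quotient.mk a :=
  (LinearEquiv.symm_apply_eq _).2 rfl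

theorem cohomologyEquiv_one :
    cohomologyEquiv k 0 ⟨1, SetLike.one_mem_graded _⟩ = H.one (heckeCat k) k := by
  refine Eq.trans ?_ (cohomologyEquiv_evZ ⟨one (heckeCat k) k 0, one_mem_Z _ _⟩)
  congr 1
  exact Subtype.ext ev_one_zero.symm

theorem cohomologyEquiv_mul (m n : ℕ) (a : ⋀[k]^m (Polynomial k)) (b : ⋀[k]^n (Polynomial k)) :
    cohomologyEquiv k (m + n) ⟨(a : ExteriorAlgebra k (Polynomial k)) * b,
      SetLike.mul_mem_graded a.2 b.2⟩ =
      H.cup (cohomologyEquiv k m a) (cohomologyEquiv k n b) := by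
  obtain ⟨a, rfl⟩ := evZ_surjective a
  obtain ⟨b, rfl⟩ := evZ_surjective b
  rw [cohomologyEquiv_evZ, cohomologyEquiv_evZ]
  refine Eq.trans ?_ (cohomologyEquiv_evZ ⟨cup a.1 b.1, cup_mem_Z a.2 b.2⟩)
  congr 1
  exact Subtype.ext (ev_cup a.1 b.1).symm

end

end TensorDeformation

namespace TensorDeformation

noncomputable section

open DAHA MvPolynomial

variable {k : Type w} [Field k] {n : ℕ}

/-! ### Tensor powers of `k[x]` and polynomials -/

namespace DAHA

variable (k) in
/-- The homomorphism `k[x]^{⊗ m} → k[X₀, X₁, …]`, `p₀ ⊗ ⋯ ↦ p₀(X₀) ⋯`. -/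
def tensorPoly (m : ℕ) : (⨂[k] _ : Fin m, Polynomial k) →ₐ[k] MvPolynomial ℕ k :=
  PiTensorProduct.liftAlgHom ((MultilinearMap.mkPiAlgebra k (Fin m) (MvPolynomial ℕ k)).compLinearMap
    fun i => (Polynomial.aeval (X (i : ℕ))).toLinearMap) (by simp) (by
      intro p q
      simp [Finset.prod_mul_distrib])

theorem tensorPoly_tprod (m : ℕ) (p : Fin m → Polynomial k) :
    tensorPoly k m (PiTensorProduct.tprod k p) = ∏ i : Fin m, Polynomial.aeval (X (i : ℕ)) (p i) := by
  refine (PiTensorProduct.lift.tprod _).trans ?_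
  simp

theorem polyMap_eq (m : ℕ) (z : ⨂[k] _ : Fin m, Polynomial k) :
    polyMap k m z = poly k m (tensorPoly k m z) := by
  induction z using PiTensorProduct.induction_on with
  | add z z' h h' => rw [map_add, map_add, map_add, h, h']
  | smul_tprod c p =>
    rw [map_smul, map_smul, map_smul, tensorPoly_tprod, polyMap, PiTensorProduct.lift.tprod,
      MultilinearMap.compLinearMap_apply, MultilinearMap.mkPiAlgebraFin_apply,
      ← List.prod_ofFn, map_list_prod, List.map_ofFn]
    congr 3
    funext i
    rw [Function.comp_apply, ← Polynomial.aeval_algHom_apply, poly_X, y'_of_lt i.2]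
    rfl

/-- The extension of a finite family of exponents by zero. -/
def extend {m : ℕ} (u : Fin m → ℕ) (i : ℕ) : ℕ := if h : i < m then u ⟨i, h⟩ else 0

theorem extend_apply {m : ℕ} (u : Fin m → ℕ) (i : Fin m) : extend u i = u i := dif_pos i.2

theorem sum_single_eq {m : ℕ} (u : Fin m → ℕ) :
    ∑ i : Fin m, Finsupp.single (i : ℕ) (u i) = cut m (extend u) := by
  ext j
  rw [Finsupp.finsetSum_apply, cut_apply]
  split_ifs with h
  · rw [Finset.sum_eq_single ⟨j, h⟩]
    · rw [Finsupp.single_eq_same, extend, dif_pos h]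
    · intro i _ hi
      rw [Finsupp.single_apply, if_neg fun h' => hi (Fin.ext h')]
    · exact fun h' => absurd (Finset.mem_univ _) h'
  · refine Finset.sum_eq_zero fun i _ => ?_
    rw [Finsupp.single_apply, if_neg]
    omega

variable (k) in
/-- The monomial basis of `k[x]^{⊗ m}`. -/
def tensorBasis (m : ℕ) : Module.Basis (Fin m → ℕ) k (⨂[k] _ : Fin m, Polynomial k) :=
  Basis.piTensorProduct fun _ => Polynomial.basisMonomials k

theorem tensorPoly_basis {m : ℕ} (u : Fin m → ℕ) :
    tensorPoly k m (tensorBasis k m u) = monomial (cut m (extend u)) 1 := by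
  rw [tensorBasis, Basis.piTensorProduct_apply, tensorPoly_tprod, ← sum_single_eq,
    monomial_sum_one]
  refine Finset.prod_congr rfl fun i _ => ?_
  rw [Polynomial.coe_basisMonomials, Polynomial.aeval_monomial, map_one, one_mul, X_pow_eq_monomial]

theorem cf_tensorPoly {m : ℕ} (z : ⨂[k] _ : Fin m, Polynomial k) (e : ℕ → ℕ) :
    cf m (tensorPoly k m z) e = (tensorBasis k m).repr z fun i => e i := by
  classical
  let f : (⨂[k] _ : Fin m, Polynomial k) →ₗ[k] k := lcoeff k (cut m e) ∘ₗ (tensorPoly k m).toLinearMap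
  let g : (⨂[k] _ : Fin m, Polynomial k) →ₗ[k] k :=
    Finsupp.lapply (fun i : Fin m => e i) ∘ₗ (tensorBasis k m).repr.toLinearMap
  refine DFunLike.congr_fun (f := f) (g := g) ((tensorBasis k m).ext fun u => ?_) z
  change coeff (cut m e) (tensorPoly k m (tensorBasis k m u)) =
    (tensorBasis k m).repr (tensorBasis k m u) fun i => e i
  rw [tensorPoly_basis, Module.Basis.repr_self, coeff_monomial, Finsupp.single_apply]
  congr 1
  refine propext ⟨fun h => funext fun i => ?_, fun h => cut_congr fun i hi => ?_⟩
  · have := DFunLike.congr_fun h (i : ℕ)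
    rwa [cut_apply, cut_apply, if_pos i.2, if_pos i.2, extend_apply] at this
  · exact (dif_pos hi).trans (congrFun h ⟨i, hi⟩)

theorem trunc_tensorPoly {m : ℕ} (z : ⨂[k] _ : Fin m, Polynomial k) :
    trunc k m (tensorPoly k m z) = tensorPoly k m z := by
  let f : (⨂[k] _ : Fin m, Polynomial k) →ₗ[k] MvPolynomial ℕ k :=
    (trunc k m).toLinearMap ∘ₗ (tensorPoly k m).toLinearMap
  refine DFunLike.congr_fun (f := f) (g := (tensorPoly k m).toLinearMap)
    ((tensorBasis k m).ext fun u => ?_) z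
  change trunc k m (tensorPoly k m (tensorBasis k m u)) = tensorPoly k m (tensorBasis k m u)
  rw [tensorPoly_basis, trunc_monomial, if_pos (cut_cut _)]

theorem tensorPoly_injective (m : ℕ) : Function.Injective (tensorPoly k m) := by
  intro z z' h
  refine (tensorBasis k m).repr.injective (Finsupp.ext fun u => ?_)
  have h1 := cf_tensorPoly z (extend u)
  have h2 := cf_tensorPoly z' (extend u)
  rw [h, h2] at h1
  simpa only [extend_apply] using h1.symm

theorem exists_tensorPoly {m : ℕ} {p : MvPolynomial ℕ k} (hp : trunc k m p = p) :
    ∃ z, tensorPoly k m z = p := by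
  have hinj : Function.Injective fun u : Fin m → ℕ => cut m (extend u) := by
    intro u v h
    funext i
    have := DFunLike.congr_fun h (i : ℕ)
    simpa only [cut_apply, if_pos i.2, extend_apply] using this
  have hfin : (Function.support fun u : Fin m → ℕ => coeff (cut m (extend u)) p).Finite :=
    (p.support.finite_toSet.preimage hinj.injOn).subset fun u hu => mem_support_iff.2 hu
  refine ⟨(tensorBasis k m).repr.symm (Finsupp.ofSupportFinite _ hfin),
    ext_cf (trunc_tensorPoly _) hp fun e => ?_⟩
  rw [cf_tensorPoly, LinearEquiv.apply_symm_apply]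
  exact cf_congr p fun i hi => dif_pos hi

theorem repr_reindex {m : ℕ} (σ : Equiv.Perm (Fin m)) (z : ⨂[k] _ : Fin m, Polynomial k)
    (u : Fin m → ℕ) :
    (tensorBasis k m).repr (PiTensorProduct.reindex k (fun _ => Polynomial k) σ z) u =
      (tensorBasis k m).repr z (u ∘ σ) := by
  induction z using PiTensorProduct.induction_on with
  | add z z' h h' => rw [map_add, map_add, map_add, Finsupp.add_apply, Finsupp.add_apply, h, h']
  | smul_tprod c p =>
    rw [map_smul, map_smul, map_smul, Finsupp.smul_apply, Finsupp.smul_apply,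
      PiTensorProduct.reindex_tprod, tensorBasis, Basis.piTensorProduct_repr_tprod_apply,
      Basis.piTensorProduct_repr_tprod_apply]
    congr 1
    refine (Fintype.prod_equiv σ _ _ fun i => ?_).symm
    rw [Equiv.symm_apply_apply]
    rfl

theorem blocks_singleton {m : ℕ} (e : ℕ → ℕ) :
    blocks [m] e = [(Finset.univ : Finset (Fin m)).val.map fun i : Fin m => e (i : ℕ)] := by
  rw [blocks, blocks]
  congr 1
  rw [Fin.univ_val_map]
  change (((List.range m).map e : List ℕ) : Multiset ℕ) = _
  exact congrArg _ (List.ext_getElem (by simp) (by simp))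

/-- Permuting the factors permutes the indices of the coordinates (`repr_reindex`). A symmetric
polynomial has coefficients that depend on the multiset of exponents alone; conversely, neighbouring
transpositions are among the permutations of the factors. -/
theorem tensorPoly_mem_Inv_iff {m : ℕ} (z : ⨂[k] _ : Fin m, Polynomial k) :
    tensorPoly k m z ∈ Inv k [m] ↔ z ∈ symPow k m := by
  have hs : [m].sum = m := List.sum_singleton
  constructor
  · intro h σ
    refine (tensorBasis k m).repr.injective (Finsupp.ext fun u => ?_)
    have h1 := cf_eq_of_blocks_eq h (e := extend (u ∘ σ)) (e' := extend u) (by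
      rw [blocks_singleton, blocks_singleton]
      simp only [extend_apply]
      rw [← Multiset.map_map, Multiset.map_univ_val_equiv])
    rw [hs, cf_tensorPoly, cf_tensorPoly] at h1
    simp only [extend_apply] at h1
    rw [repr_reindex]
    exact h1
  · intro h
    refine mem_Inv_of_cf (by rw [hs, trunc_tensorPoly]) ?_
    rintro i (hi | ⟨-, hi⟩) e
    · rw [hs, cf_tensorPoly, cf_tensorPoly]
      have h1 := repr_reindex (Equiv.swap ⟨i, by omega⟩ ⟨i + 1, hi⟩) z fun j => e j
      rw [h] at h1
      rw [h1]
      congr 1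
      funext j
      exact congrArg e (Fin.val_injective.map_swap (x := ⟨i, by omega⟩) (y := ⟨i + 1, hi⟩) (z := j)).symm
    · exact hi.elim

end DAHA

end

end TensorDeformation

namespace TensorDeformation

noncomputable section

open DAHA MvPolynomial

variable {k : Type w} [Field k] {n : ℕ}

/-! ### Block subalgebras of the degenerate affine Hecke algebras -/

theorem mem_block_cons (m : ℕ) (l : List ℕ) (a : DAHA k m) {b : DAHA k l.sum}
    (hb : (b : (heckeSeq k).A l.sum) ∈ (heckeSeq k).block l) :
    (μ m l.sum (a ⊗ₜ b) : (heckeSeq k).A (m :: l).sum) ∈ (heckeSeq k).block (m :: l) :=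
  ⟨a ⊗ₜ ⟨b, hb⟩, rfl⟩

theorem y_mem_block (l : List ℕ) (i : ℕ) (hi : i < l.sum) :
    (y k i hi : (heckeSeq k).A l.sum) ∈ (heckeSeq k).block l := by
  induction l generalizing i with
  | nil => exact absurd hi (Nat.not_lt_zero _)
  | cons m l ih =>
    by_cases h : i < m
    · have h1 := mem_block_cons m l (y k i h) (b := 1) (one_mem _)
      rw [μ_tmul, map_one, mul_one, shift_y] at h1
      exact h1
    · have hi' : i - m < l.sum := by
        rw [List.sum_cons] at hi
        omega
      have h1 := mem_block_cons m l 1 (ih (i - m) hi')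
      rw [μ_tmul, map_one, one_mul, shift_y] at h1
      have e : i - m + m = i := by omega
      simp only [e] at h1
      exact h1

theorem t_mem_block {l : List ℕ} {i : ℕ} (h : InBlock l i) (hi : i + 1 < l.sum) :
    (t k i hi : (heckeSeq k).A l.sum) ∈ (heckeSeq k).block l := by
  induction l generalizing i with
  | nil => exact h.elim
  | cons m l ih =>
    rcases h with h | ⟨h, h'⟩
    · have h1 := mem_block_cons m l (t k i h) (b := 1) (one_mem _)
      rw [μ_tmul, map_one, mul_one, shift_t] at h1
      exact h1
    · have hi' : i - m + 1 < l.sum := by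
        rw [List.sum_cons] at hi
        omega
      have h1 := mem_block_cons m l 1 (ih h' hi')
      rw [μ_tmul, map_one, one_mul, shift_t] at h1
      have e : i - m + m = i := by omega
      simp only [e] at h1
      exact h1

/-- The recursively defined image of the tensor product is generated by all `yᵢ` and by the `tᵢ`
inside the blocks, so the criterion for commuting with `blockAlg` describes the centralizer. -/
theorem mem_block_iff (l : List ℕ) (x : DAHA k l.sum) :
    (x : (heckeSeq k).A l.sum) ∈ (heckeSeq k).block l ↔ x ∈ blockAlg k l l.sum := by
  constructor
  · intro hx
    induction l with
    | nil => exact (bot_le : (⊥ : Subalgebra k (DAHA k 0)) ≤ blockAlg k [] 0) hx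
    | cons m l ih =>
      obtain ⟨w, rfl⟩ := hx
      induction w using TensorProduct.induction_on with
      | zero => rw [map_zero]; exact zero_mem _
      | tmul a b => exact tensor_mem_blockAlg _ _ a (ih b.1 b.2)
      | add w w' h h' => rw [map_add]; exact add_mem h h'
  · intro hx
    let S : Subalgebra k (DAHA k l.sum) := (heckeSeq k).block l
    exact blockAlg_le (S := S) (y_mem_block l) (fun i hi h => t_mem_block h hi) hx

theorem mem_centralizer_iff (l : List ℕ) (x : DAHA k l.sum) :
    (x : (heckeSeq k).A l.sum) ∈ (heckeSeq k).centralizer l ↔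
      x = poly k l.sum (sym k l.sum x) ∧ sym k l.sum x ∈ Inv k l := by
  rw [← commute_blockAlg_iff rfl]
  exact ⟨fun h b hb => h b ((mem_block_iff l b).2 hb), fun h b hb => h b ((mem_block_iff l b).1 hb)⟩

variable (k) in
/-- The isomorphism of the invariant polynomials with the centralizer. -/
def invCentralizer (l : List ℕ) : Inv k l ≃ₗ[k] (heckeSeq k).centralizer l where
  toFun p := ⟨poly k l.sum p.1, (mem_centralizer_iff l _).2 (by
    rw [sym_poly, p.2.1]
    exact ⟨rfl, p.2⟩)⟩
  map_add' p q := Subtype.ext (map_add (poly k l.sum) _ _)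
  map_smul' c p := Subtype.ext (map_smul (poly k l.sum) _ _)
  invFun x := ⟨sym k l.sum x.1, ((mem_centralizer_iff l _).1 x.2).2⟩
  left_inv p := Subtype.ext ((sym_poly p.1).trans p.2.1)
  right_inv x := Subtype.ext ((mem_centralizer_iff l _).1 x.2).1.symm

/-! ### Bases of orbit sums -/

/-- The lists of multisets of given cardinalities. -/
abbrev Blocks (l : List ℕ) : Type := {L : List (Multiset ℕ) // L.map Multiset.card = l}

theorem cf_eq_cf_pick {l : List ℕ} {p : MvPolynomial ℕ k} (hp : p ∈ Inv k l) (e : ℕ → ℕ) :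
    cf l.sum p e = cf l.sum p (pick (blocks l e)) := by
  refine cf_eq_of_blocks_eq hp ?_
  have := blocks_pick (blocks l e)
  rw [map_card_blocks] at this
  exact this.symm

theorem finite_cf {l : List ℕ} {p : MvPolynomial ℕ k} (hp : p ∈ Inv k l) :
    (Function.support fun L : Blocks l => cf l.sum p (pick L.1)).Finite := by
  have h := finOn_of_mem (G := fun L => cf l.sum p (pick L)) fun e => cf_eq_cf_pick hp e
  exact (h.preimage Subtype.val_injective.injOn).subset fun L hL => ⟨L.2, hL⟩

variable (k) in
/-- The coordinates of an invariant polynomial with respect to the orbit sums. -/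
def invCoord (l : List ℕ) : Inv k l →ₗ[k] Blocks l →₀ k where
  toFun p := Finsupp.ofSupportFinite _ (finite_cf p.2)
  map_add' _ _ := Finsupp.ext fun _ => cf_add _ _ _
  map_smul' _ _ := Finsupp.ext fun _ => cf_smul _ _ _

theorem invCoord_apply {l : List ℕ} (p : Inv k l) (L : Blocks l) :
    invCoord k l p L = cf l.sum p.1 (pick L.1) := rfl

/-- Injective because coefficients depend on the multisets only; surjective by `ofBlocks`, as a
finitely supported function satisfies the finiteness condition. -/
theorem invCoord_bijective (l : List ℕ) : Function.Bijective (invCoord k l) := by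
  classical
  constructor
  · intro p q h
    refine Subtype.ext (ext_cf p.2.1 q.2.1 fun e => ?_)
    rw [cf_eq_cf_pick p.2, cf_eq_cf_pick q.2]
    exact DFunLike.congr_fun h (⟨blocks l e, map_card_blocks l e⟩ : Blocks l)
  · intro G
    let G' : List (Multiset ℕ) → k := fun L => if h : L.map Multiset.card = l then G ⟨L, h⟩ else 0
    have hG' : ∀ L : Blocks l, G' L.1 = G L := fun L => dif_pos L.2
    have hf : FinOn l G' := by
      refine (G.support.finite_toSet.image Subtype.val).subset ?_
      rintro L ⟨h, hL⟩
      refine ⟨⟨L, h⟩, ?_, rfl⟩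
      rw [Finset.mem_coe, Finsupp.mem_support_iff, ← hG']
      exact hL
    refine ⟨⟨ofBlocks l G' hf, ofBlocks_mem hf⟩, Finsupp.ext fun L => ?_⟩
    rw [invCoord_apply, cf_ofBlocks, ← hG']
    have := blocks_pick L.1
    rw [L.2] at this
    rw [this]

variable (k) in
/-- The coordinates with respect to the orbit sums. -/
def invEquiv (l : List ℕ) : Inv k l ≃ₗ[k] Blocks l →₀ k :=
  LinearEquiv.ofBijective (invCoord k l) (invCoord_bijective l)

variable (k) in
/-- The symmetric power, as a space of invariant polynomials. -/
def symPowToInv (m : ℕ) : symPow k m →ₗ[k] Inv k [m] where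
  toFun z := ⟨tensorPoly k m z.1, (tensorPoly_mem_Inv_iff z.1).2 z.2⟩
  map_add' _ _ := Subtype.ext (map_add _ _ _)
  map_smul' _ _ := Subtype.ext (map_smul _ _ _)

theorem symPowToInv_bijective (m : ℕ) : Function.Bijective (symPowToInv k m) := by
  constructor
  · intro z z' h
    exact Subtype.ext (tensorPoly_injective m (congrArg Subtype.val h))
  · rintro ⟨p, hp⟩
    have h1 := hp.1
    rw [List.sum_singleton] at h1
    obtain ⟨z, rfl⟩ := exists_tensorPoly h1
    exact ⟨⟨z, (tensorPoly_mem_Inv_iff z).1 hp⟩, rfl⟩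

variable (k) in
/-- The basis of orbit sums of the symmetric power. -/
def symPowBasis (m : ℕ) : Module.Basis (Blocks [m]) k (symPow k m) :=
  .ofRepr ((LinearEquiv.ofBijective _ (symPowToInv_bijective m)).trans (invEquiv k [m]))

theorem symPowBasis_repr {m : ℕ} (z : symPow k m) (M : Blocks [m]) :
    (symPowBasis k m).repr z M = cf m (tensorPoly k m z.1) (pick M.1) := by
  change cf [m].sum _ _ = _
  rw [List.sum_singleton]
  rfl

theorem card_getD {l : List ℕ} (L : Blocks l) (i : Fin l.length) :
    [L.1.getD i 0].map Multiset.card = [l.get i] := by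
  obtain ⟨L, rfl⟩ := L
  have hi : (i : ℕ) < L.length := by simpa using i.2
  simp [hi]

/-- The entries of a list of multisets. -/
def entries (l : List ℕ) (L : Blocks l) (i : Fin l.length) : Blocks [l.get i] :=
  ⟨[L.1.getD i 0], card_getD L i⟩

theorem entries_bijective (l : List ℕ) : Function.Bijective (entries l) := by
  constructor
  · rintro ⟨L, h⟩ ⟨L', h'⟩ hL
    have h1 : L.length = l.length := by rw [← h, List.length_map]
    have h2 : L'.length = l.length := by rw [← h', List.length_map]
    refine Subtype.ext (List.ext_getElem (h1.trans h2.symm) fun i hi hi' => ?_)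
    have h3 := congrArg Subtype.val (congrFun hL ⟨i, h1 ▸ hi⟩)
    have h4 : i < L.length := hi
    have h5 : i < L'.length := hi'
    simpa [entries, h4, h5] using h3
  · intro M
    have hM : ∀ i, ∃ N : Multiset ℕ, (M i).1 = [N] ∧ N.card = l.get i := by
      intro i
      obtain ⟨N, hN⟩ := List.length_eq_one_iff.1 ((List.length_map Multiset.card).symm.trans
        (congrArg List.length (M i).2))
      have := (M i).2
      rw [hN] at this
      exact ⟨N, hN, by simpa using this⟩
    choose N hN hc using hM
    refine ⟨⟨List.ofFn N, List.ext_getElem (by simp) fun i hi hi' => ?_⟩, funext fun i =>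
      Subtype.ext ?_⟩
    · simpa using hc ⟨i, hi'⟩
    · rw [hN]
      simp [entries]

variable (k) in
/-- The isomorphism of the tensor product of symmetric powers with the invariant polynomials. -/
def symPowTensorInv (l : List ℕ) :
    (⨂[k] i : Fin l.length, symPow k (l.get i)) ≃ₗ[k] Inv k l :=
  -- The tensor products of orbit sums are indexed by tuples of multisets of the given sizes, and so
  -- are the orbit sums of the block-symmetric polynomials.
  ((Basis.piTensorProduct fun i => symPowBasis k (l.get i)).repr.trans
    (Finsupp.domLCongr (Equiv.ofBijective _ (entries_bijective l)).symm)).trans (invEquiv k l).symm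

theorem cf_symPowTensorInv {l : List ℕ} (x : ⨂[k] i : Fin l.length, symPow k (l.get i))
    (L : Blocks l) : cf l.sum (symPowTensorInv k l x).1 (pick L.1) =
      (Basis.piTensorProduct fun i => symPowBasis k (l.get i)).repr x (entries l L) := by
  change invEquiv k l ((invEquiv k l).symm _) L = _
  rw [LinearEquiv.apply_symm_apply]
  simp

/-! ### Products over the blocks, and multiplicativity. -/

/-- The polynomial that gives the product over the blocks. -/
def blockPoly : (l : List ℕ) → (∀ i : Fin l.length, symPow k (l.get i)) → MvPolynomial ℕ k
  | [], _ => 1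
  | m :: l, f => tensorPoly k m (f ⟨0, Nat.succ_pos _⟩).1 * tr k m (blockPoly l fun i => f i.succ)

theorem trunc_blockPoly (l : List ℕ) (f : ∀ i : Fin l.length, symPow k (l.get i)) :
    trunc k l.sum (blockPoly l f) = blockPoly l f := by
  induction l with
  | nil => exact map_one _
  | cons m l ih =>
    rw [blockPoly, List.sum_cons, map_mul, trunc_of_le (Nat.le_add_right m _) (trunc_tensorPoly _),
      trunc_tr (ih _)]

theorem blockProd_eq (l : List ℕ) (f : ∀ i : Fin l.length, symPow k (l.get i)) :
    blockProd k l f = poly k l.sum (blockPoly l f) := by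
  induction l with
  | nil => exact (map_one _).symm
  | cons m l ih =>
    rw [blockProd, polyMap_eq, ih, μ_poly _ _ (trunc_tensorPoly _) (trunc_blockPoly _ _)]
    rfl

theorem tensorPoly_coe_mul {m : ℕ} (z z' : symPow k m) :
    tensorPoly k m (z * z').1 = tensorPoly k m z.1 * tensorPoly k m z'.1 :=
  map_mul (tensorPoly k m) z.1 z'.1

theorem blockPoly_cons (m : ℕ) (l : List ℕ) (z : symPow k m)
    (f : ∀ i : Fin (m :: l).length, symPow k ((m :: l).get i)) (hz : f ⟨0, Nat.succ_pos _⟩ = z) :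
    blockPoly (m :: l) f = tensorPoly k m z.1 * tr k m (blockPoly l fun i => f i.succ) := by
  subst hz; rfl

theorem blockPoly_mul (l : List ℕ) (f g : ∀ i : Fin l.length, symPow k (l.get i)) :
    blockPoly l (f * g) = blockPoly l f * blockPoly l g := by
  induction l with
  | nil => exact (one_mul _).symm
  | cons m l ih =>
    let f' : ∀ i : Fin l.length, symPow k (l.get i) := fun i => f i.succ
    let g' : ∀ i : Fin l.length, symPow k (l.get i) := fun i => g i.succ
    have h1 : (f * g) ⟨0, Nat.succ_pos _⟩ = f ⟨0, Nat.succ_pos _⟩ * g ⟨0, Nat.succ_pos _⟩ := rfl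
    have h2 : (fun i : Fin l.length => (f * g) i.succ) = f' * g' := rfl
    rw [blockPoly_cons m l _ (f * g) h1, blockPoly_cons m l _ f rfl, blockPoly_cons m l _ g rfl, h2]
    have h3 := tensorPoly_coe_mul (m := m) (f ⟨0, Nat.succ_pos _⟩) (g ⟨0, Nat.succ_pos _⟩)
    erw [ih f' g', h3]
    rw [map_mul]
    ring

theorem blockPoly_one (l : List ℕ) :
    blockPoly l (1 : ∀ i : Fin l.length, symPow k (l.get i)) = 1 := by
  induction l with
  | nil => rfl
  | cons m l ih =>
    have h1 : (1 : ∀ i : Fin (m :: l).length, symPow k ((m :: l).get i)) ⟨0, Nat.succ_pos _⟩ =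
      (1 : symPow k m) := rfl
    rw [blockPoly_cons m l _ _ h1]
    have h2 : tensorPoly k m (1 : symPow k m).1 = 1 := map_one (tensorPoly k m)
    rw [h2, one_mul]
    exact (congrArg _ ih).trans (map_one _)

theorem cf_tensorPoly_pick {m : ℕ} (z : symPow k m) (e : ℕ → ℕ) :
    cf m (tensorPoly k m z.1) e = cf m (tensorPoly k m z.1) (pick [(Multiset.range m).map e]) := by
  have h := cf_eq_cf_pick ((tensorPoly_mem_Inv_iff z.1).2 z.2) e
  rw [List.sum_singleton] at h
  exact h

/-- The factors involve disjoint blocks of variables, so coefficients multiply; symmetry inside each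
block allows the exponents to be replaced by chosen ones. -/
theorem cf_blockPoly (l : List ℕ) (f : ∀ i : Fin l.length, symPow k (l.get i)) (e : ℕ → ℕ) :
    cf l.sum (blockPoly l f) e = ∏ i : Fin l.length,
      cf (l.get i) (tensorPoly k (l.get i) (f i).1) (pick [(blocks l e).getD i 0]) := by
  induction l generalizing e with
  | nil =>
    have h : ∀ i < ([] : List ℕ).sum, e i = 0 := fun i hi => absurd hi (Nat.not_lt_zero i)
    rw [blockPoly, cf_one, if_pos h]
    rfl
  | cons m l ih =>
    rw [blockPoly, List.sum_cons, cf_mul_tr (trunc_tensorPoly _), ih, cf_tensorPoly_pick]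
    exact (Fin.prod_univ_succ fun i : Fin (l.length + 1) =>
      cf ((m :: l).get i) (tensorPoly k ((m :: l).get i) (f i).1)
        (pick [(blocks (m :: l) e).getD i 0])).symm

/-- The coordinates of a pure tensor are products of coordinates, the same products as in
`cf_blockPoly`. This shows that the isomorphism obtained by matching bases is the prescribed map. -/
theorem symPowTensorInv_tprod (l : List ℕ) (f : ∀ i : Fin l.length, symPow k (l.get i)) :
    (symPowTensorInv k l (PiTensorProduct.tprod k f)).1 = blockPoly l f := by
  refine ext_cf (symPowTensorInv k l _).2.1 (trunc_blockPoly l f) fun e => ?_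
  rw [cf_eq_cf_pick (symPowTensorInv k l _).2, cf_blockPoly]
  refine (cf_symPowTensorInv _ (⟨blocks l e, map_card_blocks l e⟩ : Blocks l)).trans ?_
  rw [Basis.piTensorProduct_repr_tprod_apply]
  exact Finset.prod_congr rfl fun i _ => symPowBasis_repr _ _

/-- Pure tensors span, and on them the map is `blockPoly`, which is multiplicative since polynomials
commute. -/
theorem symPowTensorInv_mul (l : List ℕ) (x x' : ⨂[k] i : Fin l.length, symPow k (l.get i)) :
    (symPowTensorInv k l (x * x')).1 = (symPowTensorInv k l x).1 * (symPowTensorInv k l x').1 := by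
  let g : (⨂[k] i : Fin l.length, symPow k (l.get i)) →ₗ[k] MvPolynomial ℕ k :=
    (Inv k l).subtype ∘ₗ (symPowTensorInv k l).toLinearMap
  have hg : ∀ x x', g (x * x') = g x * g x' := by
    intro x x'
    induction x using PiTensorProduct.induction_on with
    | add x y hx hy => rw [add_mul, map_add, map_add, add_mul, hx, hy]
    | smul_tprod c f =>
      induction x' using PiTensorProduct.induction_on with
      | add x y hx hy => rw [mul_add, map_add, map_add, mul_add, hx, hy]
      | smul_tprod c' f' =>
        rw [PiTensorProduct.smul_tprod_mul_smul_tprod, map_smul, map_smul, map_smul,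
          smul_mul_smul_comm]
        congr 1
        have h : ∀ f, g (PiTensorProduct.tprod k f) = blockPoly l f := symPowTensorInv_tprod l
        rw [h, h, h, blockPoly_mul]
  exact hg x x'

variable (k) in
/-- The isomorphism of the tensor product of symmetric powers with the centralizer. -/
def centralizerEquiv (l : List ℕ) :
    (⨂[k] i : Fin l.length, symPow k (l.get i)) ≃ₐ[k] (heckeSeq k).centralizer l :=
  AlgEquiv.ofLinearEquiv ((symPowTensorInv k l).trans (invCentralizer k l))
    (Subtype.ext (by
      change poly k l.sum (symPowTensorInv k l 1).1 = 1
      rw [PiTensorProduct.one_def, symPowTensorInv_tprod, blockPoly_one, map_one]))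
    (fun x x' => Subtype.ext (by
      change poly k l.sum (symPowTensorInv k l (x * x')).1 =
        poly k l.sum (symPowTensorInv k l x).1 * poly k l.sum (symPowTensorInv k l x').1
      rw [symPowTensorInv_mul, map_mul]))

theorem centralizerEquiv_tprod (l : List ℕ) (f : ∀ i : Fin l.length, symPow k (l.get i)) :
    (centralizerEquiv k l (PiTensorProduct.tprod k f) : (heckeSeq k).A l.sum) = blockProd k l f := by
  change poly k l.sum (symPowTensorInv k l (PiTensorProduct.tprod k f)).1 = _
  rw [symPowTensorInv_tprod, blockProd_eq]

end

end TensorDeformation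

/-! ### The theorem. -/

theorem mainTheorem5 (k : Type w) [Field k] :
    (∃ φ : ∀ n : ℕ, ⋀[k]^n (Polynomial k) ≃ₗ[k]
        TensorDeformation.H (TensorDeformation.heckeCat k) k n,
      φ 0 ⟨1, SetLike.one_mem_graded _⟩ =
        TensorDeformation.H.one (TensorDeformation.heckeCat k) k ∧
      ∀ (m n : ℕ) (a : ⋀[k]^m (Polynomial k)) (b : ⋀[k]^n (Polynomial k)),
        φ (m + n) ⟨(a : ExteriorAlgebra k (Polynomial k)) * b,
            SetLike.mul_mem_graded a.2 b.2⟩ =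
          TensorDeformation.H.cup (φ m a) (φ n b)) ∧
    ∀ l : List ℕ,
      ∃ e : (⨂[k] i : Fin l.length, TensorDeformation.symPow k (l.get i)) ≃ₐ[k]
          (TensorDeformation.heckeSeq k).centralizer l,
        ∀ f : ∀ i : Fin l.length, TensorDeformation.symPow k (l.get i),
          (e (PiTensorProduct.tprod k f) : (TensorDeformation.heckeSeq k).A l.sum) =
            TensorDeformation.blockProd k l f := by
  exact ⟨⟨fun n => TensorDeformation.cohomologyEquiv k n, TensorDeformation.cohomologyEquiv_one,
    TensorDeformation.cohomologyEquiv_mul⟩, fun l => ⟨TensorDeformation.centralizerEquiv k l,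
    TensorDeformation.centralizerEquiv_tprod l⟩⟩
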